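/- **Theorem 1.1 (Non-asymptotic confidence intervals).** Let $\mathcal Q,\mathcal P$ be Polish spaces, $\nu^*$, $\rho^*$ probability measures on them, $\mathcal X=\mathcal Q\times\mathcal P$, $\mu^*=\nu^*\times\rho^*$, and let $(\Omega,\mathcal F,\mathcal F_t,X_t,P^x)_{x\in\mathcal X}$ be a time-homogeneous càdlàg Markov process in $\mathcal X$ with $X_0=x$ $P^x$-a.s., for which $\mu^*$ is invariant. Write $P^\mu=\int P^x\,d\mu(x)$, let $\langle\cdot,\cdot\rangle$ and $\|\cdot\|$ be the scalar product and norm of the real Hilbert space $L^2(\mu^*)$, and let $A$ be the generator on $L^2(\mu^*)$, with domain $D(A)$, of the semigroup $\mathcal P_tf(x)=E^x[f(X_t)]$. Let $(\Pi f)(q,p)=\int f(q,p')\,d\rho^*(p')$ and let $\mathsf T$ be the (closed) antisymmetric part of $A$, i.e. the closure of $\frac12(A-A^\dagger)$ defined on $D(A)\cap D(A^\dagger)$. Assume that $D(A)\cap D(A^\dagger)$ and the domain of $\mathsf T\Pi$ are dense, let $$B=(I+(\mathsf T\Pi)^\dagger(\mathsf T\Pi))^{-1}(-\mathsf T\Pi)^\dagger$$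 (extended by continuity from the domain of $(\mathsf T\Pi)^\dagger$ to $L^2(\mu^*)$), and for $\epsilon\in(0,1)$ put $\langle f,g\rangle_\epsilon=\langle f,g\rangle+\epsilon\langle f,(B+B^\dagger)g\rangle$. Let $\lambda_q,\lambda_p,R_0\ge 0$, let $\epsilon\in(0,1)$ satisfy $0<\epsilon<\dfrac{4\lambda_q\lambda_p}{4\lambda_q+R_0^2}$, and let $$\Lambda(\epsilon)=\frac{(\lambda_q-1)\epsilon+\lambda_p-\sqrt{((\lambda_q+1)\epsilon-\lambda_p)^2+\epsilon^2R_0^2}}{2}$$ (which is then positive). Suppose that the process satisfies the hypocoercive estimate $$\langle -Af,f\rangle_\epsilon\ \ge\ \Lambda(\epsilon)\,\mathrm{Var}_{\mu^*}[f]\qquad\text{for all } f\in D(A).$$ Let $\mu$ be a probability measure on $\mathcal X$ with $\mu\ll\mu^*$ and $\frac{d\mu}{d\mu^*}\in L^2(\mu^*)$. Then for every bounded measurable $f:\mathcal X\to\mathbb R$, every $T>0$ and every $\delta$ with $0<1-\delta<1$, $$P^\mu\left(\left|\frac1T\int_0^Tf(X_t)\,dt-\mu^*[f]\right|\le r\right)\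 \ge\ 1-\delta,\qquad r=\sqrt{2v\,\frac1T\log\left(\frac{2N}{\delta}\right)}+b\,\frac1T\log\left(\frac{2N}{\delta}\right),$$ where, with $\widehat f=f-\mu^*[f]$ and $\|\cdot\|_\infty$ the norm of $L^\infty(\mu^*)$, $$v=\frac{(1+\epsilon)(1-\frac{\epsilon^2}{4})}{1-\epsilon}\,\frac{2\,\mathrm{Var}_{\mu^*}[f]}{\Lambda(\epsilon)},\qquad b=\frac{(1+\epsilon)^2}{1-\epsilon}\,\frac{\|\widehat f\|_\infty}{\Lambda(\epsilon)},\qquad N=\frac{\left\|\frac{d\mu}{d\mu^*}\right\|}{\sqrt{1-\epsilon}}.$$ -/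

import Mathlib

open MeasureTheory ProbabilityTheory Filter Topology
open scoped NNReal ENNReal

noncomputable section

/-! ### Markov processes -/

/-- A time-homogeneous càdlàg Markov process `(Ω, ℱ, ℱ_t, X_t, P^x)`, `x ∈ E`, with state space `E`.
That `P` is a Markov kernel says that every `P^x` is a probability measure and that `x ↦ P^x` is
measurable. -/
structure MarkovProcess (E Ω : Type*) [TopologicalSpace E] [MeasurableSpace E]
    [mΩ : MeasurableSpace Ω] where
  /-- the filtration `ℱ_t` -/
  ℱ : Filtration ℝ≥0 mΩ
  /-- the process `X_t` -/
  X : ℝ≥0 → Ω → E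
  /-- the laws `P^x` -/
  P : Kernel E Ω
  isMarkovKernel : IsMarkovKernel P
  adapted : Adapted ℱ X
  /-- every path is right-continuous -/
  rightCts : ∀ ω t, ContinuousWithinAt (fun s => X s ω) (Set.Ici t) t
  /-- every path has left limits -/
  leftLim : ∀ ω t, ∃ l, Tendsto (fun s => X s ω) (𝓝[<] t) (𝓝 l)
  /-- `X_0 = x` almost surely under `P^x` -/
  start : ∀ x, ∀ᵐ ω ∂(P x), X 0 ω = x
  /-- the Markov property `P^x(X_{s+t} ∈ B | ℱ_s) = P^{X_s}(X_t ∈ B)`, tested on `F ∈ ℱ_s` -/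
  markov : ∀ x s t, ∀ B : Set E, MeasurableSet B → ∀ F : Set Ω, MeasurableSet[ℱ s] F →
    ∫⁻ ω in F, P (X s ω) (X t ⁻¹' B) ∂(P x) = P x (F ∩ X (s + t) ⁻¹' B)

attribute [instance] MarkovProcess.isMarkovKernel

namespace MarkovProcess

variable {E Ω : Type*} [TopologicalSpace E] [MeasurableSpace E] [MeasurableSpace Ω]

theorem measurable_X (M : MarkovProcess E Ω) (t : ℝ≥0) : Measurable (M.X t) :=
  (M.adapted t).mono (M.ℱ.le t) le_rfl

/-- The law `P^μ = ∫ P^x dμ(x)` of the process with initial distribution `μ`. -/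
def law (M : MarkovProcess E Ω) (μ : Measure E) : Measure Ω := μ.bind M.P

/-- The transition kernel `x ↦ P^x(X_t ∈ ·)`. -/
def transition (M : MarkovProcess E Ω) (t : ℝ≥0) : Kernel E E := M.P.map (M.X t)

instance (M : MarkovProcess E Ω) (t : ℝ≥0) : IsMarkovKernel (M.transition t) :=
  Kernel.IsMarkovKernel.map _ (M.measurable_X t)

/-- `μ` is an invariant measure of the process. -/
def IsInvariant (M : MarkovProcess E Ω) (μ : Measure E) : Prop :=
  ∀ t, (M.transition t).Invariant μ

end MarkovProcess

/-! ### The operator on `L²(μ)` of a Markov kernel with invariant measure `μ` -/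

section KernelOperator

set_option linter.unusedSectionVars false

variable {E : Type*} [MeasurableSpace E] {κ : Kernel E E} [IsMarkovKernel κ] {μ : Measure E}

theorem eLpNorm_integral_kernel_le (h : κ.Invariant μ) {f : E → ℝ} (hf : StronglyMeasurable f) :
    eLpNorm (fun x => ∫ y, f y ∂κ x) 2 μ ≤ eLpNorm f 2 μ := by
  rw [eLpNorm_eq_lintegral_rpow_enorm_toReal (by norm_num) (by norm_num),
    eLpNorm_eq_lintegral_rpow_enorm_toReal (by norm_num) (by norm_num)]
  refine ENNReal.rpow_le_rpow ?_ (by norm_num)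
  have h2 : ∫⁻ y, ‖f y‖ₑ ^ (2 : ℝ≥0∞).toReal ∂μ
      = ∫⁻ x, ∫⁻ y, ‖f y‖ₑ ^ (2 : ℝ≥0∞).toReal ∂κ x ∂μ := by
    conv_lhs => rw [← h.def]
    rw [Measure.lintegral_bind κ.aemeasurable]
    exact (hf.enorm.pow_const _).aemeasurable
  rw [h2]
  refine lintegral_mono fun x => ?_
  have h3 := eLpNorm_le_eLpNorm_of_exponent_le (μ := κ x) (p := 1) (q := 2) (by norm_num)
    hf.aestronglyMeasurable
  rw [eLpNorm_one_eq_lintegral_enorm,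
    eLpNorm_eq_lintegral_rpow_enorm_toReal (by norm_num) (by norm_num)] at h3
  have h4 := (enorm_integral_le_lintegral_enorm (μ := κ x) f).trans h3
  calc ‖∫ y, f y ∂κ x‖ₑ ^ (2 : ℝ≥0∞).toReal
      ≤ ((∫⁻ y, ‖f y‖ₑ ^ (2 : ℝ≥0∞).toReal ∂κ x) ^ (1 / (2 : ℝ≥0∞).toReal))
        ^ (2 : ℝ≥0∞).toReal := ENNReal.rpow_le_rpow h4 (by norm_num)
    _ = _ := by rw [← ENNReal.rpow_mul]; norm_num

theorem ae_kernel_of_ae (h : κ.Invariant μ) {p : E → Prop} (hp : ∀ᵐ x ∂μ, p x) :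
    ∀ᵐ x ∂μ, ∀ᵐ y ∂κ x, p y := by
  apply Measure.ae_ae_of_ae_comp
  rwa [h.def]

theorem memLp_integral_kernel (h : κ.Invariant μ) (f : Lp ℝ 2 μ) :
    MemLp (fun x => ∫ y, f y ∂κ x) 2 μ :=
  ⟨(StronglyMeasurable.integral_kernel (Lp.stronglyMeasurable f)).aestronglyMeasurable,
    (eLpNorm_integral_kernel_le h (Lp.stronglyMeasurable f)).trans_lt (Lp.eLpNorm_lt_top f)⟩

theorem ae_integrable_kernel (h : κ.Invariant μ) (f : Lp ℝ 2 μ) :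
    ∀ᵐ x ∂μ, Integrable f (κ x) := by
  have hf := Lp.memLp f
  have hfin : ∫⁻ x, ∫⁻ y, ‖f y‖ₑ ^ (2 : ℝ≥0∞).toReal ∂κ x ∂μ ≠ ∞ := by
    have h1 : Measurable fun y => ‖f y‖ₑ ^ (2 : ℝ≥0∞).toReal :=
      (Lp.stronglyMeasurable f).enorm.pow_const _
    rw [← Measure.lintegral_bind κ.aemeasurable h1.aemeasurable, h.def]
    exact (lintegral_rpow_enorm_lt_top_of_eLpNorm_lt_top (by norm_num) (by norm_num)
      hf.eLpNorm_lt_top).ne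
  have hm : Measurable fun x => ∫⁻ y, ‖f y‖ₑ ^ (2 : ℝ≥0∞).toReal ∂κ x :=
    ((Lp.stronglyMeasurable f).enorm.pow_const _).lintegral_kernel
  filter_upwards [ae_lt_top hm hfin] with x hx
  have : MemLp f 2 (κ x) := by
    refine ⟨(Lp.stronglyMeasurable f).aestronglyMeasurable, ?_⟩
    rw [eLpNorm_eq_lintegral_rpow_enorm_toReal (by norm_num) (by norm_num)]
    exact ENNReal.rpow_lt_top_of_nonneg (by norm_num) hx.ne
  exact this.integrable (by norm_num)

variable (κ μ) in
/-- The bounded operator `f ↦ (x ↦ ∫ f(y) κ(x, dy))` on the real Hilbert space `L²(μ)`, for a Markov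
kernel `κ` that leaves `μ` invariant. -/
def kernelL2 (h : κ.Invariant μ) : Lp ℝ 2 μ →L[ℝ] Lp ℝ 2 μ :=
  LinearMap.mkContinuous
    { toFun := fun f => (memLp_integral_kernel h f).toLp _
      map_add' := fun f g => by
        rw [← MemLp.toLp_add]
        refine MemLp.toLp_congr _ _ ?_
        filter_upwards [ae_kernel_of_ae h (Lp.coeFn_add f g), ae_integrable_kernel h f,
          ae_integrable_kernel h g] with x hx hf hg
        simp only [Pi.add_apply]
        rw [← integral_add hf hg]
        exact integral_congr_ae hx
      map_smul' := fun c f => by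
        rw [RingHom.id_apply, ← MemLp.toLp_const_smul]
        refine MemLp.toLp_congr _ _ ?_
        filter_upwards [ae_kernel_of_ae h (Lp.coeFn_smul c f)] with x hx
        simp only [Pi.smul_apply]
        rw [← integral_smul]
        exact integral_congr_ae hx } 1
    (fun f => by
      rw [one_mul, Lp.norm_def, Lp.norm_def]
      refine ENNReal.toReal_mono (Lp.eLpNorm_ne_top f) ?_
      simp only [LinearMap.coe_mk, AddHom.coe_mk]
      rw [eLpNorm_congr_ae (MemLp.coeFn_toLp _)]
      exact eLpNorm_integral_kernel_le h (Lp.stronglyMeasurable f))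

theorem kernelL2_ae (h : κ.Invariant μ) (f : Lp ℝ 2 μ) :
    kernelL2 κ μ h f =ᵐ[μ] fun x => ∫ y, f y ∂κ x :=
  MemLp.coeFn_toLp (memLp_integral_kernel h f)

end KernelOperator

/-! ### Unbounded operators on a real Hilbert space -/

section Operators

variable {H : Type*} [NormedAddCommGroup H] [InnerProductSpace ℝ H]

/-- The infinitesimal generator `A f = lim_{t ↓ 0} (S_t f - f) / t` of a family `S` of operators,
its domain being the set of all `f` for which the limit exists in norm. -/
def generator (S : ℝ≥0 → H →L[ℝ] H) : H →ₗ.[ℝ] H where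
  domain :=
    { carrier := {f | ∃ g, Tendsto (fun t : ℝ≥0 => (t : ℝ)⁻¹ • (S t f - f)) (𝓝[>] 0) (𝓝 g)}
      add_mem' := by
        rintro f f' ⟨g, hg⟩ ⟨g', hg'⟩
        refine ⟨g + g', (hg.add hg').congr fun t => ?_⟩
        rw [map_add, ← smul_add]
        congr 1
        abel
      zero_mem' := ⟨0, by simp⟩
      smul_mem' := by
        rintro c f ⟨g, hg⟩
        refine ⟨c • g, (hg.const_smul c).congr fun t => ?_⟩
        rw [map_smul, ← smul_sub, smul_comm] }
  toFun :=
    { toFun := fun f => f.2.choose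
      map_add' := fun f f' => by
        refine tendsto_nhds_unique (f + f').2.choose_spec
          ((f.2.choose_spec.add f'.2.choose_spec).congr fun t => ?_)
        rw [Submodule.coe_add, map_add, ← smul_add]
        congr 1
        abel
      map_smul' := fun c f => by
        refine tendsto_nhds_unique (c • f).2.choose_spec
          ((f.2.choose_spec.const_smul c).congr fun t => ?_)
        rw [Submodule.coe_smul, map_smul, ← smul_sub, smul_comm] }

theorem generator_spec (S : ℝ≥0 → H →L[ℝ] H) (f : (generator S).domain) :
    Tendsto (fun t : ℝ≥0 => (t : ℝ)⁻¹ • (S t f - f)) (𝓝[>] 0) (𝓝 (generator S f)) :=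
  f.2.choose_spec

/-- The composition `L ∘ K` of unbounded operators, with domain `{x ∈ D(K) | K x ∈ D(L)}`. -/
def compOp (L K : H →ₗ.[ℝ] H) : H →ₗ.[ℝ] H where
  domain := (L.domain.comap K.toFun).map K.domain.subtype
  toFun :=
    { toFun := fun x => L ⟨K ⟨x.1, by
          obtain ⟨y, -, hy⟩ := x.2
          exact hy ▸ y.2⟩, by
          obtain ⟨x, y, hy, rfl⟩ := x
          exact hy⟩
      map_add' := fun x y => by
        rw [← LinearPMap.map_add]
        congr 1
        apply Subtype.ext
        exact LinearPMap.map_add K ⟨x.1, _⟩ ⟨y.1, _⟩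
      map_smul' := fun c x => by
        rw [RingHom.id_apply, ← LinearPMap.map_smul]
        congr 1
        apply Subtype.ext
        exact LinearPMap.map_smul K c ⟨x.1, _⟩ }

theorem mem_compOp_domain (L K : H →ₗ.[ℝ] H) (x : H) :
    x ∈ (compOp L K).domain ↔ ∃ h : x ∈ K.domain, K ⟨x, h⟩ ∈ L.domain := by
  constructor
  · rintro ⟨y, hy, rfl⟩
    exact ⟨y.2, hy⟩
  · rintro ⟨h, h'⟩
    exact ⟨⟨x, h⟩, h', rfl⟩

/-- An everywhere defined bounded operator, as an unbounded operator. -/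
def fullOp (L : H →L[ℝ] H) : H →ₗ.[ℝ] H := (L : H →ₗ[ℝ] H).toPMap ⊤

open scoped Classical in
/-- The continuous extension to all of `H` of a bounded densely defined operator (and `0` if there
is no continuous extension). -/
def boundedExt (D : H →ₗ.[ℝ] H) : H →L[ℝ] H :=
  if h : ∃ B : H →L[ℝ] H, ∀ x : D.domain, B x = D x then h.choose else 0

variable [CompleteSpace H]

/-- The antisymmetric part `T = (A - A†) / 2` of `A`: the closure of the operator with domain
`D(A) ∩ D(A†)`. -/
def antisymmPart (A : H →ₗ.[ℝ] H) : H →ₗ.[ℝ] H := ((1 / 2 : ℝ) • (A - A.adjoint)).closure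

/-- The bounded operator `B = (I + K† K)⁻¹ (-K)†` for an unbounded operator `K`: the product on the
right-hand side lives on the domain of `K†`, and `B` is its continuous extension. -/
def auxOp (K : H →ₗ.[ℝ] H) : H →L[ℝ] H :=
  boundedExt (compOp (fullOp (ContinuousLinearMap.id ℝ H) + compOp K.adjoint K).inverse (-K).adjoint)

/-- The modified scalar product `⟨f, g⟩_ε = ⟨f, g⟩ + ε ⟨f, (B + B†) g⟩`. -/
def modInner (ε : ℝ) (B : H →L[ℝ] H) (f g : H) : ℝ :=
  inner ℝ f g + ε * inner ℝ f ((B + ContinuousLinearMap.adjoint B) g)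

end Operators

/-! ### Samplers on an extended phase space `Q × V` (positions and momenta) -/

section Sampler

variable {Q V Ω : Type*} [MeasurableSpace Q] [MeasurableSpace V] [MeasurableSpace Ω]

/-- The kernel `(q, p) ↦ δ_q ⊗ ρ`, that is, resampling the second component from `ρ`. -/
def refreshKernel (Q : Type*) [MeasurableSpace Q] (ρ : Measure V) :
    Kernel (Q × V) (Q × V) :=
  Kernel.deterministic Prod.fst measurable_fst ×ₖ Kernel.const (Q × V) ρ

instance (ρ : Measure V) [IsProbabilityMeasure ρ] : IsMarkovKernel (refreshKernel Q ρ) := by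
  unfold refreshKernel
  infer_instance

theorem refreshKernel_apply (ρ : Measure V) [IsProbabilityMeasure ρ] (z : Q × V) :
    refreshKernel Q ρ z = (Measure.dirac z.1).prod ρ := by
  rw [refreshKernel, Kernel.prod_apply, Kernel.deterministic_apply, Kernel.const_apply]

theorem refreshKernel_invariant (ν : Measure Q) [IsProbabilityMeasure ν] (ρ : Measure V)
    [IsProbabilityMeasure ρ] : (refreshKernel Q ρ).Invariant (ν.prod ρ) := by
  refine Measure.ext fun s hs => ?_
  rw [Measure.bind_apply hs (Kernel.aemeasurable _), Measure.prod_apply hs]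
  have h1 : ∀ z : Q × V, refreshKernel Q ρ z s = ρ (Prod.mk z.1 ⁻¹' s) := fun z => by
    rw [refreshKernel_apply, Measure.prod_apply hs,
      lintegral_dirac' _ (measurable_measure_prodMk_left hs)]
  simp_rw [h1]
  have h2 : Measurable fun z : Q × V => ρ (Prod.mk z.1 ⁻¹' s) :=
    (measurable_measure_prodMk_left hs).comp measurable_fst
  rw [lintegral_prod _ h2.aemeasurable]
  simp

/-- The projection `Π f (q, p) = ∫ f(q, p') dρ(p')` on `L²(ν ⊗ ρ)`. -/
def velocityAverage (ν : Measure Q) [IsProbabilityMeasure ν] (ρ : Measure V)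
    [IsProbabilityMeasure ρ] : Lp ℝ 2 (ν.prod ρ) →L[ℝ] Lp ℝ 2 (ν.prod ρ) :=
  kernelL2 (refreshKernel Q ρ) (ν.prod ρ) (refreshKernel_invariant ν ρ)

theorem velocityAverage_ae (ν : Measure Q) [IsProbabilityMeasure ν] (ρ : Measure V)
    [IsProbabilityMeasure ρ] (f : Lp ℝ 2 (ν.prod ρ)) :
    velocityAverage ν ρ f =ᵐ[ν.prod ρ] fun z => ∫ p, f (z.1, p) ∂ρ := by
  filter_upwards [kernelL2_ae (refreshKernel_invariant ν ρ) f] with z hz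
  rw [velocityAverage, hz, refreshKernel_apply, Measure.dirac_prod,
    integral_map (by fun_prop) (Lp.stronglyMeasurable f).aestronglyMeasurable]

/-- The generator `A` on `L²(μ)` of the semigroup `P_t f(x) = E^x[f(X_t)]`, for an invariant
measure `μ`. -/
def MarkovProcess.gen {E : Type*} [TopologicalSpace E] [MeasurableSpace E] (M : MarkovProcess E Ω)
    (μ : Measure E) (h : M.IsInvariant μ) : Lp ℝ 2 μ →ₗ.[ℝ] Lp ℝ 2 μ :=
  generator fun t => kernelL2 (M.transition t) μ (h t)

variable [TopologicalSpace Q] [TopologicalSpace V]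

/-- The operator `T Π`, where `T` is the antisymmetric part of the generator. -/
def MarkovProcess.transportOp (M : MarkovProcess (Q × V) Ω) (ν : Measure Q)
    [IsProbabilityMeasure ν] (ρ : Measure V) [IsProbabilityMeasure ρ]
    (h : M.IsInvariant (ν.prod ρ)) : Lp ℝ 2 (ν.prod ρ) →ₗ.[ℝ] Lp ℝ 2 (ν.prod ρ) :=
  compOp (antisymmPart (M.gen (ν.prod ρ) h)) (fullOp (velocityAverage ν ρ))

/-- The modified Poincaré inequality `⟨-A f, f⟩_ε ≥ Λ Var(f)` for all `f ∈ D(A)`, with the scalar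
product defined through `B = (I + (T Π)† (T Π))⁻¹ (-T Π)†`. -/
def MarkovProcess.HypocoerciveEstimate (M : MarkovProcess (Q × V) Ω) (ν : Measure Q)
    [IsProbabilityMeasure ν] (ρ : Measure V) [IsProbabilityMeasure ρ]
    (h : M.IsInvariant (ν.prod ρ)) (ε Λ : ℝ) : Prop :=
  ∀ f : (M.gen (ν.prod ρ) h).domain,
    Λ * variance (f : Lp ℝ 2 (ν.prod ρ)) (ν.prod ρ) ≤
      modInner ε (auxOp (M.transportOp ν ρ h)) (-(M.gen (ν.prod ρ) h f)) f

/-- `Λ(ε)`: the smallest eigenvalue of the matrix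
`[[ε λ_q, -ε R₀ / 2], [-ε R₀ / 2, λ_p - ε]]`. -/
def hypoGap (lq lp R₀ ε : ℝ) : ℝ :=
  ((lq - 1) * ε + lp - √(((lq + 1) * ε - lp) ^ 2 + ε ^ 2 * R₀ ^ 2)) / 2

end Sampler

end

/-! Chernoff's method reduces each tail to a bound `E^μ[exp(l ∫₀ᵀ V(X_t) dt)] ≤ N e^{κT}`, where `V`
is plus or minus the centred function. With `d` the density of `μ`, the left side is `E[d(X_0) exp(l
∫₀ᵀ V(X_t) dt)]` under the stationary law, a Feynman–Kac functional of the constant `1`, whose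
growth is governed by the operator `A + lV`.

Growth rate. The constants lie in the kernels of `A` and `A†`, so they are annihilated by `TΠ` and
orthogonal to its range. Hence `B 1 = 0` and the range of `B` is orthogonal to `1`; testing the
equation `(I + K†K) B x = (-K)† x`, `K = TΠ`, against its solution gives `‖B‖ ≤ 1/2`. The modified
form therefore dominates `(1 - ε)‖·‖²` and agrees with the usual scalar product against constants.
For `y = a + g` with `g` of mean zero, the hypocoercive estimate contributes `-Λ‖g‖²` to `⟨(A +
lV)y, y⟩_ε`, while `lV` contributes a term linear in `a g` and one quadratic in `g`. Completing the
square gives the Bernstein rate `κ = l² v / (2(1 - lb))` (`modInner_perturbation_le`).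

From rate to growth. No semigroup generated by `A + lV` is constructed. The implicit Euler steps
`y_n = (I - η(A + lV))^{-n} 1` exist for small `η` by a Neumann series, and dissipativity bounds
them by `(1 - ηκ)^{-n}` in the modified norm. Dynkin's formula and integration by parts show that
`⟨d, y_n⟩` is the average of the Feynman–Kac functional over a Gamma distributed time of shape `n`
and scale `η` (`gammaAverage_feynmanKac`). For `η = T/n` this time concentrates at `T`, and since
`V` is bounded and `d ≥ 0` the functional varies slowly in time. Letting `n → ∞` gives the bound at
`T` (`feynmanKac_le_exp`).

Optimising over `l` and applying the result to both signs of `V` gives the Bernstein inequality; the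
constants of the theorem are at least those obtained. -/

noncomputable section

/-! ### Closed operators, their adjoints, and the auxiliary operator `B`. -/

section UnboundedOperators

variable {H : Type*} [NormedAddCommGroup H] [InnerProductSpace ℝ H]

/-- The default value `0` is harmless: every property of `B` used later holds trivially for `0`, so
the existence of a continuous extension need not be shown. -/
theorem boundedExt_cases (D : H →ₗ.[ℝ] H) :
    boundedExt D = 0 ∨ ∀ x : D.domain, boundedExt D x = D x := by
  unfold boundedExt
  split_ifs with h
  · exact Or.inr h.choose_spec
  · exact Or.inl rfl

/-- The graph of the composition is the preimage of the graph of `L` under the continuous map `(x,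
y) ↦ (P x, y)`. -/
theorem compOp_isClosed_of_fullOp {L : H →ₗ.[ℝ] H} (hL : L.IsClosed) (P : H →L[ℝ] H) :
    (compOp L (fullOp P)).IsClosed := by
  have : ((compOp L (fullOp P)).graph : Set (H × H)) =
      (fun z : H × H => (P z.1, z.2)) ⁻¹' (L.graph : Set (H × H)) := by
    ext ⟨x, y⟩
    simp only [SetLike.mem_coe, LinearPMap.mem_graph_iff, Set.mem_preimage]
    constructor
    · rintro ⟨u, rfl, hu⟩
      obtain ⟨h, h'⟩ := (mem_compOp_domain _ _ _).1 u.2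
      exact ⟨⟨P u, h'⟩, rfl, hu⟩
    · rintro ⟨u, hu, hy⟩
      have hx : x ∈ (compOp L (fullOp P)).domain :=
        (mem_compOp_domain _ _ _).2 ⟨trivial, by change P x ∈ _; rw [← hu]; exact u.2⟩
      refine ⟨⟨x, hx⟩, rfl, ?_⟩
      rw [← hy]
      change L _ = L _
      congr 1
      exact Subtype.ext hu.symm
  rw [LinearPMap.IsClosed, this]
  exact IsClosed.preimage (by fun_prop) hL

variable [CompleteSpace H]

/-- A closed operator `K` and its adjoint decompose `H × H`: every `(a, b)` is `(x, K x) + (K† y, -y)`. -/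
theorem LinearPMap.IsClosed.exists_graph_decomposition {K : H →ₗ.[ℝ] H} (hK : K.IsClosed)
    (hd : Dense (K.domain : Set H)) (a b : H) :
    ∃ (x : K.domain) (y : K.adjoint.domain), a = x + K.adjoint y ∧ b = K x - y := by
  -- The decomposition is the orthogonal one along the closed graph of `K`, whose complement
  -- consists of the pairs `(K† y, -y)`. The product must carry the `ℓ²` norm to be a Hilbert space.
  let e := WithLp.prodContinuousLinearEquiv 2 ℝ H H
  let Γ : Submodule ℝ (WithLp 2 (H × H)) := K.graph.comap e.toLinearMap
  have hΓ : _root_.IsClosed (Γ : Set (WithLp 2 (H × H))) := _root_.IsClosed.preimage e.continuous hK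
  have : CompleteSpace Γ := hΓ.completeSpace_coe
  obtain ⟨p, hp, q, hq, hpq⟩ := Γ.exists_add_mem_mem_orthogonal (WithLp.toLp 2 (a, b))
  obtain ⟨x, hx1, hx2⟩ := (LinearPMap.mem_graph_iff K).1 (show e p ∈ K.graph from hp)
  have hq' : ∀ z : K.domain, inner ℝ q.fst (z : H) = inner ℝ (-q.snd) (K z) := by
    intro z
    have h := (Submodule.mem_orthogonal _ _).1 hq (WithLp.toLp 2 ((z : H), K z))
      (show e _ ∈ K.graph from (LinearPMap.mem_graph_iff K).2 ⟨z, rfl, rfl⟩)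
    rw [WithLp.prod_inner_apply] at h
    simp only at h
    rw [inner_neg_left, real_inner_comm (z : H), real_inner_comm (K z)]
    have h1 : inner ℝ (z : H) q.fst + inner ℝ (K z) q.snd = 0 := h
    linarith
  have hm : -q.snd ∈ K.adjoint.domain :=
    LinearPMap.mem_adjoint_domain_of_exists _ ⟨q.fst, hq'⟩
  refine ⟨x, ⟨-q.snd, hm⟩, ?_, ?_⟩
  · rw [LinearPMap.adjoint_apply_eq hd ⟨-q.snd, hm⟩ (x₀ := q.fst) hq', hx1]
    exact congrArg (fun z : WithLp 2 (H × H) => z.fst) hpq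
  · rw [hx2]
    simp only [sub_neg_eq_add]
    exact congrArg (fun z : WithLp 2 (H × H) => z.snd) hpq

/-- If `b` is orthogonal to `D(K†)`, decomposing `(0, b)` gives `K† y = -x` and `b = K x - y`, and
then `0 = ⟨y, b⟩ = -‖x‖² - ‖y‖²`. -/
theorem LinearPMap.IsClosed.dense_adjoint_domain {K : H →ₗ.[ℝ] H} (hK : K.IsClosed)
    (hd : Dense (K.domain : Set H)) : Dense (K.adjoint.domain : Set H) := by
  rw [Submodule.dense_iff_topologicalClosure_eq_top,
    Submodule.topologicalClosure_eq_top_iff, Submodule.eq_bot_iff]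
  intro b hb
  obtain ⟨x, y, h0, hxy⟩ := hK.exists_graph_decomposition hd 0 b
  have h1 : inner ℝ (y : H) b = 0 := (Submodule.mem_orthogonal _ _).1 hb _ y.2
  have h2 : inner ℝ (K.adjoint y) (x : H) = inner ℝ (y : H) (K x) :=
    LinearPMap.adjoint_isFormalAdjoint hd y x
  have h3 : K.adjoint y = -(x : H) := eq_neg_of_add_eq_zero_right h0.symm
  rw [hxy, inner_sub_right, ← h2, h3, inner_neg_left, real_inner_self_eq_norm_sq,
    real_inner_self_eq_norm_sq] at h1
  have hx : (x : H) = 0 := by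
    rw [← norm_eq_zero]; nlinarith [sq_nonneg ‖(x : H)‖, sq_nonneg ‖(y : H)‖]
  have hy : (y : H) = 0 := by
    rw [← norm_eq_zero]; nlinarith [sq_nonneg ‖(x : H)‖, sq_nonneg ‖(y : H)‖]
  have hx' : x = 0 := Subtype.ext hx
  rw [hxy, hy, hx', LinearPMap.map_zero, sub_zero]

/-- `I + K† K` as an unbounded operator. -/
def oneAddAdjointComp (K : H →ₗ.[ℝ] H) : H →ₗ.[ℝ] H :=
  fullOp (ContinuousLinearMap.id ℝ H) + compOp K.adjoint K

theorem mem_oneAddAdjointComp_domain {K : H →ₗ.[ℝ] H} (u : (oneAddAdjointComp K).domain) :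
    ∃ h : (u : H) ∈ K.domain, ∃ h' : K ⟨u, h⟩ ∈ K.adjoint.domain,
      oneAddAdjointComp K u = u + K.adjoint ⟨K ⟨u, h⟩, h'⟩ := by
  obtain ⟨h, h'⟩ := (mem_compOp_domain _ _ _).1 u.2.2
  exact ⟨h, h', rfl⟩

theorem inner_oneAddAdjointComp {K : H →ₗ.[ℝ] H} (hd : Dense (K.domain : Set H))
    (u : (oneAddAdjointComp K).domain) (w : K.domain) (h : (u : H) ∈ K.domain) :
      inner ℝ (oneAddAdjointComp K u) (w : H) = inner ℝ (u : H) w + inner ℝ (K ⟨u, h⟩) (K w) := by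
  obtain ⟨h, h', he⟩ := mem_oneAddAdjointComp_domain u
  rw [he, inner_add_left]
  congr 1
  exact LinearPMap.adjoint_isFormalAdjoint hd ⟨_, h'⟩ w

theorem ker_oneAddAdjointComp {K : H →ₗ.[ℝ] H} (hd : Dense (K.domain : Set H)) :
    (oneAddAdjointComp K).toFun.ker = ⊥ := by
  rw [LinearMap.ker_eq_bot']
  intro u hu
  obtain ⟨h, -, -⟩ := mem_oneAddAdjointComp_domain u
  have he := inner_oneAddAdjointComp hd u ⟨u, h⟩ h
  have hu' : oneAddAdjointComp K u = 0 := hu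
  rw [hu', inner_zero_left, real_inner_self_eq_norm_sq, real_inner_self_eq_norm_sq] at he
  refine Subtype.ext ?_
  rw [Submodule.coe_zero, ← norm_eq_zero]
  nlinarith [sq_nonneg ‖(u : H)‖, sq_nonneg ‖K ⟨(u : H), h⟩‖]

/-- Decomposing `(z, 0)` along the graph gives `K x = y` and `z = x + K† K x`. -/
theorem range_oneAddAdjointComp {K : H →ₗ.[ℝ] H} (hK : K.IsClosed)
    (hd : Dense (K.domain : Set H)) (z : H) : ∃ u, oneAddAdjointComp K u = z := by
  obtain ⟨x, y, h1, h2⟩ := hK.exists_graph_decomposition hd z 0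
  have hy : K x = y := sub_eq_zero.1 h2.symm
  have hx : (x : H) ∈ (compOp K.adjoint K).domain :=
    (mem_compOp_domain _ _ _).2 ⟨x.2, by rw [Subtype.coe_eta, hy]; exact y.2⟩
  refine ⟨⟨x, ⟨trivial, hx⟩⟩, ?_⟩
  obtain ⟨h, h', he⟩ := mem_oneAddAdjointComp_domain (K := K) ⟨x, ⟨trivial, hx⟩⟩
  rw [he, h1]
  congr 2
  exact Subtype.ext hy

theorem mem_adjoint_neg_domain {K : H →ₗ.[ℝ] H} {x : H} :
    x ∈ (-K).adjoint.domain ↔ x ∈ K.adjoint.domain := by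
  rw [LinearPMap.mem_adjoint_domain_iff, LinearPMap.mem_adjoint_domain_iff]
  have : ⇑((innerₛₗ ℝ x).comp (-K).toFun) = fun z => -((innerₛₗ ℝ x).comp K.toFun) z := by
    ext z
    change inner ℝ x (-(K z)) = -(inner ℝ x (K z))
    rw [inner_neg_right]
  constructor
  · intro h
    rw [this] at h
    refine h.neg.congr fun z => ?_
    exact neg_neg _
  · intro h
    rw [this]
    exact h.neg

/-- The solution `u` of the equation `(I + K† K) u = (-K)† x`, in weak form. -/
theorem auxOp_apply_spec {K : H →ₗ.[ℝ] H} (hK : K.IsClosed) (hd : Dense (K.domain : Set H)) :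
    auxOp K = 0 ∨ ∀ x ∈ K.adjoint.domain, ∃ h : auxOp K x ∈ K.domain, ∀ w : K.domain,
      inner ℝ (auxOp K x) (w : H) + inner ℝ (K ⟨auxOp K x, h⟩) (K w) = - inner ℝ x (K w) := by
  refine (boundedExt_cases _).imp id fun hB x hx => ?_
  have hx' := mem_adjoint_neg_domain.2 hx
  obtain ⟨u, hu⟩ := range_oneAddAdjointComp hK hd ((-K).adjoint ⟨x, hx'⟩)
  -- As `I + K† K` is onto, the product defining `B` is defined on the whole of `D(K†)`.
  have hr : (-K).adjoint ⟨x, hx'⟩ ∈ (oneAddAdjointComp K).inverse.domain := by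
    rw [LinearPMap.inverse_domain]
    exact ⟨u, hu⟩
  have hxd := (mem_compOp_domain (oneAddAdjointComp K).inverse (-K).adjoint x).2 ⟨hx', hr⟩
  have he : auxOp K x = u := by
    refine (hB ⟨x, hxd⟩).trans ?_
    exact LinearPMap.inverse_apply_eq (ker_oneAddAdjointComp hd) (y := ⟨_, hr⟩) (x := u) hu
  obtain ⟨h, -, -⟩ := mem_oneAddAdjointComp_domain u
  rw [he]
  refine ⟨h, fun w => ?_⟩
  rw [← inner_oneAddAdjointComp hd u w h, hu]
  have := LinearPMap.adjoint_isFormalAdjoint (T := -K) hd ⟨x, hx'⟩ w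
  rw [this]
  change inner ℝ x (-(K w)) = _
  rw [inner_neg_right]

/-- Testing with `w = u = B x` gives `‖u‖² + ‖K u‖² = -⟨x, K u⟩ ≤ ‖x‖ ‖K u‖`, and completing the
square leaves `‖u‖² ≤ ‖x‖² / 4`. Density of `D(K†)` does the rest. -/
theorem norm_auxOp_apply_le {K : H →ₗ.[ℝ] H} (hK : K.IsClosed) (hd : Dense (K.domain : Set H))
    (x : H) : ‖auxOp K x‖ ≤ 1 / 2 * ‖x‖ := by
  rcases auxOp_apply_spec hK hd with h0 | h
  · rw [h0]
    simp
  refine (hK.dense_adjoint_domain hd).induction (P := fun x => ‖auxOp K x‖ ≤ 1 / 2 * ‖x‖)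
    (fun x hx => ?_) (isClosed_le (by fun_prop) (by fun_prop)) x
  obtain ⟨hu, hw⟩ := h x hx
  have h1 := hw ⟨_, hu⟩
  simp only [real_inner_self_eq_norm_sq] at h1
  have h2 := abs_le.1 (abs_real_inner_le_norm x (K ⟨_, hu⟩))
  refine abs_le_of_sq_le_sq' ?_ (by positivity) |>.2
  nlinarith [sq_nonneg (‖K ⟨_, hu⟩‖ - 1 / 2 * ‖x‖)]

/-- The weak equation for `u = B e` has right-hand side zero, and testing it with `u` gives `‖u‖² +
‖K u‖² = 0`. -/
theorem auxOp_apply_eq_zero {K : H →ₗ.[ℝ] H} (hK : K.IsClosed) (hd : Dense (K.domain : Set H))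
    {e : H} (he : ∀ w : K.domain, inner ℝ e (K w) = 0) : auxOp K e = 0 := by
  rcases auxOp_apply_spec hK hd with h0 | h
  · rw [h0]
    simp
  have hm : e ∈ K.adjoint.domain := LinearPMap.mem_adjoint_domain_of_exists _
    ⟨0, fun w => by rw [he, inner_zero_left]⟩
  obtain ⟨hu, hw⟩ := h e hm
  have h1 := hw ⟨_, hu⟩
  rw [he, real_inner_self_eq_norm_sq, real_inner_self_eq_norm_sq] at h1
  rw [← norm_eq_zero]
  nlinarith [sq_nonneg ‖auxOp K e‖, sq_nonneg ‖K ⟨_, hu⟩‖]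

/-- With test function `e`, both terms of the weak equation that contain `K e` vanish. -/
theorem inner_auxOp_eq_zero {K : H →ₗ.[ℝ] H} (hK : K.IsClosed) (hd : Dense (K.domain : Set H))
    (e : K.domain) (he : K e = 0) (x : H) : inner ℝ (e : H) (auxOp K x) = 0 := by
  rcases auxOp_apply_spec hK hd with h0 | h
  · rw [h0]
    simp
  refine (hK.dense_adjoint_domain hd).induction
    (P := fun x => inner ℝ (e : H) (auxOp K x) = 0)
    (fun x hx => ?_) (isClosed_eq (by fun_prop) (by fun_prop)) x
  obtain ⟨hu, hw⟩ := h x hx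
  have h1 := hw e
  rw [he, inner_zero_right, inner_zero_right, add_zero, neg_zero] at h1
  rw [real_inner_comm, h1]

/-! ### The antisymmetric part -/

theorem inner_antisymm {A : H →ₗ.[ℝ] H} (hd : Dense (A.domain : Set H))
    (x y : ((1 / 2 : ℝ) • (A - A.adjoint)).domain) :
    inner ℝ (((1 / 2 : ℝ) • (A - A.adjoint)) x) (y : H) =
      - inner ℝ (x : H) (((1 / 2 : ℝ) • (A - A.adjoint)) y) := by
  have h1 : inner ℝ (A.adjoint ⟨x, x.2.2⟩) (y : H) = inner ℝ (x : H) (A ⟨y, y.2.1⟩) :=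
    LinearPMap.adjoint_isFormalAdjoint hd ⟨x, x.2.2⟩ ⟨y, y.2.1⟩
  have h2 : inner ℝ (A.adjoint ⟨y, y.2.2⟩) (x : H) = inner ℝ (y : H) (A ⟨x, x.2.1⟩) :=
    LinearPMap.adjoint_isFormalAdjoint hd ⟨y, y.2.2⟩ ⟨x, x.2.1⟩
  change inner ℝ ((1 / 2 : ℝ) • (A ⟨x, x.2.1⟩ - A.adjoint ⟨x, x.2.2⟩)) (y : H) =
    - inner ℝ (x : H) ((1 / 2 : ℝ) • (A ⟨y, y.2.1⟩ - A.adjoint ⟨y, y.2.2⟩))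
  rw [inner_smul_left, inner_smul_right, inner_sub_left, inner_sub_right, h1,
    real_inner_comm, ← h2, real_inner_comm (x : H) (A.adjoint _)]
  simp
  ring

/-- Antisymmetry says `-T ⊆ T†`, so `-T†` is a closed extension of `T`. -/
theorem antisymm_isClosable {A : H →ₗ.[ℝ] H}
    (hd : Dense ((A.domain ⊓ A.adjoint.domain : Submodule ℝ H) : Set H)) :
    ((1 / 2 : ℝ) • (A - A.adjoint)).IsClosable := by
  have hA : Dense (A.domain : Set H) := hd.mono inf_le_left
  set T := (1 / 2 : ℝ) • (A - A.adjoint) with hT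
  have hTd : Dense (T.domain : Set H) := hd
  have h1 : T.IsFormalAdjoint (-T) := by
    intro x y
    change inner ℝ (T x) (y : H) = inner ℝ (x : H) (-(T y))
    rw [inner_neg_right]
    exact inner_antisymm hA x y
  have h2 : -T ≤ T.adjoint := h1.le_adjoint hTd
  rw [LinearPMap.isClosable_iff_exists_closed_extension]
  refine ⟨-T.adjoint, ?_, ?_⟩
  · have h3 : T.adjoint.IsClosed := LinearPMap.adjoint_isClosed hTd
    have : ((-T.adjoint).graph : Set (H × H)) =
        (fun z : H × H => (z.1, -z.2)) ⁻¹' (T.adjoint.graph : Set (H × H)) := by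
      ext ⟨a, b⟩
      simp only [SetLike.mem_coe, LinearPMap.mem_graph_iff, Set.mem_preimage]
      constructor
      · rintro ⟨u, rfl, hu⟩
        exact ⟨u, rfl, by simp only [← hu]; exact (neg_neg _).symm⟩
      · rintro ⟨u, rfl, hu⟩
        exact ⟨u, rfl, (congrArg Neg.neg hu).trans (neg_neg _)⟩
    rw [LinearPMap.IsClosed, this]
    exact IsClosed.preimage (by fun_prop) h3
  · refine ⟨fun x hx => h2.1 hx, fun x y hxy => ?_⟩
    have := h2.2 (x := (x : (-T).domain)) (y := (y : T.adjoint.domain)) hxy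
    change T x = -(T.adjoint y)
    rw [← this]
    exact (neg_neg _).symm

theorem antisymmPart_isClosed {A : H →ₗ.[ℝ] H}
    (hd : Dense ((A.domain ⊓ A.adjoint.domain : Submodule ℝ H) : Set H)) :
    (antisymmPart A).IsClosed := (antisymm_isClosable hd).closure_isClosed

/-- If `A e = 0` and `A† e = 0` then `e` is in the domain of the antisymmetric part `T`, and `T e = 0`. -/
theorem antisymmPart_apply_eq_zero {A : H →ₗ.[ℝ] H} {e : H} (h : e ∈ A.domain)
    (h' : e ∈ A.adjoint.domain) (he : A ⟨e, h⟩ = 0) (he' : A.adjoint ⟨e, h'⟩ = 0) :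
    ∃ hT : e ∈ (antisymmPart A).domain, antisymmPart A ⟨e, hT⟩ = 0 := by
  have hle := LinearPMap.le_closure ((1 / 2 : ℝ) • (A - A.adjoint))
  refine ⟨hle.1 ⟨h, h'⟩, ?_⟩
  refine (hle.2 (x := ⟨e, ⟨h, h'⟩⟩) rfl).symm.trans ?_
  change (1 / 2 : ℝ) • (A ⟨e, h⟩ - A.adjoint ⟨e, h'⟩) = 0
  rw [he, he']
  simp

/-- If `A e = 0` and `A† e = 0` then `e` is orthogonal to the range of the antisymmetric part. -/
theorem inner_antisymmPart_eq_zero {A : H →ₗ.[ℝ] H}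
    (hd : Dense ((A.domain ⊓ A.adjoint.domain : Submodule ℝ H) : Set H)) {e : H} (h : e ∈ A.domain)
    (h' : e ∈ A.adjoint.domain) (he : A ⟨e, h⟩ = 0) (he' : A.adjoint ⟨e, h'⟩ = 0)
    (x : (antisymmPart A).domain) : inner ℝ e (antisymmPart A x) = 0 := by
  have hA : Dense (A.domain : Set H) := hd.mono inf_le_left
  have h1 : ((x : H), antisymmPart A x) ∈ ((1 / 2 : ℝ) • (A - A.adjoint)).closure.graph :=
    (LinearPMap.mem_graph_iff _).2 ⟨x, rfl, rfl⟩
  -- Orthogonality to `e` is a closed condition on the graph, so it suffices to check it before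
  -- taking the closure.
  rw [← (antisymm_isClosable hd).graph_closure_eq_closure_graph] at h1
  have h2 : IsClosed {z : H × H | inner ℝ e z.2 = 0} :=
    isClosed_eq (by fun_prop) continuous_const
  refine closure_minimal (s := (((1 / 2 : ℝ) • (A - A.adjoint)).graph : Set (H × H))) ?_ h2 h1
  rintro ⟨a, b⟩ hab
  obtain ⟨u, rfl, rfl⟩ := (LinearPMap.mem_graph_iff _).1 hab
  have h3 := inner_antisymm hA ⟨e, ⟨h, h'⟩⟩ u
  change inner ℝ ((1 / 2 : ℝ) • (A ⟨e, h⟩ - A.adjoint ⟨e, h'⟩)) (u : H) = _ at h3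
  rw [he, he', sub_zero, smul_zero, inner_zero_left] at h3
  exact neg_eq_zero.1 h3.symm

end UnboundedOperators

/-! ### Contraction semigroups, resolvents, and the modified scalar product. -/

section Semigroups

variable {H : Type*} [NormedAddCommGroup H] [InnerProductSpace ℝ H]

/-- A strongly continuous semigroup of contractions. -/
structure IsContractionSemigroup (S : ℝ≥0 → H →L[ℝ] H) : Prop where
  map_zero : ∀ f, S 0 f = f
  map_add : ∀ s t f, S (s + t) f = S s (S t f)
  norm_le : ∀ t f, ‖S t f‖ ≤ ‖f‖
  tendsto : ∀ f, Tendsto (fun t => S t f) (𝓝 0) (𝓝 f)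

variable {S : ℝ≥0 → H →L[ℝ] H}

namespace IsContractionSemigroup

theorem norm_sub_le (hS : IsContractionSemigroup S) (f : H) (s t : ℝ≥0) :
    ‖S t f - S s f‖ ≤ ‖S (nndist s t) f - f‖ := by
  wlog h : s ≤ t generalizing s t
  · rw [norm_sub_rev, nndist_comm]
    exact this t s (le_of_not_ge h)
  obtain ⟨r, rfl⟩ := exists_add_of_le h
  have h1 : nndist s (s + r) = r := by
    rw [NNReal.nndist_eq, add_tsub_cancel_left, tsub_eq_zero_of_le h]
    simp
  rw [h1, hS.map_add, ← map_sub]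
  exact hS.norm_le _ _

theorem continuous (hS : IsContractionSemigroup S) (f : H) : Continuous fun t => S t f := by
  rw [continuous_iff_continuousAt]
  intro s
  rw [ContinuousAt, tendsto_iff_norm_sub_tendsto_zero]
  have h1 : Tendsto (fun t => nndist s t) (𝓝 s) (𝓝 0) := by
    have : Continuous fun t => nndist s t := by fun_prop
    simpa using this.tendsto s
  have h2 := (tendsto_iff_norm_sub_tendsto_zero.1 (hS.tendsto f)).comp h1
  exact squeeze_zero (fun t => norm_nonneg _) (fun t => hS.norm_sub_le f s t) h2

theorem continuous_toNNReal (hS : IsContractionSemigroup S) (f : H) :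
    Continuous fun t : ℝ => S t.toNNReal f :=
  (hS.continuous f).comp continuous_real_toNNReal

theorem integrableOn_laplace (hS : IsContractionSemigroup S) {ω : ℝ} (hω : 0 < ω) (f : H) :
    IntegrableOn (fun t : ℝ => Real.exp (-ω * t) • S t.toNNReal f) (Set.Ioi 0) := by
  refine ((exp_neg_integrableOn_Ioi 0 hω).mul_const ‖f‖).mono'
    (Continuous.aestronglyMeasurable ?_) (ae_of_all _ fun t => ?_)
  · exact (Continuous.rexp (by fun_prop)).smul (hS.continuous_toNNReal f)
  · rw [norm_smul, Real.norm_of_nonneg (Real.exp_pos _).le]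
    exact mul_le_mul_of_nonneg_left (hS.norm_le _ _) (Real.exp_pos _).le

theorem integral_exp_neg_mul {ω : ℝ} (hω : 0 < ω) :
    ∫ t in Set.Ioi (0 : ℝ), Real.exp (-ω * t) = 1 / ω := by
  have := integral_exp_mul_Ioi (a := -ω) (by linarith) 0
  rw [this]
  simp

theorem norm_integral_laplace_le (hS : IsContractionSemigroup S) {ω : ℝ} (hω : 0 < ω) (f : H) :
    ‖∫ t in Set.Ioi (0 : ℝ), Real.exp (-ω * t) • S t.toNNReal f‖ ≤ 1 / ω * ‖f‖ := by
  rw [← integral_exp_neg_mul hω, ← integral_mul_const]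
  refine norm_integral_le_of_norm_le ((exp_neg_integrableOn_Ioi 0 hω).mul_const ‖f‖)
    (ae_of_all _ fun t => ?_)
  rw [norm_smul, Real.norm_of_nonneg (Real.exp_pos _).le]
  exact mul_le_mul_of_nonneg_left (hS.norm_le _ _) (Real.exp_pos _).le

/-- The resolvent `f ↦ ∫₀^∞ e^{-ω t} S_t f dt` of a contraction semigroup. -/
def resolvent (hS : IsContractionSemigroup S) {ω : ℝ} (hω : 0 < ω) : H →L[ℝ] H :=
  LinearMap.mkContinuous
    { toFun := fun f => ∫ t in Set.Ioi (0 : ℝ), Real.exp (-ω * t) • S t.toNNReal f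
      map_add' := fun f g => by
        rw [← integral_add (hS.integrableOn_laplace hω f) (hS.integrableOn_laplace hω g)]
        simp only [_root_.map_add, smul_add]
      map_smul' := fun c f => by
        rw [RingHom.id_apply, ← integral_smul]
        simp only [_root_.map_smul, smul_comm c] } (1 / ω)
    (hS.norm_integral_laplace_le hω)

theorem resolvent_apply (hS : IsContractionSemigroup S) {ω : ℝ} (hω : 0 < ω) (f : H) :
    hS.resolvent hω f = ∫ t in Set.Ioi (0 : ℝ), Real.exp (-ω * t) • S t.toNNReal f := rfl

theorem norm_resolvent_le (hS : IsContractionSemigroup S) {ω : ℝ} (hω : 0 < ω) :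
    ‖hS.resolvent hω‖ ≤ 1 / ω :=
  LinearMap.mkContinuous_norm_le _ (by positivity) _

variable [CompleteSpace H]

/-- A shift of the integration variable exhibits `S_s R f` as an explicitly differentiable function
of `s`; its derivative at `0` then identifies `A R f`. -/
theorem apply_resolvent (hS : IsContractionSemigroup S) {ω : ℝ} (hω : 0 < ω) (f : H) (s : ℝ≥0) :
    S s (hS.resolvent hω f) = Real.exp (ω * s) •
      (hS.resolvent hω f - ∫ t in (0 : ℝ)..s, Real.exp (-ω * t) • S t.toNNReal f) := by
  set g : ℝ → H := fun t => Real.exp (-ω * t) • S t.toNNReal f with hg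
  have hint : IntegrableOn g (Set.Ioi 0) := hS.integrableOn_laplace hω f
  have h1 : ∫ t in Set.Ioi (0 : ℝ), g (t + s) = ∫ t in Set.Ioi (s : ℝ), g t := by
    have := (measurePreserving_add_right volume (s : ℝ)).setIntegral_preimage_emb
      (measurableEmbedding_addRight (s : ℝ)) g (Set.Ioi (s : ℝ))
    rw [← this]
    simp
  have h2 : hS.resolvent hω f - ∫ t in (0 : ℝ)..s, g t = ∫ t in Set.Ioi (s : ℝ), g t := by
    rw [sub_eq_iff_eq_add', resolvent_apply]
    exact (intervalIntegral.integral_interval_add_Ioi hint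
      (hint.mono_set (Set.Ioi_subset_Ioi s.2))).symm
  rw [h2, ← h1, resolvent_apply, ← ContinuousLinearMap.integral_comp_comm _ hint, ← integral_smul]
  refine setIntegral_congr_fun measurableSet_Ioi fun t ht => ?_
  have ht' : (0 : ℝ) ≤ t := le_of_lt ht
  simp only [hg, _root_.map_smul, smul_smul, ← Real.exp_add]
  have h3 : (t + s).toNNReal = s + t.toNNReal := by
    rw [Real.toNNReal_add ht' s.coe_nonneg, Real.toNNReal_coe, add_comm]
  rw [← hS.map_add, h3]
  congr 2
  ring

theorem resolvent_mem_domain (hS : IsContractionSemigroup S) {ω : ℝ} (hω : 0 < ω) (f : H) :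
    ∃ h : hS.resolvent hω f ∈ (generator S).domain,
      generator S ⟨_, h⟩ = ω • hS.resolvent hω f - f := by
  have key : Tendsto (fun t : ℝ≥0 => (t : ℝ)⁻¹ • (S t (hS.resolvent hω f) - hS.resolvent hω f))
      (𝓝[>] 0) (𝓝 (ω • hS.resolvent hω f - f)) := by
    set g : ℝ → H := fun t => Real.exp (-ω * t) • S t.toNNReal f with hg
    have hc : Continuous g := (Continuous.rexp (by fun_prop)).smul (hS.continuous_toNNReal f)
    have h1 : HasDerivAt (fun s : ℝ => Real.exp (ω * s)) ω 0 := by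
      simpa using ((hasDerivAt_id (0 : ℝ)).const_mul ω).exp
    have h2 : HasDerivAt (fun s : ℝ => hS.resolvent hω f - ∫ t in (0 : ℝ)..s, g t) (-g 0) 0 :=
      (intervalIntegral.integral_hasDerivAt_right (hc.intervalIntegrable _ _)
        (hc.stronglyMeasurableAtFilter _ _) hc.continuousAt).const_sub _
    have h3 := (h1.smul h2).tendsto_slope_zero_right
    have h4 : Tendsto (fun t : ℝ≥0 => (t : ℝ)) (𝓝[>] 0) (𝓝[>] 0) := by
      refine tendsto_nhdsWithin_iff.2 ⟨?_, ?_⟩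
      · exact (NNReal.continuous_coe.tendsto' 0 0 rfl).mono_left nhdsWithin_le_nhds
      · filter_upwards [self_mem_nhdsWithin] with t ht using ht
    have h5 := h3.comp h4
    have h6 : g 0 = f := by simp [hg, hS.map_zero]
    simp only [h6, intervalIntegral.integral_same, mul_zero, Real.exp_zero, one_smul, sub_zero,
      smul_neg, Pi.smul_apply', zero_add] at h5
    rw [sub_eq_add_neg, add_comm]
    refine h5.congr fun t => ?_
    simp only [Function.comp_apply]
    rw [hS.apply_resolvent hω]
  exact ⟨⟨_, key⟩, tendsto_nhds_unique (generator_spec S ⟨_, ⟨_, key⟩⟩) key⟩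

/-- The range condition for a bounded perturbation of the generator. -/
theorem exists_sub_smul_generator_add (hS : IsContractionSemigroup S) (V : H →L[ℝ] H) {h : ℝ}
    (h0 : 0 < h) (hV : h * ‖V‖ < 1) (z : H) :
    ∃ y : (generator S).domain, (y : H) - h • (generator S y + V y) = z := by
  have hω : 0 < 1 / h := by positivity
  -- The ansatz `y = R w` with the resolvent at `1 / h` turns the equation into `h (w - V R w) = z`,
  -- solvable by a Neumann series because `‖V R‖ ≤ h ‖V‖ < 1`.
  set R := hS.resolvent hω with hR
  have hn : ‖V * R‖ < 1 := by
    refine (norm_mul_le _ _).trans_lt ?_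
    refine (mul_le_mul_of_nonneg_left (hS.norm_resolvent_le hω) (norm_nonneg _)).trans_lt ?_
    rw [one_div_one_div, mul_comm]
    exact hV
  obtain ⟨u, hu⟩ := isUnit_one_sub_of_norm_lt_one hn
  let w : H := (↑u⁻¹ : H →L[ℝ] H) (h⁻¹ • z)
  have hw : w - V (R w) = h⁻¹ • z := by
    have h1 : (u : H →L[ℝ] H) * (↑u⁻¹ : H →L[ℝ] H) = 1 := u.mul_inv
    have h2 := congrArg (fun T : H →L[ℝ] H => T (h⁻¹ • z)) h1
    rw [hu] at h2
    exact h2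
  obtain ⟨hd, hg⟩ := hS.resolvent_mem_domain hω w
  refine ⟨⟨_, hd⟩, ?_⟩
  rw [hg]
  change R w - h • ((1 / h) • R w - w + V (R w)) = z
  have h3 : (1 / h) • R w - w + V (R w) = h⁻¹ • R w - (w - V (R w)) := by
    rw [one_div]
    abel
  rw [h3, hw, smul_sub, smul_smul, smul_smul, mul_inv_cancel₀ h0.ne', one_smul, one_smul]
  abel

end IsContractionSemigroup

variable [CompleteSpace H]

theorem modInner_add_left (ε : ℝ) (B : H →L[ℝ] H) (f g k : H) :
    modInner ε B (f + g) k = modInner ε B f k + modInner ε B g k := by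
  simp only [modInner, inner_add_left]
  ring

theorem modInner_smul_left (ε : ℝ) (B : H →L[ℝ] H) (c : ℝ) (f k : H) :
    modInner ε B (c • f) k = c * modInner ε B f k := by
  simp only [modInner, inner_smul_left, conj_trivial]
  ring

theorem modInner_comm (ε : ℝ) (B : H →L[ℝ] H) (f g : H) :
    modInner ε B f g = modInner ε B g f := by
  simp only [modInner, add_apply, inner_add_right,
    ContinuousLinearMap.adjoint_inner_right]
  rw [real_inner_comm f g, real_inner_comm f (B g), real_inner_comm (B f) g]
  ring

theorem modInner_add_right (ε : ℝ) (B : H →L[ℝ] H) (f g k : H) :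
    modInner ε B k (f + g) = modInner ε B k f + modInner ε B k g := by
  rw [modInner_comm, modInner_add_left, modInner_comm, modInner_comm ε B g]

theorem modInner_smul_right (ε : ℝ) (B : H →L[ℝ] H) (c : ℝ) (f k : H) :
    modInner ε B k (c • f) = c * modInner ε B k f := by
  rw [modInner_comm, modInner_smul_left, modInner_comm]

theorem norm_add_adjoint_apply_le {B : H →L[ℝ] H} (hB : ∀ x, ‖B x‖ ≤ 1 / 2 * ‖x‖) (g : H) :
    ‖(B + ContinuousLinearMap.adjoint B) g‖ ≤ ‖g‖ := by
  have h1 : ‖ContinuousLinearMap.adjoint B‖ ≤ 1 / 2 := by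
    rw [LinearIsometryEquiv.norm_map]
    exact B.opNorm_le_bound (by norm_num) hB
  have h2 := (ContinuousLinearMap.adjoint B).le_of_opNorm_le h1 g
  calc _ ≤ ‖B g‖ + ‖ContinuousLinearMap.adjoint B g‖ := norm_add_le _ _
    _ ≤ 1 / 2 * ‖g‖ + 1 / 2 * ‖g‖ := add_le_add (hB g) h2
    _ = ‖g‖ := by ring

theorem abs_modInner_sub_inner_le {ε : ℝ} (hε : 0 ≤ ε) {B : H →L[ℝ] H}
    (hB : ∀ x, ‖B x‖ ≤ 1 / 2 * ‖x‖) (f g : H) :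
    |modInner ε B f g - inner ℝ f g| ≤ ε * (‖f‖ * ‖g‖) := by
  rw [modInner, add_sub_cancel_left, abs_mul, abs_of_nonneg hε]
  refine mul_le_mul_of_nonneg_left ?_ hε
  exact (abs_real_inner_le_norm _ _).trans
    (mul_le_mul_of_nonneg_left (norm_add_adjoint_apply_le hB g) (norm_nonneg _))

theorem abs_modInner_le {ε : ℝ} (hε : 0 ≤ ε) {B : H →L[ℝ] H}
    (hB : ∀ x, ‖B x‖ ≤ 1 / 2 * ‖x‖) (f g : H) :
    |modInner ε B f g| ≤ (1 + ε) * (‖f‖ * ‖g‖) := by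
  have h1 := abs_modInner_sub_inner_le hε hB f g
  have h2 := abs_real_inner_le_norm f g
  have h3 := abs_add_le (modInner ε B f g - inner ℝ f g) (inner ℝ f g)
  rw [sub_add_cancel] at h3
  linarith

theorem le_modInner_self {ε : ℝ} (hε : 0 ≤ ε) {B : H →L[ℝ] H}
    (hB : ∀ x, ‖B x‖ ≤ 1 / 2 * ‖x‖) (f : H) : (1 - ε) * ‖f‖ ^ 2 ≤ modInner ε B f f := by
  have h1 := (abs_le.1 (abs_modInner_sub_inner_le hε hB f f)).1
  rw [real_inner_self_eq_norm_sq] at h1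
  linarith

/-- Resolvent bound for an operator `L` satisfying `⟨L y, y⟩_ε ≤ κ ⟨y, y⟩_ε`. -/
theorem modInner_resolvent_le {ε : ℝ} {B : H →L[ℝ] H} (hpos : ∀ f, 0 ≤ modInner ε B f f)
    {κ h : ℝ} (h0 : 0 ≤ h) (hκ : h * κ ≤ 1) {y Ly z : H} (hz : y - h • Ly = z)
    (hd : modInner ε B Ly y ≤ κ * modInner ε B y y) :
    (1 - h * κ) ^ 2 * modInner ε B y y ≤ modInner ε B z z := by
  set α := 1 - h * κ with hα
  have hα0 : 0 ≤ α := by linarith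
  have h1 : α * modInner ε B y y ≤ modInner ε B z y := by
    rw [← hz, sub_eq_add_neg, modInner_add_left, ← neg_smul, modInner_smul_left]
    have := mul_le_mul_of_nonneg_left hd h0
    rw [hα]
    linarith
  -- In place of Cauchy–Schwarz for the form: `⟨z, z⟩ ≥ 2α⟨z, y⟩ - α²⟨y, y⟩ ≥ α²⟨y, y⟩`.
  have h2 := hpos (z + (-α) • y)
  simp only [modInner_add_left, modInner_add_right, modInner_smul_left, modInner_smul_right] at h2
  rw [modInner_comm ε B y z] at h2
  have h3 := mul_le_mul_of_nonneg_left h1 hα0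
  nlinarith

/-- Implicit Euler steps for a bounded perturbation of the generator. -/
theorem IsContractionSemigroup.exists_euler_sequence (hS : IsContractionSemigroup S)
    (V : H →L[ℝ] H) {ε : ℝ} {B : H →L[ℝ] H} (hpos : ∀ f, 0 ≤ modInner ε B f f) {κ h : ℝ}
    (h0 : 0 < h) (hV : h * ‖V‖ < 1) (hκ : h * κ ≤ 1)
    (hd : ∀ y : (generator S).domain,
      modInner ε B (generator S y + V y) y ≤ κ * modInner ε B y y) (e : H) :
    ∃ y : ℕ → H, y 0 = e ∧
      (∀ n, ∃ hy : y (n + 1) ∈ (generator S).domain,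
        y (n + 1) - h • (generator S ⟨_, hy⟩ + V (y (n + 1))) = y n) ∧
      ∀ n, (1 - h * κ) ^ (2 * n) * modInner ε B (y n) (y n) ≤ modInner ε B e e := by
  choose r hr using hS.exists_sub_smul_generator_add V h0 hV
  let y : ℕ → H := fun n => n.rec e fun _ x => (r x : H)
  have hy : ∀ n, y (n + 1) = r (y n) := fun n => rfl
  refine ⟨y, rfl, fun n => ⟨(r (y n)).2, hr (y n)⟩, fun n => ?_⟩
  induction n with
  | zero => simp [y]
  | succ n ih =>
    have h1 := modInner_resolvent_le hpos h0.le hκ (hr (y n)) (hd (r (y n)))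
    refine le_trans ?_ ih
    rw [mul_add, mul_one, pow_add, mul_assoc, hy]
    refine mul_le_mul_of_nonneg_left h1 ?_
    rw [pow_mul]
    positivity

end Semigroups

/-! ### Joint measurability of right-continuous processes. -/

section RightContinuousProcess

variable {Ω E : Type*} [MeasurableSpace Ω] [TopologicalSpace E] [MeasurableSpace E]

/-- The `+ 1` in the numerator puts the grid points to the right of `r`, where right-continuity of
the paths can be used. -/
theorem tendsto_floor_add_one_div (r : ℝ≥0) :
    Tendsto (fun n : ℕ => ((⌊r * (n + 1)⌋₊ : ℝ≥0) + 1) / (n + 1)) atTop (𝓝[≥] r) := by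
  refine tendsto_nhdsWithin_iff.2 ⟨?_, Eventually.of_forall fun n => ?_⟩
  · have h1 : Tendsto (fun n : ℕ => r + 1 / ((n : ℝ≥0) + 1)) atTop (𝓝 r) := by
      simpa using tendsto_const_nhds.add (tendsto_one_div_add_atTop_nhds_zero_nat (𝕜 := ℝ≥0))
    refine tendsto_of_tendsto_of_tendsto_of_le_of_le tendsto_const_nhds h1 (fun n => ?_)
      (fun n => ?_)
    · change r ≤ _
      rw [le_div_iff₀ (by positivity)]
      exact (Nat.lt_floor_add_one _).le
    · change _ / _ ≤ r + 1 / _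
      rw [add_div]
      gcongr
      rw [div_le_iff₀ (by positivity)]
      exact Nat.floor_le (by positivity)
  · change r ≤ _
    rw [le_div_iff₀ (by positivity)]
    exact (Nat.lt_floor_add_one _).le

/-- A right-continuous process with measurable marginals is jointly measurable. -/
theorem measurable_uncurry_of_rightCts [TopologicalSpace.PseudoMetrizableSpace E] [BorelSpace E]
    {Z : ℝ≥0 → Ω → E} (hm : ∀ t, Measurable (Z t))
    (hr : ∀ ω t, ContinuousWithinAt (fun s => Z s ω) (Set.Ici t) t) :
    Measurable fun p : ℝ≥0 × Ω => Z p.1 p.2 := by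
  refine measurable_of_tendsto_metrizable
    (f := fun (n : ℕ) (p : ℝ≥0 × Ω) => Z (((⌊p.1 * (n + 1)⌋₊ : ℝ≥0) + 1) / (n + 1)) p.2)
    (fun n => ?_) (tendsto_pi_nhds.2 fun p => ?_)
  · let G : ℕ × Ω → E := fun q => Z (((q.1 : ℝ≥0) + 1) / (n + 1)) q.2
    have h1 : Measurable G :=
      measurable_from_prod_countable_right fun k => hm (((k : ℝ≥0) + 1) / (n + 1))
    have h2 : Measurable fun p : ℝ≥0 × Ω => (⌊p.1 * (n + 1)⌋₊, p.2) :=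
      (Nat.measurable_floor.comp (measurable_fst.mul_const _)).prodMk measurable_snd
    have h3 := h1.comp h2
    exact h3
  · exact (hr p.2 p.1).tendsto.comp (tendsto_floor_add_one_div p.1)

theorem measurable_integral_comp_of_rightCts [TopologicalSpace.PseudoMetrizableSpace E]
    [BorelSpace E] {Z : ℝ≥0 → Ω → E} (hm : ∀ t, Measurable (Z t))
    (hr : ∀ ω t, ContinuousWithinAt (fun s => Z s ω) (Set.Ici t) t) {V : E → ℝ}
    (hV : Measurable V) (a b : ℝ) :
    StronglyMeasurable fun ω => ∫ r in a..b, V (Z r.toNNReal ω) := by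
  have h1 : Measurable fun p : Ω × ℝ => V (Z p.2.toNNReal p.1) :=
    hV.comp ((measurable_uncurry_of_rightCts hm hr).comp
      ((measurable_real_toNNReal.comp measurable_snd).prodMk measurable_fst))
  simp only [intervalIntegral]
  exact (h1.stronglyMeasurable.integral_prod_right').sub h1.stronglyMeasurable.integral_prod_right'

end RightContinuousProcess

/-! ### The stationary law and the Markov property in `L²`. -/

theorem integral_bind_kernel {α β : Type*} [MeasurableSpace α] [MeasurableSpace β] {m : Measure α}
    {κ : Kernel α β} {f : β → ℝ} (hf : Integrable f (m.bind κ)) :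
    ∫ y, f y ∂(m.bind κ) = ∫ x, ∫ y, f y ∂κ x ∂m := by
  have h1 : (κ ∘ₖ Kernel.const Unit m) () = m.bind κ := by
    rw [Kernel.comp_const, Kernel.const_apply]
  have h2 := Kernel.integral_comp (κ := Kernel.const Unit m) (η := κ) (a := ()) (f := f)
    (by rwa [h1])
  rwa [h1, Kernel.const_apply] at h2

theorem integrable_integral_kernel {α : Type*} [MeasurableSpace α] {π : Measure α}
    [IsFiniteMeasure π] {κ : Kernel α α} [IsMarkovKernel κ] (h : κ.Invariant π) (g : Lp ℝ 2 π) :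
    Integrable (fun x => ∫ y, g y ∂κ x) π :=
  (memLp_integral_kernel h g).integrable (by norm_num)

namespace MarkovProcess

variable {E Ω : Type*} [TopologicalSpace E] [MeasurableSpace E] [MeasurableSpace Ω]

/-- The additive functional `∫₀ᵗ V(X_r) dr`. -/
def pathIntegral (M : MarkovProcess E Ω) (V : E → ℝ) (t : ℝ≥0) (ω : Ω) : ℝ :=
  ∫ r in (0 : ℝ)..t, V (M.X r.toNNReal ω)

instance (M : MarkovProcess E Ω) (μ : Measure E) [IsProbabilityMeasure μ] :
    IsProbabilityMeasure (M.law μ) := by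
  unfold law
  infer_instance

theorem pathIntegral_zero (M : MarkovProcess E Ω) (V : E → ℝ) (ω : Ω) : M.pathIntegral V 0 ω = 0 := by
  simp [pathIntegral]

theorem law_apply (M : MarkovProcess E Ω) (μ : Measure E) {s : Set Ω} (hs : MeasurableSet s) :
    M.law μ s = ∫⁻ x, M.P x s ∂μ := Measure.bind_apply hs M.P.aemeasurable

theorem lintegral_law (M : MarkovProcess E Ω) (μ : Measure E) {f : Ω → ℝ≥0∞} (hf : Measurable f) :
    ∫⁻ ω, f ω ∂(M.law μ) = ∫⁻ x, ∫⁻ ω, f ω ∂(M.P x) ∂μ :=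
  Measure.lintegral_bind M.P.aemeasurable hf.aemeasurable

theorem transition_apply (M : MarkovProcess E Ω) (t : ℝ≥0) (x : E) {B : Set E}
    (hB : MeasurableSet B) : M.transition t x B = M.P x (M.X t ⁻¹' B) :=
  Kernel.map_apply' _ (M.measurable_X t) _ hB

theorem IsInvariant.measurePreserving {M : MarkovProcess E Ω} {π : Measure E}
    (h : M.IsInvariant π) (t : ℝ≥0) : MeasurePreserving (M.X t) (M.law π) π := by
  refine ⟨M.measurable_X t, Measure.ext fun B hB => ?_⟩
  conv_rhs => rw [← (h t).def, Measure.bind_apply hB (Kernel.aemeasurable _)]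
  rw [Measure.map_apply (M.measurable_X t) hB, law_apply _ _ (M.measurable_X t hB)]
  simp_rw [M.transition_apply t _ hB]

theorem setLIntegral_law_transition (M : MarkovProcess E Ω) (μ : Measure E) (s t : ℝ≥0)
    {B : Set E} (hB : MeasurableSet B) {F : Set Ω} (hF : MeasurableSet[M.ℱ s] F) :
    ∫⁻ ω in F, M.transition t (M.X s ω) B ∂(M.law μ) = M.law μ (F ∩ M.X (s + t) ⁻¹' B) := by
  have hF' := M.ℱ.le s F hF
  have h1 : Measurable fun ω => M.transition t (M.X s ω) B :=
    (Kernel.measurable_coe _ hB).comp (M.measurable_X s)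
  rw [← lintegral_indicator hF', lintegral_law _ _ (h1.indicator hF'),
    law_apply _ _ (hF'.inter (M.measurable_X _ hB))]
  refine lintegral_congr fun x => ?_
  rw [lintegral_indicator hF', ← M.markov x s t B hB F hF]
  simp_rw [M.transition_apply t _ hB]

/-- As an identity of measures, the Markov property can be integrated against functions that are not
indicators. -/
theorem map_restrict_law (M : MarkovProcess E Ω) (μ : Measure E) (s t : ℝ≥0)
    {F : Set Ω} (hF : MeasurableSet[M.ℱ s] F) :
    ((M.law μ).restrict F).map (M.X (s + t)) =
      (((M.law μ).restrict F).map (M.X s)).bind (M.transition t) := by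
  refine Measure.ext fun B hB => ?_
  rw [Measure.map_apply (M.measurable_X _) hB, Measure.restrict_apply (M.measurable_X _ hB),
    Measure.bind_apply hB (Kernel.aemeasurable _),
    lintegral_map (Kernel.measurable_coe _ hB) (M.measurable_X s),
    M.setLIntegral_law_transition μ s t hB hF, Set.inter_comm]

section Stationary

theorem IsInvariant.memLp_comp {M : MarkovProcess E Ω} {π : Measure E} (h : M.IsInvariant π)
    {g : E → ℝ} (hg : MemLp g 2 π) (t : ℝ≥0) :
    MemLp (fun ω => g (M.X t ω)) 2 (M.law π) := hg.comp_measurePreserving (h.measurePreserving t)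

theorem IsInvariant.ae_comp {M : MarkovProcess E Ω} {π : Measure E} (h : M.IsInvariant π)
    {p : E → Prop} (hp : ∀ᵐ x ∂π, p x) (t : ℝ≥0) : ∀ᵐ ω ∂(M.law π), p (M.X t ω) :=
  (h.measurePreserving t).quasiMeasurePreserving.ae hp

theorem IsInvariant.integrable_comp {M : MarkovProcess E Ω} {π : Measure E} (h : M.IsInvariant π)
    {g : E → ℝ} (hg : Integrable g π) (t : ℝ≥0) :
    Integrable (fun ω => g (M.X t ω)) (M.law π) :=
  (h.measurePreserving t).integrable_comp_of_integrable hg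

variable {M : MarkovProcess E Ω} {π : Measure E} (h : M.IsInvariant π)

/-- The isometry `g ↦ g(X_t)` from `L²(π)` to `L²` of the stationary law. -/
def IsInvariant.evalL2 (t : ℝ≥0) : Lp ℝ 2 π →ₗᵢ[ℝ] Lp ℝ 2 (M.law π) :=
  Lp.compMeasurePreservingₗᵢ ℝ (M.X t) (h.measurePreserving t)

theorem IsInvariant.evalL2_ae (t : ℝ≥0) (g : Lp ℝ 2 π) :
    h.evalL2 t g =ᵐ[M.law π] fun ω => g (M.X t ω) :=
  Lp.coeFn_compMeasurePreserving g (h.measurePreserving t)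

theorem IsInvariant.norm_kernelL2_le (t : ℝ≥0) (g : Lp ℝ 2 π) :
    ‖kernelL2 (M.transition t) π (h t) g‖ ≤ ‖g‖ := by
  refine ((kernelL2 (M.transition t) π (h t)).le_of_opNorm_le
    (LinearMap.mkContinuous_norm_le _ zero_le_one _) g).trans_eq (one_mul _)

variable [IsProbabilityMeasure π]

include h in
theorem IsInvariant.setIntegral_comp (g : Lp ℝ 2 π) (s t : ℝ≥0) {F : Set Ω}
    (hF : MeasurableSet[M.ℱ s] F) :
    ∫ ω in F, ∫ y, g y ∂(M.transition t (M.X s ω)) ∂(M.law π) =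
      ∫ ω in F, g (M.X (s + t) ω) ∂(M.law π) := by
  have hgm : AEStronglyMeasurable g (((M.law π).restrict F).map (M.X (s + t))) :=
    (Lp.stronglyMeasurable g).aestronglyMeasurable
  have hkm : AEStronglyMeasurable (fun x => ∫ y, g y ∂(M.transition t x))
      (((M.law π).restrict F).map (M.X s)) :=
    (StronglyMeasurable.integral_kernel (Lp.stronglyMeasurable g)).aestronglyMeasurable
  have hgi : Integrable (fun ω => g (M.X (s + t) ω)) (M.law π) :=
    (h.memLp_comp (Lp.memLp g) (s + t)).integrable (by norm_num)
  have h2 := M.map_restrict_law π s t hF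
  have h3 : Integrable g (((M.law π).restrict F).map (M.X (s + t))) :=
    (integrable_map_measure hgm (M.measurable_X _).aemeasurable).2 hgi.integrableOn
  have h4 := integral_map (M.measurable_X (s + t)).aemeasurable hgm
  have h5 := integral_map (M.measurable_X s).aemeasurable hkm
  rw [h2] at h3 h4
  rw [← h5, ← h4, integral_bind_kernel h3]

theorem IsInvariant.condExp_comp (g : Lp ℝ 2 π) (s t : ℝ≥0) :
    (fun ω => kernelL2 (M.transition t) π (h t) g (M.X s ω)) =ᵐ[M.law π]
      (M.law π)[fun ω => g (M.X (s + t) ω) | M.ℱ s] := by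
  have hkm : StronglyMeasurable[M.ℱ s] fun ω => ∫ y, g y ∂(M.transition t (M.X s ω)) :=
    (StronglyMeasurable.integral_kernel (κ := M.transition t)
      (Lp.stronglyMeasurable g)).comp_measurable (M.adapted s)
  have hk := h.integrable_comp (integrable_integral_kernel (h t) g) s
  have hgi : Integrable (fun ω => g (M.X (s + t) ω)) (M.law π) :=
    (h.memLp_comp (Lp.memLp g) (s + t)).integrable (by norm_num)
  have h2 := ae_eq_condExp_of_forall_setIntegral_eq (M.ℱ.le s) hgi
    (fun F _ _ => hk.integrableOn) (fun F hF _ => h.setIntegral_comp g s t hF)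
    hkm.aestronglyMeasurable
  filter_upwards [h.ae_comp (kernelL2_ae (h t) g) s, h2] with ω h3 h4
  rw [h3, h4]

/-- The Markov property under the stationary law, tested on a square integrable `ℱ_s`-measurable `W`. -/
theorem IsInvariant.integral_mul_comp {s : ℝ≥0} {W : Ω → ℝ} (hW : StronglyMeasurable[M.ℱ s] W)
    (hW2 : MemLp W 2 (M.law π)) (g : Lp ℝ 2 π) (t : ℝ≥0) :
    ∫ ω, W ω * g (M.X (s + t) ω) ∂(M.law π) =
      ∫ ω, W ω * kernelL2 (M.transition t) π (h t) g (M.X s ω) ∂(M.law π) := by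
  have hg2 := h.memLp_comp (Lp.memLp g) (s + t)
  have h1 := condExp_mul_of_stronglyMeasurable_left hW
    (g := fun ω => g (M.X (s + t) ω)) (hW2.integrable_mul hg2) (hg2.integrable (by norm_num))
  have h2 := integral_condExp (M.ℱ.le s) (μ := M.law π) (f := W * fun ω => g (M.X (s + t) ω))
  refine h2.symm.trans (integral_congr_ae (h1.trans ?_))
  filter_upwards [h.condExp_comp g s t] with ω hω
  rw [Pi.mul_apply, hω]

theorem inner_eq_integral_of_ae {α : Type*} [MeasurableSpace α] {m : Measure α} {a b : Lp ℝ 2 m}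
    {u v : α → ℝ} (ha : a =ᵐ[m] u) (hb : b =ᵐ[m] v) : inner ℝ a b = ∫ x, u x * v x ∂m := by
  rw [L2.inner_def]
  refine integral_congr_ae ?_
  filter_upwards [ha, hb] with x hx hy
  rw [hx, hy]
  simp [mul_comm]

/-- Conditioning as projection: pairing with a functional of the past replaces `g(X_{s+t})` by its
conditional expectation `(P_t g)(X_s)`. -/
theorem IsInvariant.inner_evalL2_add {s : ℝ≥0} {W : Lp ℝ 2 (M.law π)} {w : Ω → ℝ}
    (hw : StronglyMeasurable[M.ℱ s] w) (hW : W =ᵐ[M.law π] w) (g : Lp ℝ 2 π) (t : ℝ≥0) :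
    inner ℝ W (h.evalL2 (s + t) g) =
      inner ℝ W (h.evalL2 s (kernelL2 (M.transition t) π (h t) g)) := by
  rw [inner_eq_integral_of_ae hW (h.evalL2_ae (s + t) g),
    inner_eq_integral_of_ae hW (h.evalL2_ae s _)]
  exact h.integral_mul_comp hw ((memLp_congr_ae hW).1 (Lp.memLp W)) g t

theorem IsInvariant.inner_evalL2_evalL2 (s t : ℝ≥0) (f g : Lp ℝ 2 π) :
    inner ℝ (h.evalL2 s f) (h.evalL2 (s + t) g) =
      inner ℝ f (kernelL2 (M.transition t) π (h t) g) := by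
  rw [h.inner_evalL2_add ((Lp.stronglyMeasurable f).comp_measurable (M.adapted s))
    (h.evalL2_ae s f) g t, LinearIsometry.inner_map_map]

theorem IsInvariant.norm_evalL2_sub_sq (s t : ℝ≥0) (g : Lp ℝ 2 π) :
    ‖h.evalL2 (s + t) g - h.evalL2 s g‖ ^ 2 =
      2 * ‖g‖ ^ 2 - 2 * inner ℝ g (kernelL2 (M.transition t) π (h t) g) := by
  rw [norm_sub_sq_real, real_inner_comm, h.inner_evalL2_evalL2, LinearIsometry.norm_map,
    LinearIsometry.norm_map]
  ring

theorem IsInvariant.norm_evalL2_sub (s t : ℝ≥0) (g : Lp ℝ 2 π) :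
    ‖h.evalL2 (s + t) g - h.evalL2 s g‖ = ‖h.evalL2 t g - h.evalL2 0 g‖ := by
  have h1 := h.norm_evalL2_sub_sq 0 t g
  rw [zero_add] at h1
  rw [← sq_eq_sq₀ (norm_nonneg _) (norm_nonneg _), h.norm_evalL2_sub_sq, h1]

/-- Both squares expand with the same cross term `-2⟨g, P_t g⟩`, and `‖P_t g‖ ≤ ‖g‖`. Continuity of
the process in `L²` thus passes to the semigroup. -/
theorem IsInvariant.norm_kernelL2_sub_le (t : ℝ≥0) (g : Lp ℝ 2 π) :
    ‖kernelL2 (M.transition t) π (h t) g - g‖ ≤ ‖h.evalL2 t g - h.evalL2 0 g‖ := by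
  have h1 := h.norm_evalL2_sub_sq 0 t g
  rw [zero_add] at h1
  refine (sq_le_sq₀ (norm_nonneg _) (norm_nonneg _)).1 ?_
  rw [h1, norm_sub_sq_real, real_inner_comm]
  have h2 := h.norm_kernelL2_le t g
  nlinarith [norm_nonneg (kernelL2 (M.transition t) π (h t) g), norm_nonneg g]

/-- Both sides are tested against `f`: the expectation of `f(X_0) g(X_{s+t})` may be computed by
conditioning once, or at time `s` first. -/
theorem IsInvariant.kernelL2_add (s t : ℝ≥0) (g : Lp ℝ 2 π) :
    kernelL2 (M.transition (s + t)) π (h (s + t)) g =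
      kernelL2 (M.transition s) π (h s) (kernelL2 (M.transition t) π (h t) g) := by
  refine ext_inner_left ℝ fun f => ?_
  rw [← h.inner_evalL2_evalL2 0 (s + t), zero_add, h.inner_evalL2_add
    (((Lp.stronglyMeasurable f).comp_measurable (M.adapted 0)).mono (M.ℱ.mono bot_le))
    (h.evalL2_ae 0 f) g t, ← h.inner_evalL2_evalL2 0 s, zero_add]

variable [PolishSpace E] [BorelSpace E]

/-- For bounded continuous functions this is right-continuity of the paths at `0` with dominated
convergence. Such functions are dense and the evaluation maps are isometries, so the limit extends
to `L²`. -/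
theorem IsInvariant.tendsto_evalL2 (g : Lp ℝ 2 π) :
    Tendsto (fun t => h.evalL2 t g) (𝓝 0) (𝓝 (h.evalL2 0 g)) := by
  let _ := TopologicalSpace.upgradeIsCompletelyMetrizable E
  have hd : DenseRange (BoundedContinuousFunction.toLp (E := ℝ) 2 π ℝ) :=
    BoundedContinuousFunction.toLp_denseRange ℝ π ℝ (by norm_num)
  have hcont : ∀ φ : BoundedContinuousFunction E ℝ,
      Tendsto (fun t => h.evalL2 t (BoundedContinuousFunction.toLp 2 π ℝ φ)) (𝓝 0)
        (𝓝 (h.evalL2 0 (BoundedContinuousFunction.toLp 2 π ℝ φ))) := by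
    intro φ
    have hae : ∀ t, h.evalL2 t (BoundedContinuousFunction.toLp 2 π ℝ φ) =ᵐ[M.law π]
        fun ω => φ (M.X t ω) := fun t =>
      (h.evalL2_ae t _).trans ((h.measurePreserving t).quasiMeasurePreserving.ae_eq_comp
        (BoundedContinuousFunction.coeFn_toLp (p := 2) π ℝ φ))
    rw [tendsto_iff_norm_sub_tendsto_zero]
    have h1 : ∀ t, ‖h.evalL2 t (BoundedContinuousFunction.toLp 2 π ℝ φ) -
        h.evalL2 0 (BoundedContinuousFunction.toLp 2 π ℝ φ)‖ =
        √(∫ ω, (φ (M.X t ω) - φ (M.X 0 ω)) ^ 2 ∂(M.law π)) := by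
      intro t
      rw [← Real.sqrt_sq (norm_nonneg (_ - _)), ← real_inner_self_eq_norm_sq]
      congr 1
      have h2 : ⇑(h.evalL2 t (BoundedContinuousFunction.toLp 2 π ℝ φ) -
          h.evalL2 0 (BoundedContinuousFunction.toLp 2 π ℝ φ)) =ᵐ[M.law π]
          fun ω => φ (M.X t ω) - φ (M.X 0 ω) := (Lp.coeFn_sub _ _).trans ((hae t).sub (hae 0))
      rw [inner_eq_integral_of_ae h2 h2]
      simp_rw [sq]
    simp_rw [h1]
    have hφm : ∀ t, Measurable fun ω => φ (M.X t ω) :=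
      fun t => φ.continuous.measurable.comp (M.measurable_X t)
    have h3 : Tendsto (fun t => ∫ ω, (φ (M.X t ω) - φ (M.X 0 ω)) ^ 2 ∂(M.law π)) (𝓝 0)
        (𝓝 (∫ _, 0 ∂(M.law π))) := by
      refine tendsto_integral_filter_of_dominated_convergence (fun _ => (2 * ‖φ‖) ^ 2)
        (Eventually.of_forall fun t => (((hφm t).sub (hφm 0)).pow_const 2).aestronglyMeasurable)
        (Eventually.of_forall fun t => ae_of_all _ fun ω => ?_) (integrable_const _)
        (ae_of_all _ fun ω => ?_)
      · rw [norm_pow]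
        gcongr
        refine (norm_sub_le _ _).trans ?_
        rw [two_mul]
        exact add_le_add (φ.norm_coe_le_norm _) (φ.norm_coe_le_norm _)
      · have h4 := (M.rightCts ω 0).tendsto
        rw [show Set.Ici (0 : ℝ≥0) = Set.univ from by ext; simp, nhdsWithin_univ] at h4
        have h5 := ((φ.continuous.tendsto _).comp h4).sub_const (φ (M.X 0 ω))
        have h7 := h5.pow 2
        rw [sub_self, zero_pow two_ne_zero] at h7
        exact h7
    have h6 := h3.sqrt
    rwa [integral_zero, Real.sqrt_zero] at h6
  rw [Metric.tendsto_nhds]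
  intro δ hδ
  obtain ⟨φ, hφ⟩ := hd.exists_dist_lt g (show 0 < δ / 3 by positivity)
  filter_upwards [Metric.tendsto_nhds.1 (hcont φ) (δ / 3) (by positivity)] with t ht
  have h1 := (h.evalL2 t).dist_map g (BoundedContinuousFunction.toLp 2 π ℝ φ)
  have h2 := (h.evalL2 0).dist_map g (BoundedContinuousFunction.toLp 2 π ℝ φ)
  rw [dist_comm] at h2
  have h3 := dist_triangle4 (h.evalL2 t g) (h.evalL2 t (BoundedContinuousFunction.toLp 2 π ℝ φ))
    (h.evalL2 0 (BoundedContinuousFunction.toLp 2 π ℝ φ)) (h.evalL2 0 g)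
  linarith

/-- The transition operators on `L²(π)` form a strongly continuous contraction semigroup. -/
theorem IsInvariant.isContractionSemigroup :
    IsContractionSemigroup fun t => kernelL2 (M.transition t) π (h t) where
  map_zero f := by
    have h1 := h.norm_kernelL2_sub_le 0 f
    rw [sub_self, norm_zero] at h1
    exact sub_eq_zero.1 (norm_le_zero_iff.1 h1)
  map_add := h.kernelL2_add
  norm_le := h.norm_kernelL2_le
  tendsto f := by
    rw [tendsto_iff_norm_sub_tendsto_zero]
    exact squeeze_zero (fun _ => norm_nonneg _) (fun t => h.norm_kernelL2_sub_le t f)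
      (tendsto_iff_norm_sub_tendsto_zero.1 (h.tendsto_evalL2 f))

theorem IsInvariant.continuous_evalL2 (g : Lp ℝ 2 π) : Continuous fun t => h.evalL2 t g := by
  rw [continuous_iff_continuousAt]
  intro s
  rw [ContinuousAt, tendsto_iff_norm_sub_tendsto_zero]
  have h1 : Tendsto (fun t => nndist s t) (𝓝 s) (𝓝 0) := by
    have : Continuous fun t => nndist s t := by fun_prop
    simpa using this.tendsto s
  have h2 := (tendsto_iff_norm_sub_tendsto_zero.1 (h.tendsto_evalL2 g)).comp h1
  refine h2.congr fun t => ?_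
  have key : ∀ a b : ℝ≥0, a ≤ b → ‖h.evalL2 (nndist a b) g - h.evalL2 0 g‖ =
      ‖h.evalL2 b g - h.evalL2 a g‖ := by
    intro a b hab
    obtain ⟨r, rfl⟩ := exists_add_of_le hab
    have h3 : nndist a (a + r) = r := by
      rw [NNReal.nndist_eq, add_tsub_cancel_left, tsub_eq_zero_of_le hab]
      simp
    rw [h3, h.norm_evalL2_sub]
  rcases le_total s t with hst | hst
  · exact key s t hst
  · rw [Function.comp_apply, nndist_comm, key t s hst, norm_sub_rev]

end Stationary

/-! ### Additive functionals. -/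

section PathIntegral

variable [PolishSpace E] [BorelSpace E] (M : MarkovProcess E Ω) {V : E → ℝ}

theorem measurable_uncurry_X : Measurable fun p : ℝ≥0 × Ω => M.X p.1 p.2 := by
  let _ := TopologicalSpace.upgradeIsCompletelyMetrizable E
  exact measurable_uncurry_of_rightCts M.measurable_X M.rightCts

theorem measurable_comp_X (hV : Measurable V) (ω : Ω) :
    Measurable fun r : ℝ => V (M.X r.toNNReal ω) :=
  hV.comp (M.measurable_uncurry_X.comp (measurable_real_toNNReal.prodMk measurable_const))

theorem stronglyMeasurable_pathIntegral (hV : Measurable V) (t : ℝ≥0) :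
    StronglyMeasurable[M.ℱ t] (M.pathIntegral V t) := by
  let _ := TopologicalSpace.upgradeIsCompletelyMetrizable E
  -- Freezing the process at time `t` makes all its values `ℱ_t`-measurable without changing the
  -- integral up to `t`.
  have h1 := @measurable_integral_comp_of_rightCts Ω E (M.ℱ t) _ _ _ _
    (fun r ω => M.X (min r t) ω)
    (fun r => (M.adapted (min r t)).mono (M.ℱ.mono (min_le_right r t)) le_rfl)
    (fun ω r => (M.rightCts ω (min r t)).comp (f := fun s => min s t)
      (continuous_id.min continuous_const).continuousWithinAt
      (fun s hs => min_le_min_right t hs)) V hV 0 t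
  convert h1 using 2 with ω
  refine intervalIntegral.integral_congr fun r hr => ?_
  rw [Set.uIcc_of_le t.coe_nonneg] at hr
  have : r.toNNReal ≤ t := Real.toNNReal_le_iff_le_coe.2 hr.2
  simp only [min_eq_left this]

theorem intervalIntegrable_comp_X (hV : Measurable V) {C : ℝ} (hC : ∀ x, |V x| ≤ C) (ω : Ω)
    (a b : ℝ) : IntervalIntegrable (fun r : ℝ => V (M.X r.toNNReal ω)) volume a b := by
  rw [intervalIntegrable_iff]
  exact Measure.integrableOn_of_bounded (M := C) (by simp)
    (M.measurable_comp_X hV ω).aestronglyMeasurable (ae_of_all _ fun r => hC _)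

theorem abs_pathIntegral_sub_le (hV : Measurable V) {C : ℝ} (hC : ∀ x, |V x| ≤ C) (ω : Ω)
    (s t : ℝ≥0) : |M.pathIntegral V t ω - M.pathIntegral V s ω| ≤ C * |(t : ℝ) - s| := by
  rw [pathIntegral, pathIntegral, intervalIntegral.integral_interval_sub_left
    (M.intervalIntegrable_comp_X hV hC ω _ _) (M.intervalIntegrable_comp_X hV hC ω _ _)]
  exact intervalIntegral.norm_integral_le_of_norm_le_const
    (f := fun r : ℝ => V (M.X r.toNNReal ω)) fun r _ => hC (M.X r.toNNReal ω)

end PathIntegral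

end MarkovProcess

/-! ### Multiplication operators on `L²`. -/

section MultiplicationOperator

variable {α : Type*} [MeasurableSpace α] {m : Measure α} {u : α → ℝ}

theorem memLp_mul_of_bounded (hu : Measurable u) {C : ℝ} (hC : ∀ x, |u x| ≤ C) (g : Lp ℝ 2 m) :
    MemLp (fun x => u x * g x) 2 m :=
  MemLp.of_le_mul (c := C) (Lp.memLp g)
    (hu.aestronglyMeasurable.mul (Lp.stronglyMeasurable g).aestronglyMeasurable)
    (ae_of_all _ fun x => by
      rw [norm_mul]
      exact mul_le_mul_of_nonneg_right (hC x) (norm_nonneg _))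

/-- Multiplication by a bounded function, as a bounded operator on `L²(m)`. -/
def mulL2 (m : Measure α) (hu : Measurable u) {C : ℝ} (hC : ∀ x, |u x| ≤ C) :
    Lp ℝ 2 m →L[ℝ] Lp ℝ 2 m :=
  LinearMap.mkContinuous
    { toFun := fun g => (memLp_mul_of_bounded hu hC g).toLp _
      map_add' := fun f g => by
        rw [← MemLp.toLp_add]
        refine MemLp.toLp_congr _ _ ?_
        filter_upwards [Lp.coeFn_add f g] with x hx
        rw [hx, Pi.add_apply, Pi.add_apply, mul_add]
      map_smul' := fun c g => by
        rw [RingHom.id_apply, ← MemLp.toLp_const_smul]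
        refine MemLp.toLp_congr _ _ ?_
        filter_upwards [Lp.coeFn_smul c g] with x hx
        rw [hx, Pi.smul_apply, Pi.smul_apply, smul_eq_mul, smul_eq_mul, mul_left_comm] } C
    (fun g => by
      refine Lp.norm_le_mul_norm_of_ae_le_mul ?_
      filter_upwards [MemLp.coeFn_toLp (memLp_mul_of_bounded hu hC g)] with x hx
      simp only [LinearMap.coe_mk, AddHom.coe_mk]
      rw [hx, norm_mul]
      exact mul_le_mul_of_nonneg_right (hC x) (norm_nonneg _))

theorem mulL2_ae (hu : Measurable u) {C : ℝ} (hC : ∀ x, |u x| ≤ C) (g : Lp ℝ 2 m) :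
    mulL2 m hu hC g =ᵐ[m] fun x => u x * g x :=
  MemLp.coeFn_toLp (memLp_mul_of_bounded hu hC g)

theorem norm_mulL2_le (hu : Measurable u) {C : ℝ} (hC : ∀ x, |u x| ≤ C) {K : ℝ}
    (hK : ∀ᵐ x ∂m, |u x| ≤ K) (g : Lp ℝ 2 m) : ‖mulL2 m hu hC g‖ ≤ K * ‖g‖ := by
  refine Lp.norm_le_mul_norm_of_ae_le_mul ?_
  filter_upwards [mulL2_ae hu hC g, hK] with x hx hx'
  rw [hx, norm_mul]
  exact mul_le_mul_of_nonneg_right hx' (norm_nonneg _)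

theorem inner_mulL2 (hu : Measurable u) {C : ℝ} (hC : ∀ x, |u x| ≤ C) (f g : Lp ℝ 2 m) :
    inner ℝ (mulL2 m hu hC f) g = ∫ x, u x * (f x * g x) ∂m := by
  rw [MarkovProcess.inner_eq_integral_of_ae (mulL2_ae hu hC f) (EventuallyEq.refl _ ⇑g)]
  simp_rw [mul_assoc]

theorem inner_mulL2_comm (hu : Measurable u) {C : ℝ} (hC : ∀ x, |u x| ≤ C) (f g : Lp ℝ 2 m) :
    inner ℝ (mulL2 m hu hC f) g = inner ℝ f (mulL2 m hu hC g) := by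
  rw [inner_mulL2, real_inner_comm, inner_mulL2]
  simp_rw [mul_comm]

end MultiplicationOperator

/-! ### The Feynman–Kac functional and its derivative in time. -/

namespace MarkovProcess

variable {E Ω : Type*} [TopologicalSpace E] [MeasurableSpace E] [MeasurableSpace Ω]
  [PolishSpace E] [BorelSpace E] {M : MarkovProcess E Ω} {π : Measure E} [IsProbabilityMeasure π]
  (h : M.IsInvariant π) {V : E → ℝ} (hV : Measurable V) {C : ℝ} (hC : ∀ x, |V x| ≤ C)

omit [BorelSpace E] [PolishSpace E] in
theorem measurable_comp_X_right (hV : Measurable V) (t : ℝ≥0) :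
    Measurable fun ω => V (M.X t ω) := hV.comp (M.measurable_X t)

theorem abs_pathIntegral_le (hV : Measurable V) (hC : ∀ x, |V x| ≤ C) (t : ℝ≥0) (ω : Ω) :
    |M.pathIntegral V t ω| ≤ C * t := by
  have h1 := M.abs_pathIntegral_sub_le hV hC ω 0 t
  rwa [M.pathIntegral_zero, sub_zero, NNReal.coe_zero, sub_zero, NNReal.abs_eq] at h1

theorem measurable_pathIntegral (hV : Measurable V) (t : ℝ≥0) : Measurable (M.pathIntegral V t) :=
  ((M.stronglyMeasurable_pathIntegral hV t).mono (M.ℱ.le t)).measurable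

/-- The increment `∫_s^t V(X_r) dr`, as a multiplication operator. -/
def incrementL2 (M : MarkovProcess E Ω) (P : Measure Ω) (hV : Measurable V) (hC : ∀ x, |V x| ≤ C)
    (s t : ℝ≥0) : Lp ℝ 2 P →L[ℝ] Lp ℝ 2 P :=
  mulL2 P ((measurable_pathIntegral (M := M) hV t).sub (measurable_pathIntegral hV s))
    (fun ω => M.abs_pathIntegral_sub_le hV hC ω s t)

/-- Multiplication by `V(X_t)`. -/
def potentialL2 (M : MarkovProcess E Ω) (P : Measure Ω) (hV : Measurable V) (hC : ∀ x, |V x| ≤ C)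
    (t : ℝ≥0) : Lp ℝ 2 P →L[ℝ] Lp ℝ 2 P :=
  mulL2 P (measurable_comp_X_right (M := M) hV t) (fun ω => hC (M.X t ω))

theorem inner_incrementL2 {P : Measure Ω} [IsFiniteMeasure P] (f g : Lp ℝ 2 P) (s t : ℝ≥0) :
    inner ℝ (M.incrementL2 P hV hC s t f) g =
      ∫ r in (s : ℝ)..t, inner ℝ (M.potentialL2 P hV hC r.toNNReal f) g := by
  have hfg : Integrable (fun ω => f ω * g ω) P := (Lp.memLp f).integrable_mul (Lp.memLp g)
  simp only [incrementL2, potentialL2, inner_mulL2]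
  have hj : Measurable fun p : ℝ × Ω => V (M.X p.1.toNNReal p.2) :=
    hV.comp (M.measurable_uncurry_X.comp
      ((measurable_real_toNNReal.comp measurable_fst).prodMk measurable_snd))
  have hint : ∀ A : Set ℝ, volume A ≠ ∞ → Integrable
      (fun p : ℝ × Ω => V (M.X p.1.toNNReal p.2) * (f p.2 * g p.2))
      ((volume.restrict A).prod P) := fun A hA => by
    have : IsFiniteMeasure (volume.restrict A) := ⟨by simpa using hA.lt_top⟩
    exact (hfg.comp_snd (volume.restrict A)).bdd_mul hj.aestronglyMeasurable
      (ae_of_all _ fun p => hC _)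
  have hswap : ∀ A : Set ℝ, volume A ≠ ∞ →
      ∫ r in A, ∫ ω, V (M.X r.toNNReal ω) * (f ω * g ω) ∂P =
      ∫ ω, (∫ r in A, V (M.X r.toNNReal ω)) * (f ω * g ω) ∂P := fun A hA => by
    rw [integral_integral_swap (hint A hA)]
    simp_rw [integral_mul_const]
  have hint' : ∀ A : Set ℝ, volume A ≠ ∞ →
      Integrable (fun ω => (∫ r in A, V (M.X r.toNNReal ω)) * (f ω * g ω)) P := fun A hA => by
    have := (hint A hA).integral_prod_right
    simpa only [integral_mul_const] using this
  rw [intervalIntegral, hswap _ (by simp), hswap _ (by simp),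
    ← integral_sub (hint' _ (by simp)) (hint' _ (by simp))]
  refine integral_congr_ae (ae_of_all _ fun ω => ?_)
  simp only
  rw [← sub_mul, Pi.sub_apply, pathIntegral, pathIntegral, intervalIntegral.integral_interval_sub_left
    (M.intervalIntegrable_comp_X hV hC ω _ _) (M.intervalIntegrable_comp_X hV hC ω _ _),
    intervalIntegral]

section Tilted

set_option linter.unusedSectionVars false

include h hV hC in
theorem IsInvariant.memLp_tilted (d : Lp ℝ 2 π) (t : ℝ≥0) :
    MemLp (fun ω => Real.exp (M.pathIntegral V t ω) * d (M.X 0 ω)) 2 (M.law π) := by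
  refine MemLp.of_le_mul (c := Real.exp (C * t)) (h.memLp_comp (Lp.memLp d) 0)
    ((measurable_pathIntegral hV t).exp.aestronglyMeasurable.mul
      (h.memLp_comp (Lp.memLp d) 0).aestronglyMeasurable) (ae_of_all _ fun ω => ?_)
  rw [norm_mul, Real.norm_of_nonneg (Real.exp_pos _).le]
  exact mul_le_mul_of_nonneg_right
    (Real.exp_le_exp.2 ((le_abs_self _).trans (abs_pathIntegral_le hV hC t ω))) (norm_nonneg _)

/-- The weight `d(X_0) exp(∫₀ᵗ V(X_r) dr)` as an element of `L²` of the stationary law. -/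
def IsInvariant.tilted (d : Lp ℝ 2 π) (t : ℝ≥0) : Lp ℝ 2 (M.law π) :=
  (h.memLp_tilted hV hC d t).toLp _

theorem IsInvariant.tilted_ae (d : Lp ℝ 2 π) (t : ℝ≥0) :
    h.tilted hV hC d t =ᵐ[M.law π] fun ω => Real.exp (M.pathIntegral V t ω) * d (M.X 0 ω) :=
  MemLp.coeFn_toLp _

theorem stronglyMeasurable_weight (d : Lp ℝ 2 π) (t : ℝ≥0) (hV : Measurable V) :
    StronglyMeasurable[M.ℱ t] fun ω => Real.exp (M.pathIntegral V t ω) * d (M.X 0 ω) :=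
  (Real.continuous_exp.comp_stronglyMeasurable (M.stronglyMeasurable_pathIntegral hV t)).mul
    (((Lp.stronglyMeasurable d).comp_measurable (M.adapted 0)).mono (M.ℱ.mono bot_le))

theorem IsInvariant.tilted_zero (d : Lp ℝ 2 π) : h.tilted hV hC d 0 = h.evalL2 0 d := by
  refine Lp.ext ?_
  filter_upwards [h.tilted_ae hV hC d 0, h.evalL2_ae 0 d] with ω h1 h2
  rw [h1, h2, M.pathIntegral_zero, Real.exp_zero, one_mul]

theorem IsInvariant.norm_tilted_le (d : Lp ℝ 2 π) (t : ℝ≥0) :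
    ‖h.tilted hV hC d t‖ ≤ Real.exp (C * t) * ‖d‖ := by
  rw [← (h.evalL2 0).norm_map d]
  refine Lp.norm_le_mul_norm_of_ae_le_mul ?_
  filter_upwards [h.tilted_ae hV hC d t, h.evalL2_ae 0 d] with ω h1 h2
  rw [h1, h2, norm_mul, Real.norm_of_nonneg (Real.exp_pos _).le]
  exact mul_le_mul_of_nonneg_right
    (Real.exp_le_exp.2 ((le_abs_self _).trans (abs_pathIntegral_le hV hC t ω))) (norm_nonneg _)

theorem IsInvariant.tilted_ae_eq_mul (d : Lp ℝ 2 π) (s t : ℝ≥0) :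
    h.tilted hV hC d t =ᵐ[M.law π] fun ω =>
      Real.exp (M.pathIntegral V t ω - M.pathIntegral V s ω) * h.tilted hV hC d s ω := by
  filter_upwards [h.tilted_ae hV hC d t, h.tilted_ae hV hC d s] with ω h1 h2
  rw [h1, h2, ← mul_assoc, ← Real.exp_add, sub_add_cancel]

theorem IsInvariant.norm_tilted_sub_le (d : Lp ℝ 2 π) (s t : ℝ≥0)
    (hst : C * |(t : ℝ) - s| ≤ 1) :
    ‖h.tilted hV hC d t - h.tilted hV hC d s‖ ≤
      2 * (C * |(t : ℝ) - s|) * ‖h.tilted hV hC d s‖ := by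
  refine Lp.norm_le_mul_norm_of_ae_le_mul ?_
  filter_upwards [Lp.coeFn_sub (h.tilted hV hC d t) (h.tilted hV hC d s),
    h.tilted_ae_eq_mul hV hC d s t] with ω h1 h2
  have h3 := M.abs_pathIntegral_sub_le hV hC ω s t
  rw [h1, Pi.sub_apply, h2, ← sub_one_mul, norm_mul]
  refine mul_le_mul_of_nonneg_right ?_ (norm_nonneg _)
  exact (Real.abs_exp_sub_one_le (h3.trans hst)).trans (by linarith)

theorem IsInvariant.norm_tilted_sub_sub_le (d : Lp ℝ 2 π) (s t : ℝ≥0)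
    (hst : C * |(t : ℝ) - s| ≤ 1) :
    ‖h.tilted hV hC d t - h.tilted hV hC d s - M.incrementL2 _ hV hC s t (h.tilted hV hC d s)‖ ≤
      (C * |(t : ℝ) - s|) ^ 2 * ‖h.tilted hV hC d s‖ := by
  refine Lp.norm_le_mul_norm_of_ae_le_mul ?_
  have h0 : M.incrementL2 _ hV hC s t (h.tilted hV hC d s) =ᵐ[M.law π] _ := mulL2_ae _ _ _
  filter_upwards [Lp.coeFn_sub (h.tilted hV hC d t - h.tilted hV hC d s)
      (M.incrementL2 _ hV hC s t (h.tilted hV hC d s)),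
    Lp.coeFn_sub (h.tilted hV hC d t) (h.tilted hV hC d s),
    h.tilted_ae_eq_mul hV hC d s t, h0] with ω h1 h2 h3 h4
  have h5 := M.abs_pathIntegral_sub_le hV hC ω s t
  rw [h1, Pi.sub_apply, h2, Pi.sub_apply, h3, h4, ← sub_one_mul, ← sub_mul, norm_mul]
  refine mul_le_mul_of_nonneg_right ?_ (norm_nonneg _)
  refine (Real.abs_exp_sub_one_sub_id_le (h5.trans hst)).trans ?_
  exact sq_le_sq.2 (h5.trans (le_abs_self _))

theorem IsInvariant.continuous_tilted (d : Lp ℝ 2 π) :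
    Continuous fun t => h.tilted hV hC d t := by
  rw [continuous_iff_continuousAt]
  intro s
  have h1 : Tendsto (fun t : ℝ≥0 => C * |(t : ℝ) - s|) (𝓝 s) (𝓝 0) := by
    have : Continuous fun t : ℝ≥0 => C * |(t : ℝ) - s| := by fun_prop
    simpa using this.tendsto s
  rw [ContinuousAt, tendsto_iff_norm_sub_tendsto_zero]
  refine squeeze_zero' (Eventually.of_forall fun _ => norm_nonneg _)
    (g := fun t : ℝ≥0 => 2 * (C * |(t : ℝ) - s|) * ‖h.tilted hV hC d s‖) ?_ ?_
  · filter_upwards [h1.eventually_le_const zero_lt_one] with t ht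
    exact h.norm_tilted_sub_le hV hC d s t ht
  · simpa using (h1.const_mul 2).mul_const ‖h.tilted hV hC d s‖

/-- The functional `g ↦ E[d(X_0) exp(∫₀ᵗ V(X_r) dr) g(X_t)]` under the stationary law. -/
def IsInvariant.feynmanKac (d : Lp ℝ 2 π) (t : ℝ≥0) (g : Lp ℝ 2 π) : ℝ :=
  inner ℝ (h.tilted hV hC d t) (h.evalL2 t g)

theorem IsInvariant.feynmanKac_zero (d g : Lp ℝ 2 π) :
    h.feynmanKac hV hC d 0 g = inner ℝ d g := by
  rw [feynmanKac, tilted_zero, LinearIsometry.inner_map_map]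

theorem IsInvariant.feynmanKac_add (d : Lp ℝ 2 π) (t : ℝ≥0) (f g : Lp ℝ 2 π) :
    h.feynmanKac hV hC d t (f + g) = h.feynmanKac hV hC d t f + h.feynmanKac hV hC d t g := by
  rw [feynmanKac, map_add, inner_add_right]
  rfl

theorem IsInvariant.feynmanKac_smul (d : Lp ℝ 2 π) (t : ℝ≥0) (c : ℝ) (g : Lp ℝ 2 π) :
    h.feynmanKac hV hC d t (c • g) = c * h.feynmanKac hV hC d t g := by
  rw [feynmanKac, map_smul, inner_smul_right]
  rfl

theorem IsInvariant.continuous_feynmanKac (d g : Lp ℝ 2 π) :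
    Continuous fun t => h.feynmanKac hV hC d t g :=
  (h.continuous_tilted hV hC d).inner (h.continuous_evalL2 g)

theorem IsInvariant.abs_feynmanKac_le (d : Lp ℝ 2 π) (t : ℝ≥0) (g : Lp ℝ 2 π) :
    |h.feynmanKac hV hC d t g| ≤ Real.exp (C * t) * (‖d‖ * ‖g‖) := by
  refine (abs_real_inner_le_norm _ _).trans ?_
  rw [LinearIsometry.norm_map, ← mul_assoc]
  exact mul_le_mul_of_nonneg_right (h.norm_tilted_le hV hC d t) (norm_nonneg _)

theorem IsInvariant.potentialL2_evalL2 (t : ℝ≥0) (g : Lp ℝ 2 π) :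
    M.potentialL2 (M.law π) hV hC t (h.evalL2 t g) = h.evalL2 t (mulL2 π hV hC g) := by
  refine Lp.ext ?_
  have h0 : M.potentialL2 (M.law π) hV hC t (h.evalL2 t g) =ᵐ[M.law π] _ := mulL2_ae _ _ _
  filter_upwards [h0, h.evalL2_ae t g, h.evalL2_ae t (mulL2 π hV hC g),
    h.ae_comp (mulL2_ae hV hC g) t] with ω h1 h2 h3 h4
  rw [h1, h2, h3, h4]

/-- `V` is only measurable, so `s ↦ V(X_s)` has no pathwise continuity. Replacing `g(X_{t+r})` by
`g(X_s)` produces `(V g)(X_s)`, and evaluation of the fixed `L²` function `V g` is continuous in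
time. -/
theorem IsInvariant.tendsto_incrementL2 (W : Lp ℝ 2 (M.law π)) (t : ℝ≥0) (g : Lp ℝ 2 π) :
    Tendsto (fun r : ℝ≥0 => (r : ℝ)⁻¹ *
        inner ℝ (M.incrementL2 _ hV hC t (t + r) W) (h.evalL2 (t + r) g)) (𝓝[>] 0)
      (𝓝 (inner ℝ W (h.evalL2 t (mulL2 π hV hC g)))) := by
  have hshift : ∀ k : Lp ℝ 2 π, Tendsto (fun r : ℝ≥0 => ‖h.evalL2 (t + r) k - h.evalL2 t k‖)
      (𝓝 0) (𝓝 0) := fun k => by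
    simp_rw [h.norm_evalL2_sub]
    exact tendsto_iff_norm_sub_tendsto_zero.1 (h.tendsto_evalL2 k)
  have hC0 : 0 ≤ C := (abs_nonneg _).trans (hC (Classical.choice π.nonempty_of_neZero))
  rw [Metric.tendsto_nhds]
  intro η hη
  -- The error below is `2C‖W‖η'` from two increments of `g` plus `‖W‖η'` from one of `V g`; the
  -- final `+ 1` covers `W = 0`.
  have hc : 0 < (2 * C + 1) * ‖W‖ + 1 := by positivity
  set η' := η / (2 * ((2 * C + 1) * ‖W‖ + 1)) with hη'
  have hη0 : 0 < η' := by positivity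
  have hev : ∀ᶠ r in 𝓝 (0 : ℝ≥0), ‖h.evalL2 (t + r) g - h.evalL2 t g‖ ≤ η' ∧
      ‖h.evalL2 (t + r) (mulL2 π hV hC g) - h.evalL2 t (mulL2 π hV hC g)‖ ≤ η' :=
    ((hshift _).eventually_le_const hη0).and ((hshift _).eventually_le_const hη0)
  obtain ⟨δ, hδ, hball⟩ := Metric.eventually_nhds_iff.1 hev
  have hδ' : ∀ r : ℝ≥0, (r : ℝ) < δ → dist r 0 < δ := fun r hr => by
    rwa [NNReal.dist_eq, NNReal.coe_zero, sub_zero, NNReal.abs_eq]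
  filter_upwards [self_mem_nhdsWithin, mem_nhdsWithin_of_mem_nhds (Metric.ball_mem_nhds 0 hδ)]
    with r hr hrδ
  have hr0 : (0 : ℝ) < r := hr
  have hrδ' : (r : ℝ) < δ := by
    rwa [Metric.mem_ball, NNReal.dist_eq, NNReal.coe_zero, sub_zero, NNReal.abs_eq] at hrδ
  set c := inner ℝ W (h.evalL2 t (mulL2 π hV hC g)) with hcdef
  have hk : ∀ s : ℝ, s ∈ Set.uIoc (t : ℝ) ((t + r : ℝ≥0) : ℝ) →
      ‖inner ℝ (M.potentialL2 (M.law π) hV hC s.toNNReal W) (h.evalL2 (t + r) g) - c‖ ≤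
        (2 * C + 1) * ‖W‖ * η' := by
    intro s hs
    rw [Set.uIoc_of_le (by simp), NNReal.coe_add] at hs
    obtain ⟨q, hq⟩ : ∃ q : ℝ≥0, s.toNNReal = t + q :=
      exists_add_of_le (NNReal.le_toNNReal_of_coe_le hs.1.le)
    have hqr : (q : ℝ) ≤ r := by
      have h1 : (s.toNNReal : ℝ) = s := Real.coe_toNNReal s (t.coe_nonneg.trans hs.1.le)
      rw [hq, NNReal.coe_add] at h1
      linarith [hs.2]
    rw [hq]
    obtain ⟨h1, h2⟩ := hball (hδ' q (hqr.trans_lt hrδ'))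
    obtain ⟨h3, -⟩ := hball (hδ' r hrδ')
    have h4 : inner ℝ (M.potentialL2 (M.law π) hV hC (t + q) W) (h.evalL2 (t + r) g) - c =
        inner ℝ (M.potentialL2 (M.law π) hV hC (t + q) W)
          ((h.evalL2 (t + r) g - h.evalL2 t g) - (h.evalL2 (t + q) g - h.evalL2 t g)) +
        inner ℝ W (h.evalL2 (t + q) (mulL2 π hV hC g) - h.evalL2 t (mulL2 π hV hC g)) := by
      have h5 : inner ℝ (M.potentialL2 (M.law π) hV hC (t + q) W) (h.evalL2 (t + q) g) =
          inner ℝ W (h.evalL2 (t + q) (mulL2 π hV hC g)) := by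
        rw [← h.potentialL2_evalL2]
        exact inner_mulL2_comm _ _ _ _
      rw [sub_sub_sub_cancel_right, inner_sub_right, inner_sub_right, h5]
      ring
    rw [h4]
    have h6 : ‖M.potentialL2 (M.law π) hV hC (t + q) W‖ ≤ C * ‖W‖ :=
      norm_mulL2_le _ _ (ae_of_all _ fun ω => hC _) W
    have h7 := abs_real_inner_le_norm (M.potentialL2 (M.law π) hV hC (t + q) W)
      ((h.evalL2 (t + r) g - h.evalL2 t g) - (h.evalL2 (t + q) g - h.evalL2 t g))
    have h8 := abs_real_inner_le_norm W
      (h.evalL2 (t + q) (mulL2 π hV hC g) - h.evalL2 t (mulL2 π hV hC g))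
    have h9 : ‖(h.evalL2 (t + r) g - h.evalL2 t g) - (h.evalL2 (t + q) g - h.evalL2 t g)‖ ≤
        2 * η' := (norm_sub_le _ _).trans (by linarith)
    have h10 := mul_le_mul h6 h9 (norm_nonneg _) (by positivity)
    have h11 := mul_le_mul_of_nonneg_left h2 (norm_nonneg W)
    refine (abs_add_le _ _).trans ?_
    linarith
  have hint : IntervalIntegrable (fun s : ℝ => inner ℝ
      (M.potentialL2 (M.law π) hV hC s.toNNReal W) (h.evalL2 (t + r) g)) volume t
      ((t + r : ℝ≥0) : ℝ) := by
    rw [intervalIntegrable_iff]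
    refine Measure.integrableOn_of_bounded (M := C * ‖W‖ * ‖g‖) (by simp) ?_
      (ae_of_all _ fun s => ?_)
    · simp only [potentialL2, inner_mulL2]
      have hj : Measurable fun p : ℝ × Ω => V (M.X p.1.toNNReal p.2) :=
        hV.comp (M.measurable_uncurry_X.comp
          ((measurable_real_toNNReal.comp measurable_fst).prodMk measurable_snd))
      have hm : StronglyMeasurable fun p : ℝ × Ω =>
          V (M.X p.1.toNNReal p.2) * (W p.2 * h.evalL2 (t + r) g p.2) :=
        hj.stronglyMeasurable.mul
          (((Lp.stronglyMeasurable W).comp_measurable measurable_snd).mul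
            ((Lp.stronglyMeasurable _).comp_measurable measurable_snd))
      exact hm.integral_prod_right'.aestronglyMeasurable
    · refine (norm_inner_le_norm _ _).trans ?_
      rw [LinearIsometry.norm_map]
      exact mul_le_mul_of_nonneg_right
        (norm_mulL2_le _ _ (ae_of_all _ fun ω => hC _) W) (norm_nonneg _)
  have hI := intervalIntegral.norm_integral_le_of_norm_le_const hk
  rw [intervalIntegral.integral_sub hint intervalIntegrable_const,
    intervalIntegral.integral_const, ← inner_incrementL2, NNReal.coe_add, add_sub_cancel_left,
    abs_of_pos hr0, smul_eq_mul] at hI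
  rw [Real.dist_eq]
  have h12 : (r : ℝ)⁻¹ * inner ℝ (M.incrementL2 _ hV hC t (t + r) W) (h.evalL2 (t + r) g) - c =
      (r : ℝ)⁻¹ * (inner ℝ (M.incrementL2 _ hV hC t (t + r) W) (h.evalL2 (t + r) g) - r * c) := by
    field_simp
  rw [h12, abs_mul, abs_of_pos (inv_pos.2 hr0)]
  calc _ ≤ (r : ℝ)⁻¹ * ((2 * C + 1) * ‖W‖ * η' * r) :=
        mul_le_mul_of_nonneg_left hI (inv_pos.2 hr0).le
    _ = (2 * C + 1) * ‖W‖ * η' := by field_simp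
    _ < ((2 * C + 1) * ‖W‖ + 1) * (2 * η') := by
        nlinarith [mul_nonneg (by positivity : 0 ≤ (2 * C + 1) * ‖W‖) hη0.le]
    _ = η := by rw [hη']; field_simp

/-- The right derivative of `t ↦ E[d(X_0) exp(∫₀ᵗ V(X_r) dr) y(X_t)]` for `y` in the domain of the
generator. -/
theorem IsInvariant.tendsto_feynmanKac_slope (d : Lp ℝ 2 π) (t : ℝ≥0) (y : (M.gen π h).domain) :
    Tendsto (fun r : ℝ≥0 => (r : ℝ)⁻¹ *
        (h.feynmanKac hV hC d (t + r) y - h.feynmanKac hV hC d t y)) (𝓝[>] 0)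
      (𝓝 (h.feynmanKac hV hC d t (M.gen π h y + mulL2 π hV hC y))) := by
  set W := h.tilted hV hC d with hW
  -- The increment splits into the motion of the process, which the Markov property turns into the
  -- generator, the linear growth of the weight, which gives the potential, and a remainder of order
  -- `r²` from `exp x - 1 - x`.
  have h1 : Tendsto (fun r : ℝ≥0 => inner ℝ (W t) (h.evalL2 t
      ((r : ℝ)⁻¹ • (kernelL2 (M.transition r) π (h r) y - y)))) (𝓝[>] 0)
      (𝓝 (inner ℝ (W t) (h.evalL2 t (M.gen π h y)))) := by
    have hg := generator_spec (fun t => kernelL2 (M.transition t) π (h t)) y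
    have hcont : Continuous fun k : Lp ℝ 2 π => (inner ℝ (W t) (h.evalL2 t k) : ℝ) := by fun_prop
    exact (hcont.tendsto _).comp hg
  have h2 := h.tendsto_incrementL2 hV hC (W t) t (y : Lp ℝ 2 π)
  have h3 : Tendsto (fun r : ℝ≥0 => (r : ℝ)⁻¹ * inner ℝ
      (W (t + r) - W t - M.incrementL2 _ hV hC t (t + r) (W t)) (h.evalL2 (t + r) y))
      (𝓝[>] 0) (𝓝 0) := by
    have hr : Tendsto (fun r : ℝ≥0 => (r : ℝ)) (𝓝[>] 0) (𝓝 0) :=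
      (NNReal.continuous_coe.tendsto' 0 0 rfl).mono_left nhdsWithin_le_nhds
    have hCr : Tendsto (fun r : ℝ≥0 => C * (r : ℝ)) (𝓝[>] 0) (𝓝 0) := by
      simpa using hr.const_mul C
    refine squeeze_zero_norm' (a := fun r : ℝ≥0 => (r : ℝ) * (C ^ 2 * (‖W t‖ * ‖(y : Lp ℝ 2 π)‖)))
      ?_ (by simpa using hr.mul_const (C ^ 2 * (‖W t‖ * ‖(y : Lp ℝ 2 π)‖)))
    filter_upwards [self_mem_nhdsWithin, hCr.eventually_le_const zero_lt_one] with r hr0 hr1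
    have hr0' : (0 : ℝ) < r := hr0
    have habs : |((t + r : ℝ≥0) : ℝ) - t| = r := by
      rw [NNReal.coe_add, add_sub_cancel_left, NNReal.abs_eq]
    have h4 := h.norm_tilted_sub_sub_le hV hC d t (t + r) (by rwa [habs])
    rw [habs] at h4
    rw [norm_mul, norm_inv, Real.norm_of_nonneg hr0'.le]
    have h5 := (norm_inner_le_norm (𝕜 := ℝ)
      (W (t + r) - W t - M.incrementL2 _ hV hC t (t + r) (W t)) (h.evalL2 (t + r) y)).trans
      (mul_le_mul_of_nonneg_right h4 (norm_nonneg _))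
    rw [LinearIsometry.norm_map] at h5
    refine (mul_le_mul_of_nonneg_left h5 (inv_pos.2 hr0').le).trans_eq ?_
    field_simp
    ring
  have h6 := (h1.add h2).add h3
  rw [add_zero, ← inner_add_right, ← map_add] at h6
  refine h6.congr fun r => ?_
  have h7 : inner ℝ (W t) (h.evalL2 (t + r) y) =
      inner ℝ (W t) (h.evalL2 t (kernelL2 (M.transition r) π (h r) y)) :=
    h.inner_evalL2_add (stronglyMeasurable_weight d t hV) (h.tilted_ae hV hC d t) y r
  rw [map_smul, inner_smul_right, map_sub, inner_sub_right, ← h7, ← mul_add, ← mul_add,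
    inner_sub_left, inner_sub_left]
  congr 1
  change _ = inner ℝ (W (t + r)) (h.evalL2 (t + r) y) - inner ℝ (W t) (h.evalL2 t y)
  ring

theorem IsInvariant.hasDerivWithinAt_feynmanKac (d : Lp ℝ 2 π) {t : ℝ} (ht : 0 ≤ t)
    (y : (M.gen π h).domain) :
    HasDerivWithinAt (fun t : ℝ => h.feynmanKac hV hC d t.toNNReal y)
      (h.feynmanKac hV hC d t.toNNReal (M.gen π h y + mulL2 π hV hC y)) (Set.Ioi t) t := by
  rw [hasDerivWithinAt_iff_tendsto_slope' (by simp)]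
  have h1 := h.tendsto_feynmanKac_slope hV hC d t.toNNReal y
  have h2 : Tendsto (fun s : ℝ => (s - t).toNNReal) (𝓝[>] t) (𝓝[>] 0) := by
    refine tendsto_nhdsWithin_iff.2 ⟨?_, ?_⟩
    · have : Continuous fun s : ℝ => (s - t).toNNReal := by fun_prop
      exact (this.tendsto' t 0 (by simp)).mono_left nhdsWithin_le_nhds
    · filter_upwards [self_mem_nhdsWithin] with s hs
      exact Real.toNNReal_pos.2 (sub_pos.2 hs)
  refine (h1.comp h2).congr' ?_
  filter_upwards [self_mem_nhdsWithin] with s hs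
  have hs' : 0 ≤ s - t := (sub_pos.2 hs).le
  rw [Function.comp_apply, slope_def_field, ← Real.toNNReal_add ht hs', add_sub_cancel,
    Real.coe_toNNReal _ hs', inv_mul_eq_div]

/-- Dynkin's formula for the Feynman–Kac functional. -/
theorem IsInvariant.feynmanKac_hasDerivAt (d : Lp ℝ 2 π) {t : ℝ} (ht : 0 < t)
    (y : (M.gen π h).domain) :
    HasDerivAt (fun t : ℝ => h.feynmanKac hV hC d t.toNNReal y)
      (h.feynmanKac hV hC d t.toNNReal (M.gen π h y + mulL2 π hV hC y)) t := by
  have hc : ∀ g : Lp ℝ 2 π, Continuous fun t : ℝ => h.feynmanKac hV hC d t.toNNReal g :=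
    fun g => (h.continuous_feynmanKac hV hC d g).comp continuous_real_toNNReal
  set ℓ := fun t : ℝ => h.feynmanKac hV hC d t.toNNReal (M.gen π h y + mulL2 π hV hC y) with hℓ
  -- Only a right derivative is known so far, but it is continuous in time. The functional is
  -- therefore its primitive, hence differentiable from both sides.
  have h1 : ∀ s : ℝ, 0 ≤ s → h.feynmanKac hV hC d s.toNNReal y =
      (∫ r in (0 : ℝ)..s, ℓ r) + h.feynmanKac hV hC d (0 : ℝ).toNNReal y := by
    intro s hs
    rw [intervalIntegral.integral_eq_sub_of_hasDeriv_right (f := fun t : ℝ =>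
      h.feynmanKac hV hC d t.toNNReal y) (f' := ℓ) (hc y).continuousOn
      (fun x hx => ?_) ((hc _).intervalIntegrable _ _), sub_add_cancel]
    rw [min_eq_left hs] at hx
    exact h.hasDerivWithinAt_feynmanKac hV hC d hx.1.le y
  have h2 : HasDerivAt (fun s => (∫ r in (0 : ℝ)..s, ℓ r) +
      h.feynmanKac hV hC d (0 : ℝ).toNNReal y) (ℓ t) t :=
    (intervalIntegral.integral_hasDerivAt_right ((hc _).intervalIntegrable _ _)
      ((hc _).stronglyMeasurableAtFilter _ _) (hc _).continuousAt).add_const _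
  refine h2.congr_of_eventuallyEq ?_
  filter_upwards [lt_mem_nhds ht] with s hs
  exact h1 s hs.le

end Tilted

end MarkovProcess

/-! ### Averages over Gamma distributed times. -/

section GammaAverage

/-- The density of the Gamma distribution with shape `k + 1` and scale `h`. -/
def gammaDensity (h : ℝ) (k : ℕ) (t : ℝ) : ℝ :=
  t ^ k * Real.exp (-(t / h)) / (k.factorial * h ^ (k + 1))

/-- The average of `φ` against the Gamma distribution with shape `k + 1` and scale `h`. -/
def gammaAverage (h : ℝ) (k : ℕ) (φ : ℝ → ℝ) : ℝ := ∫ t in Set.Ioi (0 : ℝ), gammaDensity h k t * φ t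

/-- Continuous functions on `ℝ` of exponential growth less than `e^{t / h}` on the positive axis. -/
def SubexpGrowth (h : ℝ) (φ : ℝ → ℝ) : Prop :=
  Continuous φ ∧ ∃ K C : ℝ, h * C < 1 ∧ ∀ t, 0 ≤ t → |φ t| ≤ K * Real.exp (C * t)

variable {h : ℝ}

theorem gammaDensity_nonneg (h0 : 0 < h) (k : ℕ) {t : ℝ} (ht : 0 ≤ t) : 0 ≤ gammaDensity h k t := by
  unfold gammaDensity
  positivity

theorem continuous_gammaDensity (h : ℝ) (k : ℕ) : Continuous (gammaDensity h k) := by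
  unfold gammaDensity
  fun_prop

theorem hasDerivAt_gammaDensity_zero (h t : ℝ) :
    HasDerivAt (gammaDensity h 0) (-(gammaDensity h 0 t) / h) t := by
  have h1 : HasDerivAt (fun t : ℝ => Real.exp (-(t / h))) (Real.exp (-(t / h)) * (-(1 / h))) t :=
    ((hasDerivAt_id t).div_const h).neg.exp
  have h2 := h1.div_const h
  unfold gammaDensity
  simp only [pow_zero, one_mul, Nat.factorial_zero, Nat.cast_one, zero_add, pow_one]
  refine h2.congr_deriv ?_
  ring

theorem hasDerivAt_gammaDensity_succ (h0 : 0 < h) (k : ℕ) (t : ℝ) :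
    HasDerivAt (gammaDensity h (k + 1)) ((gammaDensity h k t - gammaDensity h (k + 1) t) / h) t := by
  have h1 : HasDerivAt (fun t : ℝ => Real.exp (-(t / h))) (Real.exp (-(t / h)) * (-(1 / h))) t :=
    ((hasDerivAt_id t).div_const h).neg.exp
  have h2 := ((hasDerivAt_pow (k + 1) t).mul h1).div_const ((k + 1).factorial * h ^ (k + 1 + 1))
  refine h2.congr_deriv ?_
  unfold gammaDensity
  rw [Nat.factorial_succ]
  have : (k.factorial : ℝ) ≠ 0 := by positivity
  push_cast
  field_simp
  ring

theorem SubexpGrowth.integrableOn {φ : ℝ → ℝ} (hφ : SubexpGrowth h φ) (h0 : 0 < h) (k : ℕ) :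
    IntegrableOn (fun t => gammaDensity h k t * φ t) (Set.Ioi 0) := by
  obtain ⟨hc, K, C, hC, hb⟩ := hφ
  have hω : 0 < 1 / h - C := by
    rw [sub_pos, lt_div_iff₀ h0]
    linarith
  have h1 : IntegrableOn (fun t : ℝ => t ^ (k : ℝ) * Real.exp (-(1 / h - C) * t ^ (1 : ℝ)))
      (Set.Ioi 0) :=
    integrableOn_rpow_mul_exp_neg_mul_rpow (by linarith [(Nat.cast_nonneg k : (0 : ℝ) ≤ k)])
      one_pos hω
  refine (h1.const_mul (K / (k.factorial * h ^ (k + 1)))).mono'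
    ((continuous_gammaDensity h k).mul hc).aestronglyMeasurable ?_
  filter_upwards [ae_restrict_mem measurableSet_Ioi] with t ht
  have ht0 : (0 : ℝ) < t := ht
  rw [norm_mul, Real.norm_of_nonneg (gammaDensity_nonneg h0 k ht0.le)]
  refine (mul_le_mul_of_nonneg_left (hb t ht0.le) (gammaDensity_nonneg h0 k ht0.le)).trans_eq ?_
  rw [Real.rpow_one, Real.rpow_natCast, gammaDensity,
    show -(1 / h - C) * t = -(t / h) + C * t by ring, Real.exp_add]
  ring

theorem SubexpGrowth.tendsto {φ : ℝ → ℝ} (hφ : SubexpGrowth h φ) (h0 : 0 < h) (k : ℕ) :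
    Tendsto (fun t => gammaDensity h k t * φ t) atTop (𝓝 0) := by
  obtain ⟨hc, K, C, hC, hb⟩ := hφ
  have hω : 0 < 1 / h - C := by
    rw [sub_pos, lt_div_iff₀ h0]
    linarith
  have h1 := (tendsto_rpow_mul_exp_neg_mul_atTop_nhds_zero (k : ℝ) _ hω).const_mul
    (K / (k.factorial * h ^ (k + 1)))
  rw [mul_zero] at h1
  refine squeeze_zero_norm' ?_ h1
  filter_upwards [eventually_gt_atTop 0] with t ht0
  rw [norm_mul, Real.norm_of_nonneg (gammaDensity_nonneg h0 k ht0.le)]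
  refine (mul_le_mul_of_nonneg_left (hb t ht0.le) (gammaDensity_nonneg h0 k ht0.le)).trans_eq ?_
  rw [Real.rpow_natCast, gammaDensity,
    show -(1 / h - C) * t = -(t / h) + C * t by ring, Real.exp_add]
  ring

theorem gammaAverage_add (h0 : 0 < h) (k : ℕ) {φ ψ : ℝ → ℝ} (hφ : SubexpGrowth h φ)
    (hψ : SubexpGrowth h ψ) :
    gammaAverage h k (fun t => φ t + ψ t) = gammaAverage h k φ + gammaAverage h k ψ := by
  simp only [gammaAverage, mul_add]
  exact integral_add (hφ.integrableOn h0 k) (hψ.integrableOn h0 k)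

theorem gammaAverage_const_mul (h : ℝ) (k : ℕ) (c : ℝ) (φ : ℝ → ℝ) :
    gammaAverage h k (fun t => c * φ t) = c * gammaAverage h k φ := by
  simp only [gammaAverage, mul_left_comm _ c]
  exact integral_const_mul _ _

theorem gammaAverage_mono (h0 : 0 < h) (k : ℕ) {φ ψ : ℝ → ℝ} (hφ : SubexpGrowth h φ)
    (hψ : SubexpGrowth h ψ) (hle : ∀ t, 0 ≤ t → φ t ≤ ψ t) :
    gammaAverage h k φ ≤ gammaAverage h k ψ :=
  setIntegral_mono_on (hφ.integrableOn h0 k) (hψ.integrableOn h0 k) measurableSet_Ioi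
    fun t ht => mul_le_mul_of_nonneg_left (hle t (le_of_lt ht)) (gammaDensity_nonneg h0 k (le_of_lt ht))

/-- Integration by parts; the exponential density equals `1 / h` at `0`, which leaves the boundary
term `φ 0`. -/
theorem gammaAverage_zero_sub_deriv (h0 : 0 < h) {φ ℓ : ℝ → ℝ} (hφ : SubexpGrowth h φ)
    (hℓ : SubexpGrowth h ℓ) (hd : ∀ t, 0 < t → HasDerivAt φ (ℓ t) t) :
    gammaAverage h 0 φ = φ 0 + h * gammaAverage h 0 ℓ := by
  have h1 : ∀ t ∈ Set.Ioi (0 : ℝ), HasDerivAt (fun t => -h * (gammaDensity h 0 t * φ t))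
      (gammaDensity h 0 t * φ t - h * (gammaDensity h 0 t * ℓ t)) t := fun t ht => by
    refine (((hasDerivAt_gammaDensity_zero h t).mul (hd t ht)).const_mul (-h)).congr_deriv ?_
    field_simp
    ring
  have h2 := integral_Ioi_of_hasDerivAt_of_tendsto (Continuous.continuousWithinAt (by
      have := continuous_gammaDensity h 0
      have := hφ.1
      fun_prop)) h1
    ((hφ.integrableOn h0 0).sub ((hℓ.integrableOn h0 0).const_mul h))
    (by simpa using (hφ.tendsto h0 0).const_mul (-h))
  rw [integral_sub (hφ.integrableOn h0 0) ((hℓ.integrableOn h0 0).const_mul h),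
    integral_const_mul] at h2
  have h3 : gammaDensity h 0 0 = 1 / h := by simp [gammaDensity]
  rw [h3] at h2
  unfold gammaAverage
  rw [eq_add_of_sub_eq h2]
  field_simp
  ring

/-- For larger shapes the density vanishes at `0` and its derivative involves the previous density,
so passing from `φ` to `φ - h φ'` lowers the shape by one. -/
theorem gammaAverage_succ_sub_deriv (h0 : 0 < h) (k : ℕ) {φ ℓ : ℝ → ℝ} (hφ : SubexpGrowth h φ)
    (hℓ : SubexpGrowth h ℓ) (hd : ∀ t, 0 < t → HasDerivAt φ (ℓ t) t) :
    gammaAverage h (k + 1) φ = gammaAverage h k φ + h * gammaAverage h (k + 1) ℓ := by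
  have h1 : ∀ t ∈ Set.Ioi (0 : ℝ), HasDerivAt (fun t => -h * (gammaDensity h (k + 1) t * φ t))
      (gammaDensity h (k + 1) t * φ t - gammaDensity h k t * φ t
        - h * (gammaDensity h (k + 1) t * ℓ t)) t := fun t ht => by
    refine (((hasDerivAt_gammaDensity_succ h0 k t).mul (hd t ht)).const_mul (-h)).congr_deriv ?_
    field_simp
    ring
  have hi1 : IntegrableOn (fun t => gammaDensity h (k + 1) t * φ t - gammaDensity h k t * φ t)
      (Set.Ioi 0) := (hφ.integrableOn h0 (k + 1)).sub (hφ.integrableOn h0 k)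
  have hi2 := (hℓ.integrableOn h0 (k + 1)).const_mul h
  have h2 := integral_Ioi_of_hasDerivAt_of_tendsto (Continuous.continuousWithinAt (by
      have := continuous_gammaDensity h (k + 1)
      have := hφ.1
      fun_prop)) h1 (hi1.sub hi2) (by simpa using (hφ.tendsto h0 (k + 1)).const_mul (-h))
  rw [integral_sub hi1 hi2, integral_sub (hφ.integrableOn h0 (k + 1)) (hφ.integrableOn h0 k),
    integral_const_mul] at h2
  have h3 : gammaDensity h (k + 1) 0 = 0 := by simp [gammaDensity]
  rw [h3] at h2
  unfold gammaAverage
  linarith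

theorem subexpGrowth_const (h c : ℝ) : SubexpGrowth h fun _ => c :=
  ⟨continuous_const, |c|, 0, by simp, fun t _ => by simp⟩

theorem subexpGrowth_id (h0 : 0 < h) : SubexpGrowth h fun t => t := by
  refine ⟨continuous_id, 2 * h, 1 / (2 * h), by field_simp; norm_num, fun t ht => ?_⟩
  have h1 := Real.add_one_le_exp (1 / (2 * h) * t)
  rw [abs_of_nonneg ht]
  have h2 := mul_le_mul_of_nonneg_left h1 (by positivity : 0 ≤ 2 * h)
  have h3 : 2 * h * (1 / (2 * h) * t + 1) = t + 2 * h := by field_simp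
  linarith

theorem subexpGrowth_sq (h0 : 0 < h) : SubexpGrowth h fun t => t ^ 2 := by
  refine ⟨by fun_prop, 8 * h ^ 2, 1 / (2 * h), by field_simp; norm_num, fun t ht => ?_⟩
  have h1 := Real.quadratic_le_exp_of_nonneg (x := 1 / (2 * h) * t) (by positivity)
  rw [abs_of_nonneg (by positivity)]
  have h2 := mul_le_mul_of_nonneg_left h1 (by positivity : 0 ≤ 8 * h ^ 2)
  have h3 : 8 * h ^ 2 * (1 + 1 / (2 * h) * t + (1 / (2 * h) * t) ^ 2 / 2) =
      8 * h ^ 2 + 4 * h * t + t ^ 2 := by field_simp; ring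
  nlinarith [mul_nonneg h0.le ht, sq_nonneg h]

theorem SubexpGrowth.const_mul {φ : ℝ → ℝ} (hφ : SubexpGrowth h φ) (c : ℝ) :
    SubexpGrowth h fun t => c * φ t := by
  obtain ⟨hc, K, C, hC, hb⟩ := hφ
  refine ⟨by fun_prop, |c| * K, C, hC, fun t ht => ?_⟩
  rw [abs_mul, mul_assoc]
  exact mul_le_mul_of_nonneg_left (hb t ht) (abs_nonneg _)

theorem SubexpGrowth.add {φ ψ : ℝ → ℝ} (hφ : SubexpGrowth h φ)
    (hψ : SubexpGrowth h ψ) : SubexpGrowth h fun t => φ t + ψ t := by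
  obtain ⟨hc, K, C, hC, hb⟩ := hφ
  obtain ⟨hc', K', C', hC', hb'⟩ := hψ
  refine ⟨by fun_prop, |K| + |K'|, max C C', ?_, fun t ht => ?_⟩
  · rcases max_choice C C' with hm | hm <;> rw [hm] <;> assumption
  · have h1 : ∀ K₀ C₀ : ℝ, C₀ ≤ max C C' →
        K₀ * Real.exp (C₀ * t) ≤ |K₀| * Real.exp (max C C' * t) := fun K₀ C₀ hC₀ =>
      mul_le_mul (le_abs_self _) (Real.exp_le_exp.2 (mul_le_mul_of_nonneg_right hC₀ ht))
        (Real.exp_pos _).le (abs_nonneg _)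
    have h2 := h1 K C (le_max_left _ _)
    have h3 := h1 K' C' (le_max_right _ _)
    have h4 := hb t ht
    have h5 := hb' t ht
    rw [add_mul]
    exact (abs_add_le _ _).trans (by linarith)

theorem gammaAverage_one (h0 : 0 < h) (k : ℕ) : gammaAverage h k (fun _ => 1) = 1 := by
  have hz : ∀ k, gammaAverage h k (fun _ => 0) = 0 := fun k => by simp [gammaAverage]
  induction k with
  | zero =>
    rw [gammaAverage_zero_sub_deriv h0 (subexpGrowth_const h 1) (subexpGrowth_const h 0)
      (fun t _ => hasDerivAt_const t 1), hz]
    ring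
  | succ k ih =>
    rw [gammaAverage_succ_sub_deriv h0 k (subexpGrowth_const h 1) (subexpGrowth_const h 0)
      (fun t _ => hasDerivAt_const t 1), hz, ih]
    ring

theorem gammaAverage_id (h0 : 0 < h) (k : ℕ) : gammaAverage h k (fun t => t) = (k + 1) * h := by
  induction k with
  | zero =>
    rw [gammaAverage_zero_sub_deriv h0 (subexpGrowth_id h0) (subexpGrowth_const h 1)
      (fun t _ => hasDerivAt_id t), gammaAverage_one h0]
    simp
  | succ k ih =>
    rw [gammaAverage_succ_sub_deriv h0 k (subexpGrowth_id h0) (subexpGrowth_const h 1)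
      (fun t _ => hasDerivAt_id t), gammaAverage_one h0, ih]
    push_cast
    ring

theorem gammaAverage_sq (h0 : 0 < h) (k : ℕ) :
    gammaAverage h k (fun t => t ^ 2) = (k + 1) * (k + 2) * h ^ 2 := by
  have hd : ∀ t : ℝ, 0 < t → HasDerivAt (fun t : ℝ => t ^ 2) (2 * t) t := fun t _ => by
    simpa using hasDerivAt_pow 2 t
  induction k with
  | zero =>
    rw [gammaAverage_zero_sub_deriv h0 (subexpGrowth_sq h0) ((subexpGrowth_id h0).const_mul 2) hd,
      gammaAverage_const_mul, gammaAverage_id h0]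
    push_cast
    ring
  | succ k ih =>
    rw [gammaAverage_succ_sub_deriv h0 k (subexpGrowth_sq h0)
      ((subexpGrowth_id h0).const_mul 2) hd, gammaAverage_const_mul, gammaAverage_id h0, ih]
    push_cast
    ring

/-- A function that is almost constant near the mean `T` has Gamma averages close to its value at `T`. -/
theorem le_gammaAverage (h0 : 0 < h) (k : ℕ) {φ : ℝ → ℝ} (hφ : SubexpGrowth h φ) {a C c T : ℝ}
    (ha : 0 ≤ a) (hC : 0 ≤ C) (hc : 0 < c) (hT : T = (k + 1) * h)
    (hle : ∀ t, 0 ≤ t → a * Real.exp (-(C * |t - T|)) ≤ φ t) :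
    a * (1 - C * ((c + (k + 1) * h ^ 2 / c) / 2)) ≤ gammaAverage h k φ := by
  -- Leading coefficient of a quadratic minorant of `φ`, from `exp(-x) ≥ 1 - x` and `|t - T| ≤ (c +
  -- (t - T)² / c) / 2`. Its average needs only the mean `(k + 1) h` and variance `(k + 1) h²`.
  set A := -(a * C / (2 * c)) with hA
  have hψ : SubexpGrowth h fun t => A * t ^ 2 + ((-(2 * T * A)) * t +
      (a - a * C * c / 2 + A * T ^ 2)) :=
    ((subexpGrowth_sq h0).const_mul A).add
      (((subexpGrowth_id h0).const_mul _).add (subexpGrowth_const h _))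
  have h1 := gammaAverage_mono h0 k hψ hφ fun t ht => ?_
  · rw [gammaAverage_add h0 k ((subexpGrowth_sq h0).const_mul A)
      (((subexpGrowth_id h0).const_mul _).add (subexpGrowth_const h _)),
      gammaAverage_add h0 k ((subexpGrowth_id h0).const_mul _) (subexpGrowth_const h _),
      gammaAverage_const_mul, gammaAverage_const_mul, gammaAverage_sq h0, gammaAverage_id h0] at h1
    have h2 := gammaAverage_const_mul h k (a - a * C * c / 2 + A * T ^ 2) (fun _ => 1)
    simp only [mul_one] at h2
    rw [h2, gammaAverage_one h0] at h1
    refine le_trans (le_of_eq ?_) h1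
    rw [hA, hT]
    field_simp
    ring
  · refine le_trans ?_ (hle t ht)
    have h3 : 1 - C * |t - T| ≤ Real.exp (-(C * |t - T|)) := by
      linarith [Real.add_one_le_exp (-(C * |t - T|))]
    have h4 : |t - T| ≤ c / 2 + (t - T) ^ 2 / (2 * c) := by
      have : c / 2 + (t - T) ^ 2 / (2 * c) - |t - T| = (c - |t - T|) ^ 2 / (2 * c) := by
        rw [sub_sq c, sq_abs]
        field_simp
        ring
      have h5 : 0 ≤ (c - |t - T|) ^ 2 / (2 * c) := by positivity
      linarith
    have h6 := mul_le_mul_of_nonneg_left h3 ha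
    have h7 := mul_le_mul_of_nonneg_left h4 (mul_nonneg ha hC)
    have h8 : A * t ^ 2 + ((-(2 * T * A)) * t + (a - a * C * c / 2 + A * T ^ 2)) =
        a - a * C * (c / 2 + (t - T) ^ 2 / (2 * c)) := by
      rw [hA]
      field_simp
      ring
    rw [h8]
    linarith

end GammaAverage

/-! ### Exponential growth bound by implicit Euler steps and duality. -/

namespace MarkovProcess

variable {E Ω : Type*} [TopologicalSpace E] [MeasurableSpace E] [MeasurableSpace Ω]
  [PolishSpace E] [BorelSpace E] {M : MarkovProcess E Ω} {π : Measure E} [IsProbabilityMeasure π]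
  (h : M.IsInvariant π) {V : E → ℝ} (hV : Measurable V) {C : ℝ} (hC : ∀ x, |V x| ≤ C)

theorem IsInvariant.subexpGrowth_feynmanKac (d g : Lp ℝ 2 π) {η : ℝ} (hη : η * C < 1) :
    SubexpGrowth η fun t => h.feynmanKac hV hC d t.toNNReal g := by
  refine ⟨(h.continuous_feynmanKac hV hC d g).comp continuous_real_toNNReal, ‖d‖ * ‖g‖, C, hη,
    fun t ht => ?_⟩
  have h1 := h.abs_feynmanKac_le hV hC d t.toNNReal g
  rw [Real.coe_toNNReal t ht] at h1
  linarith

/-- By Dynkin's formula the functional of `y j` is `φ - η φ'`, with `φ` that of `y (j + 1)`. Each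
Euler step thus trades one unit of shape for one of the index, and the last one leaves the value at
time `0`. -/
theorem IsInvariant.gammaAverage_feynmanKac (d : Lp ℝ 2 π) {η : ℝ} (hη0 : 0 < η) (hη : η * C < 1)
    {y : ℕ → Lp ℝ 2 π} (hy : ∀ n, ∃ hy : y (n + 1) ∈ (M.gen π h).domain,
      y (n + 1) - η • (M.gen π h ⟨_, hy⟩ + mulL2 π hV hC (y (n + 1))) = y n) (k j : ℕ) :
    gammaAverage η k (fun t => h.feynmanKac hV hC d t.toNNReal (y j)) =
      inner ℝ d (y (j + k + 1)) := by
  have hg : ∀ g, SubexpGrowth η fun t => h.feynmanKac hV hC d t.toNNReal g :=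
    fun g => h.subexpGrowth_feynmanKac hV hC d g hη
  have hsplit : ∀ k j, ∃ hy : y (j + 1) ∈ (M.gen π h).domain,
      gammaAverage η k (fun t => h.feynmanKac hV hC d t.toNNReal (y j)) =
      gammaAverage η k (fun t => h.feynmanKac hV hC d t.toNNReal (y (j + 1))) -
      η * gammaAverage η k (fun t => h.feynmanKac hV hC d t.toNNReal
        (M.gen π h ⟨_, hy⟩ + mulL2 π hV hC (y (j + 1)))) := fun k j => by
    obtain ⟨hd, he⟩ := hy j
    refine ⟨hd, ?_⟩
    rw [← gammaAverage_const_mul, eq_sub_iff_add_eq, ← gammaAverage_add hη0 k (hg _)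
      ((hg _).const_mul η)]
    congr 1
    ext t
    rw [← h.feynmanKac_smul, ← h.feynmanKac_add, ← he, sub_add_cancel]
  induction k generalizing j with
  | zero =>
    obtain ⟨hd, he⟩ := hsplit 0 j
    rw [he, gammaAverage_zero_sub_deriv hη0 (hg _) (hg _)
      (fun t ht => h.feynmanKac_hasDerivAt hV hC d ht ⟨_, hd⟩), add_sub_cancel_right,
      Real.toNNReal_zero, h.feynmanKac_zero]
  | succ k ih =>
    obtain ⟨hd, he⟩ := hsplit (k + 1) j
    rw [he, gammaAverage_succ_sub_deriv hη0 k (hg _) (hg _)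
      (fun t ht => h.feynmanKac_hasDerivAt hV hC d ht ⟨_, hd⟩), add_sub_cancel_right, ih]
    congr 2
    omega

/-- Exponential growth bound for the Feynman–Kac functional of a nonnegative density. -/
theorem IsInvariant.feynmanKac_le_exp {d e : Lp ℝ 2 π}
    (hmono : ∀ s t : ℝ≥0, h.feynmanKac hV hC d s e * Real.exp (-(C * |(t : ℝ) - s|)) ≤
      h.feynmanKac hV hC d t e) {ε : ℝ} {B : Lp ℝ 2 π →L[ℝ] Lp ℝ 2 π} (hε : ε < 1)
    (hpos : ∀ f, (1 - ε) * ‖f‖ ^ 2 ≤ modInner ε B f f) {κ : ℝ}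
    (hd : ∀ y : (M.gen π h).domain,
      modInner ε B (M.gen π h y + mulL2 π hV hC y) y ≤ κ * modInner ε B y y) {T : ℝ≥0}
    (hT : 0 < T) :
    h.feynmanKac hV hC d T e ≤
      ‖d‖ * √(modInner ε B e e / (1 - ε)) * Real.exp (κ * T) := by
  -- The comparison with Gamma averages needs a nonnegative value; a negative one satisfies the
  -- bound trivially.
  rcases lt_or_ge (h.feynmanKac hV hC d T e) 0 with hneg | ha
  · exact hneg.le.trans (by positivity)
  set a := h.feynmanKac hV hC d T e with hadef
  have hT' : (0 : ℝ) < T := hT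
  have hC0 : 0 ≤ C := (abs_nonneg _).trans (hC (Classical.choice π.nonempty_of_neZero))
  have hmpos : ∀ f, 0 ≤ modInner ε B f f := fun f =>
    (mul_nonneg (by linarith) (sq_nonneg _)).trans (hpos f)
  have h0 : Tendsto (fun n : ℕ => (T : ℝ) / n) atTop (𝓝 0) := tendsto_const_div_atTop_nhds_zero_nat _
  have hsmall : ∀ c : ℝ, ∀ᶠ n : ℕ in atTop, (T : ℝ) / n * c < 1 := fun c => by
    have := h0.mul_const c
    rw [zero_mul] at this
    exact this.eventually_lt_const one_pos
  have hsqrt : Tendsto (fun n : ℕ => 1 / √(n : ℝ)) atTop (𝓝 0) := by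
    simp_rw [one_div]
    exact (Real.tendsto_sqrt_atTop.comp tendsto_natCast_atTop_atTop).inv_tendsto_atTop
  have hlim : Tendsto (fun n : ℕ =>
      a * (1 - C * ((1 + (T : ℝ) ^ 2) / 2 * (1 / √(n : ℝ)))) * (1 + -(κ * T) / (n : ℝ)) ^ n) atTop
      (𝓝 (a * (1 - C * ((1 + (T : ℝ) ^ 2) / 2 * 0)) * Real.exp (-(κ * T)))) :=
    (tendsto_const_nhds.mul (tendsto_const_nhds.sub
      ((hsqrt.const_mul _).const_mul _))).mul (Real.tendsto_one_add_div_pow_exp _)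
  have hbound : ∀ᶠ n : ℕ in atTop,
      a * (1 - C * ((1 + (T : ℝ) ^ 2) / 2 * (1 / √(n : ℝ)))) * (1 + -(κ * T) / (n : ℝ)) ^ n ≤
        ‖d‖ * √(modInner ε B e e / (1 - ε)) := by
    -- For the step `T / n`, these make the Gamma averages converge, keep `1 - ηκ` positive, and
    -- make the Euler equation solvable.
    filter_upwards [eventually_ge_atTop 1, hsmall C, hsmall κ, hsmall ‖mulL2 π hV hC‖]
      with n hn1 hnC hnκ hnV
    have hn : (0 : ℝ) < n := by exact_mod_cast hn1
    set η := (T : ℝ) / n with hη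
    have hη0 : 0 < η := by positivity
    obtain ⟨y, hy0, hy, hyn⟩ := h.isContractionSemigroup.exists_euler_sequence (mulL2 π hV hC)
      hmpos hη0 hnV hnκ.le hd e
    have hnk : ((n - 1 : ℕ) : ℝ) + 1 = n := by
      rw [Nat.cast_sub hn1]
      simp
    have hTη : (T : ℝ) = (((n - 1 : ℕ) : ℝ) + 1) * η := by
      rw [hnk, hη]
      field_simp
    have h1 := h.gammaAverage_feynmanKac hV hC d hη0 hnC hy (n - 1) 0
    rw [zero_add, Nat.sub_add_cancel hn1, hy0] at h1
    -- Index `n - 1` is shape `n`, so the mean is `T` and the variance `T² / n`; with `c = 1 / √n`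
    -- both error terms are of order `1 / √n`.
    have h2 := le_gammaAverage hη0 (n - 1) (h.subexpGrowth_feynmanKac hV hC d e hnC) ha hC0
      (c := 1 / √(n : ℝ)) (by positivity) hTη (fun t ht => by
        have := hmono T t.toNNReal
        rwa [Real.coe_toNNReal t ht] at this)
    rw [h1, hnk] at h2
    have h3 : 1 / √(n : ℝ) + n * η ^ 2 / (1 / √(n : ℝ)) = (1 + (T : ℝ) ^ 2) * (1 / √(n : ℝ)) := by
      have hs : √(n : ℝ) ^ 2 = n := Real.sq_sqrt hn.le
      have hs0 : 0 < √(n : ℝ) := Real.sqrt_pos.2 hn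
      rw [hη]
      field_simp
      rw [hs]
      ring
    rw [h3] at h2
    have hb : 1 + -(κ * T) / (n : ℝ) = 1 - η * κ := by
      rw [hη]
      ring
    have hb0 : 0 ≤ 1 - η * κ := by linarith
    rw [hb]
    have h4 : (1 - η * κ) ^ n * ‖y n‖ ≤ √(modInner ε B e e / (1 - ε)) := by
      refine Real.le_sqrt_of_sq_le ?_
      rw [le_div_iff₀ (by linarith)]
      refine le_trans ?_ (hyn n)
      have := mul_le_mul_of_nonneg_left (hpos (y n)) (pow_nonneg hb0 (2 * n))
      refine le_trans (le_of_eq ?_) this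
      rw [mul_pow, ← pow_mul, mul_comm n 2]
      ring
    have h5 : inner ℝ d (y n) ≤ ‖d‖ * ‖y n‖ := real_inner_le_norm _ _
    calc _ ≤ ‖d‖ * ‖y n‖ * (1 - η * κ) ^ n := by
          refine mul_le_mul_of_nonneg_right (le_trans (le_of_eq ?_) (h2.trans h5))
            (pow_nonneg hb0 n)
          ring
      _ = ‖d‖ * ((1 - η * κ) ^ n * ‖y n‖) := by ring
      _ ≤ _ := mul_le_mul_of_nonneg_left h4 (norm_nonneg _)
  have hfin := le_of_tendsto hlim hbound
  rw [mul_zero, mul_zero, sub_zero, mul_one, Real.exp_neg, ← div_eq_mul_inv,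
    div_le_iff₀ (Real.exp_pos _)] at hfin
  exact hfin

end MarkovProcess

/-! ### Dissipativity of the perturbed generator in the modified scalar product. -/

section Dissipativity

variable {H : Type*} [NormedAddCommGroup H] [InnerProductSpace ℝ H] [CompleteSpace H]

theorem modInner_right_eq_inner {ε : ℝ} {B : H →L[ℝ] H} {e : H} (hBe : B e = 0)
    (heB : ∀ x, inner ℝ e (B x) = 0) (f : H) : modInner ε B f e = inner ℝ f e := by
  have h : inner ℝ (B f) e = 0 := by rw [real_inner_comm, heB]
  rw [modInner, add_apply, hBe, zero_add, ContinuousLinearMap.adjoint_inner_right, h, mul_zero,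
    add_zero]

/-- A bounded perturbation `l V` of an operator with spectral gap `Λ` in the modified scalar product
is dissipative up to the Bernstein-type constant `l² v / (2 (1 - l b))`. -/
theorem modInner_perturbation_le {ε : ℝ} (hε0 : 0 ≤ ε) {B : H →L[ℝ] H}
    (hB : ∀ x, ‖B x‖ ≤ 1 / 2 * ‖x‖) (hε1 : ε ≤ 1) {e : H} (he : ‖e‖ = 1) (hBe : B e = 0)
    (heB : ∀ x, inner ℝ e (B x) = 0) {V : H →L[ℝ] H}
    (hVsymm : ∀ f g, inner ℝ (V f) g = inner ℝ f (V g)) (hVe : inner ℝ (V e) e = 0) {K : ℝ}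
    (hVK : ∀ f, ‖V f‖ ≤ K * ‖f‖) {Λ v b l : ℝ} (hΛ : 0 < Λ)
    (hv : (2 + ε) ^ 2 * ‖V e‖ ^ 2 ≤ 2 * Λ * v) (hb : (1 + ε) * K ≤ Λ * b) (hl : 0 ≤ l)
    (hlb : l * b < 1) {y Ay : H}
    (hA : Λ * ‖y - (inner ℝ y e : ℝ) • e‖ ^ 2 ≤ modInner ε B (-Ay) y) :
    modInner ε B (Ay + l • V y) y ≤ l ^ 2 * v / (2 * (1 - l * b)) * modInner ε B y y := by
  set a : ℝ := inner ℝ y e with ha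
  set g := y - a • e with hg
  have hy : y = a • e + g := by rw [hg]; abel
  have hee : inner ℝ e e = (1 : ℝ) := by rw [real_inner_self_eq_norm_sq, he, one_pow]
  have hge : inner ℝ g e = (0 : ℝ) := by
    rw [hg, inner_sub_left, inner_smul_left, hee, ← ha]
    simp
  have hme := modInner_right_eq_inner (ε := ε) hBe heB
  -- The modification is invisible against `e`, so the cross terms vanish and the part along `e`
  -- contributes exactly `a²`.
  have hself : a ^ 2 ≤ modInner ε B y y := by
    have h1 : modInner ε B y y = a ^ 2 + modInner ε B g g := by
      conv_lhs => rw [hy]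
      rw [modInner_add_left, modInner_add_right, modInner_add_right, modInner_smul_left,
        modInner_smul_left, modInner_smul_right, modInner_smul_right, modInner_comm ε B e g,
        hme, hme, hge, hee]
      ring
    have h2 := le_modInner_self hε0 hB g
    have h3 : 0 ≤ (1 - ε) * ‖g‖ ^ 2 := mul_nonneg (by linarith) (sq_nonneg _)
    linarith
  -- There is no `a²` term because `V e` is orthogonal to `e`. Of the two cross terms one is
  -- modified, costing `1 + ε`, and the other is paired with `e`, costing `1`: hence the constant `2
  -- + ε`.
  have hVy : modInner ε B (V y) y =
      a * (modInner ε B (V e) g + inner ℝ g (V e)) + modInner ε B (V g) g := by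
    conv_lhs => rw [hy]
    rw [map_add, map_smul, modInner_add_left, modInner_add_right, modInner_add_right,
      modInner_smul_left, modInner_smul_left, modInner_smul_right, modInner_smul_right,
      hme, hme, hVe, hVsymm g e]
    ring
  have h1 : |modInner ε B (V e) g + inner ℝ g (V e)| ≤ (2 + ε) * ‖V e‖ * ‖g‖ := by
    have h2 := abs_modInner_le hε0 hB (V e) g
    have h3 := abs_real_inner_le_norm g (V e)
    refine (abs_add_le _ _).trans ?_
    linarith
  have h2 : modInner ε B (V g) g ≤ Λ * b * ‖g‖ ^ 2 := by
    have h3 := (le_abs_self _).trans (abs_modInner_le hε0 hB (V g) g)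
    have h4 := mul_le_mul_of_nonneg_right (hVK g) (norm_nonneg g)
    have h5 := mul_le_mul_of_nonneg_left h4 (by linarith : 0 ≤ 1 + ε)
    have h6 := mul_le_mul_of_nonneg_right hb (sq_nonneg ‖g‖)
    linarith
  have h3 : modInner ε B Ay y ≤ -(Λ * ‖g‖ ^ 2) := by
    rw [← neg_one_smul ℝ, modInner_smul_left] at hA
    linarith
  have hq : 0 < 1 - l * b := by linarith
  have h4 : a * (modInner ε B (V e) g + inner ℝ g (V e)) ≤ |a| * ((2 + ε) * ‖V e‖ * ‖g‖) := by
    refine (le_abs_self _).trans ?_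
    rw [abs_mul]
    exact mul_le_mul_of_nonneg_left h1 (abs_nonneg _)
  have h5 : modInner ε B (Ay + l • V y) y ≤
      l * |a| * ((2 + ε) * ‖V e‖) * ‖g‖ - Λ * (1 - l * b) * ‖g‖ ^ 2 := by
    rw [modInner_add_left, modInner_smul_left, hVy]
    have := mul_le_mul_of_nonneg_left (add_le_add h4 h2) hl
    linarith
  have hv0 : 0 ≤ v := by
    have : 0 ≤ 2 * Λ * v := le_trans (by positivity) hv
    exact nonneg_of_mul_nonneg_right this (by linarith)
  -- Maximising over `‖g‖`: `p x - q x² ≤ p² / (4q)`.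
  have h6 : l * |a| * ((2 + ε) * ‖V e‖) * ‖g‖ - Λ * (1 - l * b) * ‖g‖ ^ 2 ≤
      l ^ 2 * v / (2 * (1 - l * b)) * a ^ 2 := by
    set q := Λ * (1 - l * b) with hqdef
    have hq0 : 0 < q := by positivity
    have h7 : l ^ 2 * v / (2 * (1 - l * b)) * a ^ 2 = l ^ 2 * a ^ 2 * (2 * Λ * v) / (4 * q) := by
      rw [hqdef]
      field_simp
      ring
    rw [h7, le_div_iff₀ (by positivity)]
    have h8 := mul_le_mul_of_nonneg_left hv (by positivity : 0 ≤ l ^ 2 * a ^ 2)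
    have h9 := sq_nonneg (l * |a| * ((2 + ε) * ‖V e‖) - 2 * q * ‖g‖)
    have h10 : (l * |a| * ((2 + ε) * ‖V e‖)) ^ 2 = l ^ 2 * a ^ 2 * ((2 + ε) ^ 2 * ‖V e‖ ^ 2) := by
      rw [mul_pow, mul_pow, sq_abs]
      ring
    nlinarith
  exact h5.trans (h6.trans (mul_le_mul_of_nonneg_left hself (by positivity)))

end Dissipativity

theorem mulL2_const_mul {α : Type*} [MeasurableSpace α] {π : Measure α} {u : α → ℝ} (hu : Measurable u) {C : ℝ} (hC : ∀ x, |u x| ≤ C) {l C' : ℝ}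
    (hlu : Measurable fun x => l * u x) (hC' : ∀ x, |l * u x| ≤ C') (f : Lp ℝ 2 π) :
    mulL2 π hlu hC' f = l • mulL2 π hu hC f := by
  refine Lp.ext ?_
  filter_upwards [mulL2_ae hlu hC' f, mulL2_ae hu hC f,
    Lp.coeFn_smul l (mulL2 π hu hC f)] with x h1 h2 h3
  rw [h1, h3, Pi.smul_apply, h2, smul_eq_mul, mul_assoc]

/-! ### The constant function in `L²`. -/

section ConstantFunction

variable {α : Type*} [MeasurableSpace α] (π : Measure α) [IsProbabilityMeasure π]

/-- The constant function `1` in `L²(π)`. -/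
def oneL2 : Lp ℝ 2 π := Lp.const 2 π (1 : ℝ)

theorem oneL2_ae : oneL2 π =ᵐ[π] fun _ => (1 : ℝ) := Lp.coeFn_const 2 π (1 : ℝ)

theorem norm_oneL2 : ‖oneL2 π‖ = 1 := by
  rw [oneL2, Lp.norm_const 2 π (1 : ℝ) (by norm_num)]
  simp

theorem inner_oneL2 (f : Lp ℝ 2 π) : inner ℝ f (oneL2 π) = ∫ x, f x ∂π := by
  rw [MarkovProcess.inner_eq_integral_of_ae (EventuallyEq.refl _ ⇑f) (oneL2_ae π)]
  simp

theorem variance_eq_norm_sq (f : Lp ℝ 2 π) :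
    variance f π = ‖f - (inner ℝ f (oneL2 π) : ℝ) • oneL2 π‖ ^ 2 := by
  rw [variance_eq_integral (Lp.stronglyMeasurable f).measurable.aemeasurable,
    ← real_inner_self_eq_norm_sq]
  have h1 : ⇑(f - (inner ℝ f (oneL2 π) : ℝ) • oneL2 π) =ᵐ[π] fun x => f x - ∫ y, f y ∂π := by
    filter_upwards [Lp.coeFn_sub f ((inner ℝ f (oneL2 π) : ℝ) • oneL2 π),
      Lp.coeFn_smul (inner ℝ f (oneL2 π) : ℝ) (oneL2 π), oneL2_ae π] with x h1 h2 h3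
    rw [h1, Pi.sub_apply, h2, Pi.smul_apply, h3, inner_oneL2, smul_eq_mul, mul_one]
  rw [MarkovProcess.inner_eq_integral_of_ae h1 h1]
  simp_rw [sq]

theorem norm_mulL2_one_sq {u : α → ℝ} (hu : Measurable u) {C : ℝ} (hC : ∀ x, |u x| ≤ C) :
    ‖mulL2 π hu hC (oneL2 π)‖ ^ 2 = ∫ x, u x ^ 2 ∂π := by
  rw [← real_inner_self_eq_norm_sq, inner_mulL2]
  refine integral_congr_ae ?_
  filter_upwards [mulL2_ae hu hC (oneL2 π), oneL2_ae π] with x h1 h2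
  rw [h1, h2]
  ring

theorem inner_mulL2_one {u : α → ℝ} (hu : Measurable u) {C : ℝ} (hC : ∀ x, |u x| ≤ C) :
    inner ℝ (mulL2 π hu hC (oneL2 π)) (oneL2 π) = ∫ x, u x ∂π := by
  rw [inner_mulL2]
  refine integral_congr_ae ?_
  filter_upwards [oneL2_ae π] with x h2
  rw [h2]
  ring

end ConstantFunction

/-! ### Invariance of constants, change of the initial law, and the one-sided Bernstein inequality.
-/

namespace MarkovProcess

variable {E Ω : Type*} [TopologicalSpace E] [MeasurableSpace E] [MeasurableSpace Ω]
  {M : MarkovProcess E Ω} {π : Measure E} [IsProbabilityMeasure π] (h : M.IsInvariant π)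

theorem IsInvariant.evalL2_one (t : ℝ≥0) : h.evalL2 t (oneL2 π) = oneL2 (M.law π) := by
  refine Lp.ext ?_
  filter_upwards [h.evalL2_ae t (oneL2 π), h.ae_comp (oneL2_ae π) t, oneL2_ae (M.law π)]
    with ω h1 h2 h3
  rw [h1, h2, h3]

theorem IsInvariant.kernelL2_one (t : ℝ≥0) :
    kernelL2 (M.transition t) π (h t) (oneL2 π) = oneL2 π := by
  have h1 := h.norm_kernelL2_sub_le t (oneL2 π)
  rw [h.evalL2_one, h.evalL2_one, sub_self, norm_zero] at h1
  exact sub_eq_zero.1 (norm_le_zero_iff.1 h1)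

theorem IsInvariant.inner_one_kernelL2 (t : ℝ≥0) (f : Lp ℝ 2 π) :
    inner ℝ (oneL2 π) (kernelL2 (M.transition t) π (h t) f) = inner ℝ (oneL2 π) f := by
  rw [← h.inner_evalL2_evalL2 0 t, zero_add, h.evalL2_one, ← h.evalL2_one t,
    LinearIsometry.inner_map_map]

theorem IsInvariant.one_mem_domain :
    ∃ h1 : oneL2 π ∈ (M.gen π h).domain, M.gen π h ⟨_, h1⟩ = 0 := by
  have key : Tendsto (fun t : ℝ≥0 => (t : ℝ)⁻¹ •
      (kernelL2 (M.transition t) π (h t) (oneL2 π) - oneL2 π)) (𝓝[>] 0) (𝓝 0) := by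
    simp_rw [h.kernelL2_one, sub_self, smul_zero]
    exact tendsto_const_nhds
  exact ⟨⟨0, key⟩, tendsto_nhds_unique (generator_spec _ ⟨oneL2 π, ⟨0, key⟩⟩) key⟩

theorem IsInvariant.inner_one_gen (x : (M.gen π h).domain) :
    inner ℝ (oneL2 π) (M.gen π h x) = 0 := by
  have h1 := generator_spec (fun t => kernelL2 (M.transition t) π (h t)) x
  have hcont : Continuous fun k : Lp ℝ 2 π => (inner ℝ (oneL2 π) k : ℝ) := by fun_prop
  refine tendsto_nhds_unique ((hcont.tendsto _).comp h1) ?_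
  refine tendsto_const_nhds.congr fun t => ?_
  rw [Function.comp_apply, inner_smul_right, inner_sub_right, h.inner_one_kernelL2, sub_self,
    mul_zero]

theorem IsInvariant.one_mem_adjoint_domain (hd : Dense ((M.gen π h).domain : Set (Lp ℝ 2 π))) :
    ∃ h1 : oneL2 π ∈ (M.gen π h).adjoint.domain, (M.gen π h).adjoint ⟨_, h1⟩ = 0 := by
  have h0 : ∀ x : (M.gen π h).domain, inner ℝ (0 : Lp ℝ 2 π) (x : Lp ℝ 2 π) =
      inner ℝ (oneL2 π) (M.gen π h x) := fun x => by rw [h.inner_one_gen, inner_zero_left]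
  have h1 := LinearPMap.mem_adjoint_domain_of_exists _ ⟨_, h0⟩
  exact ⟨h1, LinearPMap.adjoint_apply_eq hd ⟨_, h1⟩ h0⟩

/-- Since `X_0 = x` almost surely under `P^x`, the density at `x` can be moved inside the inner
integral as a function of `X_0`. -/
theorem lintegral_law_of_absolutelyContinuous (M : MarkovProcess E Ω) (π : Measure E)
    [IsProbabilityMeasure π] (μ : Measure E) [IsProbabilityMeasure μ] (hμ : μ ≪ π) {F : Ω → ℝ≥0∞}
    (hF : Measurable F) :
    ∫⁻ ω, F ω ∂(M.law μ) = ∫⁻ ω, μ.rnDeriv π (M.X 0 ω) * F ω ∂(M.law π) := by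
  have hm : Measurable fun ω => μ.rnDeriv π (M.X 0 ω) * F ω :=
    ((Measure.measurable_rnDeriv μ π).comp (M.measurable_X 0)).mul hF
  rw [M.lintegral_law μ hF, M.lintegral_law π hm,
    ← lintegral_rnDeriv_mul hμ (hF.lintegral_kernel.aemeasurable)]
  refine lintegral_congr fun x => ?_
  rw [← lintegral_const_mul _ hF]
  refine lintegral_congr_ae ?_
  filter_upwards [M.start x] with ω hω
  rw [hω]

theorem pathIntegral_const_mul (M : MarkovProcess E Ω) (V : E → ℝ) (l : ℝ) (t : ℝ≥0) (ω : Ω) :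
    M.pathIntegral (fun x => l * V x) t ω = l * M.pathIntegral V t ω :=
  intervalIntegral.integral_const_mul _ _

variable [PolishSpace E] [BorelSpace E] {V : E → ℝ} (hV : Measurable V) {C : ℝ}
  (hC : ∀ x, |V x| ≤ C)

theorem IsInvariant.feynmanKac_one (d : Lp ℝ 2 π) (t : ℝ≥0) :
    h.feynmanKac hV hC d t (oneL2 π) =
      ∫ ω, Real.exp (M.pathIntegral V t ω) * d (M.X 0 ω) ∂(M.law π) := by
  rw [feynmanKac, h.evalL2_one, inner_oneL2]
  exact integral_congr_ae (h.tilted_ae hV hC d t)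

include h hV hC in
theorem IsInvariant.integrable_tilted (d : Lp ℝ 2 π) (t : ℝ≥0) :
    Integrable (fun ω => Real.exp (M.pathIntegral V t ω) * d (M.X 0 ω)) (M.law π) :=
  (h.memLp_tilted hV hC d t).integrable (by norm_num)

/-- A change of time moves the exponent by at most `C |t - s|`, and nonnegativity of `d` lets this
be integrated. -/
theorem IsInvariant.feynmanKac_one_mul_exp_le {d : Lp ℝ 2 π} (hd : ∀ᵐ x ∂π, 0 ≤ d x) (s t : ℝ≥0) :
    h.feynmanKac hV hC d s (oneL2 π) * Real.exp (-(C * |(t : ℝ) - s|)) ≤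
      h.feynmanKac hV hC d t (oneL2 π) := by
  rw [h.feynmanKac_one, h.feynmanKac_one, ← integral_mul_const]
  refine integral_mono_ae ((h.integrable_tilted hV hC d s).mul_const _)
    (h.integrable_tilted hV hC d t) ?_
  filter_upwards [h.ae_comp hd 0] with ω hω
  rw [mul_right_comm, ← Real.exp_add]
  refine mul_le_mul_of_nonneg_right (Real.exp_le_exp.2 ?_) hω
  linarith [(abs_le.1 (M.abs_pathIntegral_sub_le hV hC ω s t)).1]

theorem IsInvariant.lintegral_exp_pathIntegral {μ : Measure E} [IsProbabilityMeasure μ]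
    (hμ : μ ≪ π) {d : Lp ℝ 2 π} (hd : d =ᵐ[π] fun x => (μ.rnDeriv π x).toReal) (t : ℝ≥0) :
    ∫⁻ ω, ENNReal.ofReal (Real.exp (M.pathIntegral V t ω)) ∂(M.law μ) =
      ENNReal.ofReal (h.feynmanKac hV hC d t (oneL2 π)) := by
  rw [M.lintegral_law_of_absolutelyContinuous π μ hμ
    (measurable_pathIntegral hV t).exp.ennreal_ofReal, h.feynmanKac_one,
    ofReal_integral_eq_lintegral_ofReal (h.integrable_tilted hV hC d t)]
  · refine lintegral_congr_ae ?_
    filter_upwards [h.ae_comp hd 0, h.ae_comp (Measure.rnDeriv_lt_top μ π) 0] with ω h1 h2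
    rw [h1, ENNReal.ofReal_mul (Real.exp_pos _).le, ENNReal.ofReal_toReal h2.ne, mul_comm]
  · filter_upwards [h.ae_comp hd 0] with ω h1
    rw [h1]
    exact mul_nonneg (Real.exp_pos _).le ENNReal.toReal_nonneg

include hV hC in
/-- The one-sided Bernstein inequality for the additive functional of a mean-zero function, for a
process satisfying a modified Poincaré inequality with constant `Λ`. -/
theorem IsInvariant.law_pathIntegral_gt_le {μ : Measure E} [IsProbabilityMeasure μ]
    (hμ : μ ≪ π) {d : Lp ℝ 2 π} (hd : d =ᵐ[π] fun x => (μ.rnDeriv π x).toReal)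
    {ε : ℝ} (hε0 : 0 ≤ ε) (hε1 : ε < 1) {B : Lp ℝ 2 π →L[ℝ] Lp ℝ 2 π}
    (hB : ∀ x, ‖B x‖ ≤ 1 / 2 * ‖x‖) (hBe : B (oneL2 π) = 0)
    (heB : ∀ x, inner ℝ (oneL2 π) (B x) = 0) {Λ : ℝ} (hΛ : 0 < Λ)
    (hA : ∀ y : (M.gen π h).domain, Λ * variance (y : Lp ℝ 2 π) π ≤
      modInner ε B (-(M.gen π h y)) y)
    (hV0 : ∫ x, V x ∂π = 0) {K : ℝ} (hVK : ∀ᵐ x ∂π, |V x| ≤ K) {v b s : ℝ}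
    (hv : (2 + ε) ^ 2 * (∫ x, V x ^ 2 ∂π) ≤ 2 * Λ * v) (hb : (1 + ε) * K ≤ Λ * b) (hv0 : 0 < v)
    (hb0 : 0 ≤ b) (hs : 0 < s) {T : ℝ≥0} (hT : 0 < T) :
    M.law μ {ω | √(2 * v * s) + b * s < 1 / T * M.pathIntegral V T ω} ≤
      ENNReal.ofReal (‖d‖ / √(1 - ε) * Real.exp (-(s * T))) := by
  have hT' : (0 : ℝ) < T := hT
  set w := √(2 * v * s) with hw
  have hw0 : 0 < w := Real.sqrt_pos.2 (by positivity)
  have hw2 : w ^ 2 = 2 * v * s := Real.sq_sqrt (by positivity)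
  -- The minimiser of `l² v / (2(1 - lb)) - l (w + bs)` on `lb < 1`; the minimum is exactly `-s`.
  set l := w / (v + b * w) with hl
  have hden : 0 < v + b * w := by positivity
  have hl0 : 0 < l := by positivity
  have hlb : 1 - l * b = v / (v + b * w) := by
    rw [hl]
    field_simp
    ring
  have hlb1 : l * b < 1 := by
    have : 0 < v / (v + b * w) := by positivity
    linarith
  set κ := l ^ 2 * v / (2 * (1 - l * b)) with hκ
  have hopt : κ - l * (w + b * s) = -s := by
    rw [hκ, hlb, hl]
    field_simp
    linear_combination hw2 * (-1)
  have hlV : Measurable fun x => l * V x := hV.const_mul l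
  have hlC : ∀ x, |l * V x| ≤ l * C := fun x => by
    rw [abs_mul, abs_of_pos hl0]
    exact mul_le_mul_of_nonneg_left (hC x) hl0.le
  have hdiss : ∀ y : (M.gen π h).domain,
      modInner ε B (M.gen π h y + mulL2 π hlV hlC y) y ≤ κ * modInner ε B y y := fun y => by
    rw [mulL2_const_mul hV hC]
    have hA' := hA y
    rw [variance_eq_norm_sq] at hA'
    refine modInner_perturbation_le hε0 hB hε1.le (norm_oneL2 π) hBe heB
      (inner_mulL2_comm hV hC) ?_ (norm_mulL2_le hV hC hVK) hΛ ?_ hb hl0.le hlb1 hA'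
    · rw [inner_mulL2_one, hV0]
    · rw [norm_mulL2_one_sq]
      exact hv
  have hd0 : ∀ᵐ x ∂π, 0 ≤ d x := by
    filter_upwards [hd] with x hx
    rw [hx]
    exact ENNReal.toReal_nonneg
  have hFK := h.feynmanKac_le_exp hlV hlC
    (h.feynmanKac_one_mul_exp_le hlV hlC hd0) hε1 (le_modInner_self hε0 hB) hdiss hT
  have hone : modInner ε B (oneL2 π) (oneL2 π) = 1 := by
    rw [modInner_right_eq_inner hBe heB, real_inner_self_eq_norm_sq, norm_oneL2, one_pow]
  rw [hone, Real.sqrt_div zero_le_one, Real.sqrt_one, mul_one_div] at hFK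
  have hsub : {ω | w + b * s < 1 / T * M.pathIntegral V T ω} ⊆
      {ω | ENNReal.ofReal (Real.exp (l * (w + b * s) * T)) ≤
        ENNReal.ofReal (Real.exp (M.pathIntegral (fun x => l * V x) T ω))} := fun ω hω => by
    refine ENNReal.ofReal_le_ofReal (Real.exp_le_exp.2 ?_)
    rw [M.pathIntegral_const_mul, mul_assoc]
    refine mul_le_mul_of_nonneg_left ?_ hl0.le
    have h1 : w + b * s < 1 / T * M.pathIntegral V T ω := hω
    rw [one_div_mul_eq_div, lt_div_iff₀ hT'] at h1
    exact h1.le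
  have hcheb := mul_meas_ge_le_lintegral (μ := M.law μ)
    (measurable_pathIntegral (M := M) hlV T).exp.ennreal_ofReal
    (ENNReal.ofReal (Real.exp (l * (w + b * s) * T)))
  rw [h.lintegral_exp_pathIntegral hlV hlC hμ hd T] at hcheb
  have hexp : ENNReal.ofReal (Real.exp (l * (w + b * s) * T)) ≠ 0 := by
    simpa using Real.exp_pos _
  refine (measure_mono hsub).trans ?_
  rw [mul_comm, ← ENNReal.le_div_iff_mul_le (Or.inl hexp) (Or.inl ENNReal.ofReal_ne_top),
    ← ENNReal.ofReal_div_of_pos (Real.exp_pos _)] at hcheb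
  refine hcheb.trans (ENNReal.ofReal_le_ofReal ?_)
  rw [div_le_iff₀ (Real.exp_pos _)]
  refine hFK.trans (le_of_eq ?_)
  rw [mul_assoc, ← Real.exp_add]
  congr 2
  linear_combination (T : ℝ) * hopt

end MarkovProcess

/-- The squares of `(lq - 1)ε + lp` and `(lq + 1)ε - lp` differ by `4 lq ε (lp - ε)`, which exceeds
`ε² R₀²` exactly under the bound on `ε`. A zero denominator would make that bound `0`. -/
theorem hypoGap_pos {lq lp R₀ ε : ℝ} (hlq : 0 ≤ lq) (hε0 : 0 < ε)
    (hε : ε < 4 * lq * lp / (4 * lq + R₀ ^ 2)) : 0 < hypoGap lq lp R₀ ε := by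
  have hden : 0 < 4 * lq + R₀ ^ 2 := by
    refine lt_of_le_of_ne (by positivity) fun h0 => ?_
    rw [← h0, div_zero] at hε
    exact hε.not_gt hε0
  have h1 : ε * (4 * lq + R₀ ^ 2) < 4 * lq * lp := (lt_div_iff₀ hden).1 hε
  have hlq' : 0 < lq := by
    refine lt_of_le_of_ne hlq fun h0 => ?_
    rw [← h0] at h1
    have : 0 ≤ ε * R₀ ^ 2 := by positivity
    linarith
  have h2 : ε < lp := by
    have h3 : 0 ≤ ε * R₀ ^ 2 := by positivity
    have h4 : lq * ε < lq * lp := by linarith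
    exact lt_of_mul_lt_mul_left h4 hlq
  have h5 : ε * (ε * (4 * lq + R₀ ^ 2)) < ε * (4 * lq * lp) := mul_lt_mul_of_pos_left h1 hε0
  have h6 : √(((lq + 1) * ε - lp) ^ 2 + ε ^ 2 * R₀ ^ 2) < (lq - 1) * ε + lp := by
    have h7 : 0 < lq * ε := by positivity
    rw [Real.sqrt_lt' (by linarith)]
    linarith
  rw [hypoGap]
  linarith

/-! ### Constants and the transport operator `TΠ`. -/

section TransportOp

variable {Q V Ω : Type*} [MeasurableSpace Q] [MeasurableSpace V] [MeasurableSpace Ω]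
  (ν : Measure Q) [IsProbabilityMeasure ν] (ρ : Measure V) [IsProbabilityMeasure ρ]

theorem velocityAverage_one : velocityAverage ν ρ (oneL2 (ν.prod ρ)) = oneL2 (ν.prod ρ) := by
  have h := ae_kernel_of_ae (refreshKernel_invariant ν ρ) (oneL2_ae (ν.prod ρ))
  refine Lp.ext ?_
  filter_upwards [kernelL2_ae (refreshKernel_invariant ν ρ) (oneL2 (ν.prod ρ)), h,
    oneL2_ae (ν.prod ρ)] with z h1 h2 h3
  rw [velocityAverage, h1, h3, integral_congr_ae h2]
  simp

variable [TopologicalSpace Q] [TopologicalSpace V] {ν ρ} {M : MarkovProcess (Q × V) Ω}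
  (h : M.IsInvariant (ν.prod ρ))
  (hA : Dense (((M.gen (ν.prod ρ) h).domain ⊓ (M.gen (ν.prod ρ) h).adjoint.domain :
    Submodule ℝ (Lp ℝ 2 (ν.prod ρ))) : Set (Lp ℝ 2 (ν.prod ρ))))

include hA

theorem transportOp_isClosed : (M.transportOp ν ρ h).IsClosed :=
  compOp_isClosed_of_fullOp (antisymmPart_isClosed hA) _

theorem transportOp_one : ∃ h1 : oneL2 (ν.prod ρ) ∈ (M.transportOp ν ρ h).domain,
    M.transportOp ν ρ h ⟨_, h1⟩ = 0 := by
  obtain ⟨h1, h2⟩ := h.one_mem_domain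
  obtain ⟨h3, h4⟩ := h.one_mem_adjoint_domain (hA.mono inf_le_left)
  obtain ⟨h5, h6⟩ := antisymmPart_apply_eq_zero h1 h3 h2 h4
  have h7 : oneL2 (ν.prod ρ) ∈ (fullOp (velocityAverage ν ρ)).domain := Submodule.mem_top
  have h8 : fullOp (velocityAverage ν ρ) ⟨_, h7⟩ = oneL2 (ν.prod ρ) := velocityAverage_one ν ρ
  have h9 : fullOp (velocityAverage ν ρ) ⟨_, h7⟩ ∈ (antisymmPart (M.gen (ν.prod ρ) h)).domain := by
    rwa [h8]
  refine ⟨(mem_compOp_domain _ _ _).2 ⟨h7, h9⟩, Eq.trans ?_ h6⟩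
  refine congrArg (antisymmPart (M.gen (ν.prod ρ) h)) ?_
  exact Subtype.ext h8

theorem inner_one_transportOp (w : (M.transportOp ν ρ h).domain) :
    inner ℝ (oneL2 (ν.prod ρ)) (M.transportOp ν ρ h w) = 0 := by
  obtain ⟨h1, h2⟩ := h.one_mem_domain
  obtain ⟨h3, h4⟩ := h.one_mem_adjoint_domain (hA.mono inf_le_left)
  exact inner_antisymmPart_eq_zero hA h1 h3 h2 h4 _

end TransportOp

/-! ### The two-sided inequality and the confidence interval. -/

namespace MarkovProcess

variable {E Ω : Type*} [TopologicalSpace E] [MeasurableSpace E] [MeasurableSpace Ω]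
  [PolishSpace E] [BorelSpace E] {M : MarkovProcess E Ω} {π : Measure E} [IsProbabilityMeasure π]
  (h : M.IsInvariant π) {V : E → ℝ} (hV : Measurable V) {C : ℝ} (hC : ∀ x, |V x| ≤ C)

include hV hC in
/-- The two-sided Bernstein inequality for the additive functional of a mean-zero function. -/
theorem IsInvariant.law_abs_pathIntegral_gt_le {μ : Measure E} [IsProbabilityMeasure μ]
    (hμ : μ ≪ π) {d : Lp ℝ 2 π} (hd : d =ᵐ[π] fun x => (μ.rnDeriv π x).toReal)
    {ε : ℝ} (hε0 : 0 ≤ ε) (hε1 : ε < 1) {B : Lp ℝ 2 π →L[ℝ] Lp ℝ 2 π}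
    (hB : ∀ x, ‖B x‖ ≤ 1 / 2 * ‖x‖) (hBe : B (oneL2 π) = 0)
    (heB : ∀ x, inner ℝ (oneL2 π) (B x) = 0) {Λ : ℝ} (hΛ : 0 < Λ)
    (hA : ∀ y : (M.gen π h).domain, Λ * variance (y : Lp ℝ 2 π) π ≤
      modInner ε B (-(M.gen π h y)) y)
    (hV0 : ∫ x, V x ∂π = 0) {K : ℝ} (hVK : ∀ᵐ x ∂π, |V x| ≤ K) {v b s : ℝ}
    (hv : (2 + ε) ^ 2 * (∫ x, V x ^ 2 ∂π) ≤ 2 * Λ * v) (hb : (1 + ε) * K ≤ Λ * b) (hv0 : 0 ≤ v)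
    (hb0 : 0 ≤ b) (hs : 0 < s) {T : ℝ≥0} (hT : 0 < T) :
    M.law μ {ω | √(2 * v * s) + b * s < |1 / T * M.pathIntegral V T ω|} ≤
      ENNReal.ofReal (2 * (‖d‖ / √(1 - ε) * Real.exp (-(s * T)))) := by
  have hneg : ∀ ω, M.pathIntegral (fun x => -V x) T ω = -M.pathIntegral V T ω := fun ω =>
    intervalIntegral.integral_neg
  -- The one-sided bound needs a positive variance parameter, but `v` may be `0`. It is enlarged by
  -- `1 / (n + 1)`; the resulting events increase with `n` and cover the wanted one.
  have hn : ∀ n : ℕ, M.law μ {ω | √(2 * (v + 1 / ((n : ℝ) + 1)) * s) + b * s <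
      |1 / T * M.pathIntegral V T ω|} ≤
      ENNReal.ofReal (2 * (‖d‖ / √(1 - ε) * Real.exp (-(s * T)))) := fun n => by
    have hpos : (0 : ℝ) < 1 / ((n : ℝ) + 1) := Nat.one_div_pos_of_nat
    have hv' : (2 + ε) ^ 2 * (∫ x, V x ^ 2 ∂π) ≤ 2 * Λ * (v + 1 / ((n : ℝ) + 1)) :=
      hv.trans (by gcongr; linarith)
    have h1 := h.law_pathIntegral_gt_le hV hC hμ hd hε0 hε1 hB hBe heB hΛ hA hV0 hVK hv' hb
      (by linarith) hb0 hs hT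
    have h2 := h.law_pathIntegral_gt_le (V := fun x => -V x) hV.neg (C := C)
      (by simpa using hC) hμ hd hε0 hε1 hB hBe heB hΛ hA
      (by rw [integral_neg, hV0, neg_zero]) (K := K) (by simpa using hVK)
      (v := v + 1 / ((n : ℝ) + 1)) (by simpa using hv') hb (by linarith) hb0 hs hT
    have h3 : {ω | √(2 * (v + 1 / ((n : ℝ) + 1)) * s) + b * s < |1 / T * M.pathIntegral V T ω|} ⊆
        {ω | √(2 * (v + 1 / ((n : ℝ) + 1)) * s) + b * s < 1 / T * M.pathIntegral V T ω} ∪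
        {ω | √(2 * (v + 1 / ((n : ℝ) + 1)) * s) + b * s <
          1 / T * M.pathIntegral (fun x => -V x) T ω} := fun ω hω => by
      rcases lt_abs.1 (Set.mem_ofPred_eq ▸ hω) with h4 | h4
      · exact Or.inl h4
      · refine Or.inr ?_
        rwa [Set.mem_ofPred_eq, hneg, mul_neg]
    refine (measure_mono h3).trans ((measure_union_le _ _).trans ((add_le_add h1 h2).trans ?_))
    rw [← ENNReal.ofReal_add (by positivity) (by positivity), two_mul]
  have hlim : Tendsto (fun n : ℕ => √(2 * (v + 1 / ((n : ℝ) + 1)) * s) + b * s) atTop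
      (𝓝 (√(2 * (v + 0) * s) + b * s)) := by
    refine Tendsto.add_const _ ((Real.continuous_sqrt.tendsto _).comp ?_)
    exact ((tendsto_one_div_add_atTop_nhds_zero_nat.const_add v).const_mul 2).mul_const s
  rw [add_zero] at hlim
  have hunion : {ω | √(2 * v * s) + b * s < |1 / T * M.pathIntegral V T ω|} ⊆
      ⋃ n : ℕ, {ω | √(2 * (v + 1 / ((n : ℝ) + 1)) * s) + b * s <
        |1 / T * M.pathIntegral V T ω|} := fun ω hω =>
    Set.mem_iUnion.2 (hlim.eventually_lt_const hω).exists
  have hmono : Monotone fun n : ℕ => {ω | √(2 * (v + 1 / ((n : ℝ) + 1)) * s) + b * s <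
      |1 / T * M.pathIntegral V T ω|} := fun m n hmn ω hω => by
    refine lt_of_le_of_lt ?_ (Set.mem_ofPred_eq ▸ hω)
    have := Nat.one_div_le_one_div (α := ℝ) hmn
    gcongr
  refine (measure_mono hunion).trans ?_
  rw [hmono.measure_iUnion]
  exact iSup_le hn

end MarkovProcess

theorem theorem1p1 {Q V Ω : Type*}
    [TopologicalSpace Q] [PolishSpace Q] [MeasurableSpace Q] [BorelSpace Q]
    [TopologicalSpace V] [PolishSpace V] [MeasurableSpace V] [BorelSpace V]
    [MeasurableSpace Ω] (M : MarkovProcess (Q × V) Ω)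
    (ν : Measure Q) [IsProbabilityMeasure ν] (ρ : Measure V) [IsProbabilityMeasure ρ]
    (hinv : M.IsInvariant (ν.prod ρ))
    (hA : Dense (((M.gen (ν.prod ρ) hinv).domain ⊓ (M.gen (ν.prod ρ) hinv).adjoint.domain :
      Submodule ℝ (Lp ℝ 2 (ν.prod ρ))) : Set (Lp ℝ 2 (ν.prod ρ))))
    (hTP : Dense ((M.transportOp ν ρ hinv).domain : Set (Lp ℝ 2 (ν.prod ρ))))
    (lq lp R₀ ε : ℝ) (hlq : 0 ≤ lq) (hlp : 0 ≤ lp) (hR₀ : 0 ≤ R₀)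
    (hε0 : 0 < ε) (hε1 : ε < 1) (hε : ε < 4 * lq * lp / (4 * lq + R₀ ^ 2))
    (hhypo : M.HypocoerciveEstimate ν ρ hinv ε (hypoGap lq lp R₀ ε))
    (μ : Measure (Q × V)) [IsProbabilityMeasure μ] (hμ : μ ≪ ν.prod ρ)
    (hμ2 : MemLp (fun x => (μ.rnDeriv (ν.prod ρ) x).toReal) 2 (ν.prod ρ))
    (f : Q × V → ℝ) (hf : Measurable f) (hfb : ∃ K, ∀ x, |f x| ≤ K)
    (T : ℝ) (hT : 0 < T) (δ : ℝ) (hδ0 : 0 < 1 - δ) (hδ1 : 1 - δ < 1)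
    (v b N r : ℝ)
    (hv : v = (1 + ε) * (1 - ε ^ 2 / 4) / (1 - ε) *
      (2 * variance f (ν.prod ρ) / hypoGap lq lp R₀ ε))
    (hb : b = (1 + ε) ^ 2 / (1 - ε) *
      ((eLpNorm (fun x => f x - ∫ y, f y ∂(ν.prod ρ)) ∞ (ν.prod ρ)).toReal / hypoGap lq lp R₀ ε))
    (hN : N = (eLpNorm (fun x => (μ.rnDeriv (ν.prod ρ) x).toReal) 2 (ν.prod ρ)).toReal / √(1 - ε))
    (hr : r = √(2 * v * (1 / T) * Real.log (2 * N / δ)) + b * (1 / T) * Real.log (2 * N / δ)) :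
    (M.law μ).real {ω | |(1 / T) * (∫ t in (0 : ℝ)..T, f (M.X t.toNNReal ω)) -
      ∫ y, f y ∂(ν.prod ρ)| ≤ r} ≥ 1 - δ := by
  set π := ν.prod ρ with hπ
  set Λ := hypoGap lq lp R₀ ε with hΛdef
  set m := ∫ y, f y ∂π with hm
  have hΛ : 0 < Λ := hypoGap_pos hlq hε0 hε
  have h1ε : 0 < 1 - ε := by linarith
  have hδ : 0 < δ := by linarith
  have hK := transportOp_isClosed hinv hA
  obtain ⟨he, hKe⟩ := transportOp_one hinv hA
  have hd := hμ2.coeFn_toLp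
  have hnorm : N = ‖hμ2.toLp _‖ / √(1 - ε) := by rw [hN, Lp.norm_toLp]
  -- Cauchy–Schwarz against the constant `1` shows that a probability density has norm at least `1`;
  -- this makes the logarithm, and so `s`, positive.
  have hN1 : 1 ≤ N := by
    have h1 : (1 : ℝ) ≤ ‖hμ2.toLp _‖ := by
      have h2 : inner ℝ (hμ2.toLp _) (oneL2 π) = (1 : ℝ) := by
        rw [inner_oneL2, integral_congr_ae hd, Measure.integral_toReal_rnDeriv hμ, probReal_univ]
      have h3 := real_inner_le_norm (hμ2.toLp _) (oneL2 π)
      rwa [h2, norm_oneL2, mul_one] at h3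
    rw [hnorm, le_div_iff₀ (Real.sqrt_pos.2 h1ε), one_mul]
    exact (Real.sqrt_le_one.2 (by linarith)).trans h1
  have hN0 : 0 < N := by linarith
  have hlog : 0 < Real.log (2 * N / δ) := Real.log_pos ((one_lt_div hδ).2 (by linarith))
  set s := 1 / T * Real.log (2 * N / δ) with hs
  have hs0 : 0 < s := by positivity
  -- `s` is chosen so that the two tails, each at most `N e^{-sT}`, add up to `δ`.
  have hexp : 2 * (N * Real.exp (-(s * T))) = δ := by
    have h1 : -(s * T) = -Real.log (2 * N / δ) := by
      rw [hs]
      field_simp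
    rw [h1, Real.exp_neg, Real.exp_log (by positivity)]
    field_simp
  obtain ⟨C, hC⟩ := hfb
  have hfint : Integrable f π := Integrable.of_bound hf.aestronglyMeasurable C (ae_of_all _ hC)
  have hV : Measurable fun x => f x - m := hf.sub_const m
  have hVC : ∀ x, |f x - m| ≤ C + |m| := fun x => (abs_sub _ _).trans (by linarith [hC x])
  have hV0 : ∫ x, (f x - m) ∂π = 0 := by
    rw [integral_sub hfint (integrable_const m), ← hm, integral_const, probReal_univ, one_smul,
      sub_self]
  have hVmem : MemLp (fun x => f x - m) ∞ π :=
    memLp_top_of_bound hV.aestronglyMeasurable (C + |m|) (ae_of_all _ hVC)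
  set K := (eLpNorm (fun x => f x - m) ∞ π).toReal with hKdef
  have hVK : ∀ᵐ x ∂π, |f x - m| ≤ K := by
    filter_upwards [ae_le_eLpNormEssSup (f := fun x => f x - m) (μ := π)] with x hx
    rw [← eLpNorm_exponent_top] at hx
    have h1 := ENNReal.toReal_mono hVmem.eLpNorm_ne_top hx
    rwa [toReal_enorm, Real.norm_eq_abs] at h1
  have hK0 : 0 ≤ K := ENNReal.toReal_nonneg
  have hvar : variance f π = ∫ x, (f x - m) ^ 2 ∂π := variance_eq_integral hf.aemeasurable
  have hvar0 : 0 ≤ variance f π := variance_nonneg f π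
  -- The stated `v` has room to spare: `(1 + ε)(4 - ε²) - (2 + ε)²(1 - ε) = 2ε(2 + ε) ≥ 0`.
  have hv' : (2 + ε) ^ 2 * (∫ x, (f x - m) ^ 2 ∂π) ≤ 2 * Λ * v := by
    have h1 : 2 * Λ * v = 4 * ((1 + ε) * (1 - ε ^ 2 / 4) / (1 - ε)) * variance f π := by
      rw [hv]
      field_simp
      ring
    rw [h1, ← hvar]
    refine mul_le_mul_of_nonneg_right ?_ hvar0
    rw [← mul_div_assoc, le_div_iff₀ h1ε]
    have : 0 ≤ ε * (2 + ε) := by positivity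
    linarith
  have hv0 : 0 ≤ v := by
    have h1 : 0 ≤ 2 * Λ * v := le_trans (by positivity) hv'
    exact nonneg_of_mul_nonneg_right h1 (by linarith)
  -- Here the slack is the factor `(1 + ε) / (1 - ε) ≥ 1`.
  have hb' : (1 + ε) * K ≤ Λ * b := by
    have h1 : Λ * b = (1 + ε) * K * ((1 + ε) / (1 - ε)) := by
      rw [hb]
      field_simp
    rw [h1]
    exact le_mul_of_one_le_right (by positivity) ((one_le_div h1ε).2 (by linarith))
  have hb0 : 0 ≤ b := by
    rw [hb]
    positivity
  have hTpos : 0 < T.toNNReal := Real.toNNReal_pos.2 hT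
  have key := hinv.law_abs_pathIntegral_gt_le hV hVC hμ hd hε0.le hε1 (norm_auxOp_apply_le hK hTP)
    (auxOp_apply_eq_zero hK hTP (inner_one_transportOp hinv hA))
    (inner_auxOp_eq_zero hK hTP ⟨_, he⟩ hKe) hΛ hhypo hV0 hVK hv' hb' hv0 hb0 hs0 hTpos
  rw [← hnorm, Real.coe_toNNReal T hT.le, hexp] at key
  have hpath : ∀ ω, 1 / T * M.pathIntegral (fun x => f x - m) T.toNNReal ω =
      1 / T * (∫ t in (0 : ℝ)..T, f (M.X t.toNNReal ω)) - m := fun ω => by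
    rw [MarkovProcess.pathIntegral, Real.coe_toNNReal T hT.le, intervalIntegral.integral_sub
      (M.intervalIntegrable_comp_X hf hC ω _ _) intervalIntegrable_const,
      intervalIntegral.integral_const, smul_eq_mul]
    field_simp
    ring
  have hr' : r = √(2 * v * s) + b * s := by
    rw [hr, hs]
    simp only [mul_assoc]
  simp only [hpath, ← hr'] at key
  have hmeas : MeasurableSet {ω | r < |1 / T * (∫ t in (0 : ℝ)..T, f (M.X t.toNNReal ω)) - m|} := by
    simp only [← hpath]
    exact measurableSet_lt measurable_const
      ((MarkovProcess.measurable_pathIntegral hV T.toNNReal).const_mul (1 / T)).abs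
  have hcompl : {ω | |1 / T * (∫ t in (0 : ℝ)..T, f (M.X t.toNNReal ω)) - m| ≤ r} =
      {ω | r < |1 / T * (∫ t in (0 : ℝ)..T, f (M.X t.toNNReal ω)) - m|}ᶜ := by
    ext ω
    simp
  rw [hcompl, probReal_compl_eq_one_sub hmeas]
  have := ENNReal.toReal_le_of_le_ofReal hδ.le key
  rw [← measureReal_def] at this
  linarith

end
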